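/- Let $(\mathcal V,\otimes,\mathcal I)$ be a symmetric monoidal category that has all small colimits, and assume that $\otimes$ preserves small colimits in each variable (as holds, for example, if $\mathcal V$ is cocomplete and closed). Write $\emptyset$ for the initial object. Let $\Lambda$ be the category of the finite based sets $\mathbf n=\{0,1,\dots,n\}$, $n\ge 0$, with base point $0$, and based injections; it is symmetric monoidal under the wedge sum $\mathbf m\vee\mathbf n=\mathbf{m+n}$. A *$\Lambda$-sequence* is a functor $\mathcal D\colon\Lambda^{op}\to\mathcal V$ together with a base map $\eta\colon\mathcal I\to\mathcal D(\mathbf 0)$; a morphism of $\Lambda$-sequences is a natural transformation compatible with the base maps. Equivalently, if $\mathcal I_0$ denotes the functor with $\mathcal I_0(\mathbf 0)=\mathcal I$ and $\mathcal I_0(\mathbf n)=\emptyset$ for $n>0$, a $\Lambda$-sequence is a functor under $\mathcal I_0$, and we write $\Lambda^{op}[\mathcal V]_{\mathcal I_0}$ for their category. A $\Lambda$-sequence is *unital* if its base map is an isomorphism (identifying $\mathcal D(\mathbf 0)$ with $\mathcal I$); $\Lambda^{op}_{\mathcal I}[\mathcal V]$ denotes the full subcategory of the unital ones. Let $\boxtimes$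 be the Day convolution on functors $\Lambda^{op}\to\mathcal V$, that is, the left Kan extension of $(\mathbf m,\mathbf n)\mapsto\mathcal D(\mathbf m)\otimes\mathcal E(\mathbf n)$ along $\vee$; it is symmetric monoidal with unit $\mathcal I_0$. For a $\Lambda$-sequence $\mathcal E$, let $\mathcal E^{\boxtimes k}$ be the $k$-fold power, with $\mathcal E^{\boxtimes 0}=\mathcal I_0$. These powers form a covariant functor of $\mathbf k\in\Lambda$: an injection $f\colon\mathbf j\to\mathbf k$ sends the $i$-th factor to the $f(i)$-th factor and inserts the map $\mathcal I_0\to\mathcal E$ given by $\eta$ in the factors not in the image of $f$. Define the *Kelly product* of $\Lambda$-sequences by $$(\mathcal D\odot\mathcal E)(\mathbf n)=\mathcal D\otimes_\Lambda\mathcal E^{\boxtimes *}(\mathbf n)=\int^{\mathbf k\in\Lambda}\mathcal D(\mathbf k)\otimes\mathcal E^{\boxtimes k}(\mathbf n),$$ with base map the composite $\mathcal I\to\mathcal D(\mathbf 0)\cong\mathcal D(\mathbf 0)\otimes\mathcal E^{\boxtimes 0}(\mathbf 0)\to(\mathcal D\odot\mathcal E)(\mathbf 0)$ of $\eta$ and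 the component $\mathbf k=\mathbf 0$ of the coend. Let $\mathcal I_1$ be the $\Lambda$-sequence with $\mathcal I_1(\mathbf 0)=\mathcal I_1(\mathbf 1)=\mathcal I$ and $\mathcal I_1(\mathbf n)=\emptyset$ for $n>1$, where $\mathbf 0\to\mathbf 1$ induces the identity of $\mathcal I$ and the base map is the identity. Let $\Lambda^{op}[\mathcal V]_{\mathcal I_1}$ be the category of $\Lambda$-sequences under $\mathcal I_1$, let $\mathcal V_{\mathcal I}$ be the category of objects of $\mathcal V$ under $\mathcal I$, and let $i_1\colon\mathcal V_{\mathcal I}\to\Lambda^{op}[\mathcal V]_{\mathcal I_1}$ be the functor $i_1X=X\otimes\mathcal I_1$, with levelwise $\otimes$ and the structure maps induced by $\mathcal I\to X$. The category $\mathcal V_{\mathcal I}$ is monoidal under $\otimes$ with unit $\mathcal I$, where $X\otimes Y$ has the structure map $\mathcal I\cong\mathcal I\otimes\mathcal I\to X\otimes Y$. **Theorem.** Under the Kelly product $\odot$, the category $\Lambda^{op}[\mathcal V]_{\mathcal I_0}$ of $\Lambda$-sequences is a monoidal category with unit object $\mathcal I_1$: there are natural associativity and left and right unit isomorphisms for $\odot$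 and $\mathcal I_1$ that satisfy the coherence conditions of a monoidal category. They can be chosen such that the following also holds. 1. The full subcategory $\Lambda^{op}_{\mathcal I}[\mathcal V]$ of unital $\Lambda$-sequences contains $\mathcal I_1$ and is closed under $\odot$, and hence is a monoidal category under $\odot$ with unit object $\mathcal I_1$. 2. With the associativity and unit isomorphisms of the $\Lambda$-sequences, $\Lambda^{op}[\mathcal V]_{\mathcal I_1}$ is a monoidal category under $\odot$ with unit object $\mathcal I_1$ (under itself by the identity), where $\mathcal D\odot\mathcal E$ has the structure map $\mathcal I_1\cong\mathcal I_1\odot\mathcal I_1\to\mathcal D\odot\mathcal E$. 3. The functor $i_1\colon(\mathcal V_{\mathcal I},\otimes,\mathcal I)\to(\Lambda^{op}[\mathcal V]_{\mathcal I_1},\odot,\mathcal I_1)$ admits the structure of a strong monoidal functor. -/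

import Mathlib

open CategoryTheory MonoidalCategory Opposite Limits

/-- The category `Λ` of the finite based sets `{0, 1, …, n}`, with base point `0`, and the based
injections. A based injection is determined by its restriction to the elements other than the base
point, so that the morphisms from `m` to `n` are the injections `Fin m ↪ Fin n`. -/
structure LambdaCat : Type where
  card : ℕ

namespace LambdaCat

instance : Category LambdaCat where
  Hom m n := Fin m.card ↪ Fin n.card
  id n := Function.Embedding.refl _
  comp f g := f.trans g

/-- The injection underlying a morphism. -/
def inj {m n : LambdaCat} (f : m ⟶ n) : Fin m.card ↪ Fin n.card := f

/-- Auxiliary: `f` extended by a shift to all natural numbers. -/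
def shift {m n : LambdaCat} (f : m ⟶ n) (i : ℕ) : ℕ :=
  if h : i < m.card then inj f ⟨i, h⟩ else i - m.card + n.card

lemma shift_lt {m n : LambdaCat} (f : m ⟶ n) (i : ℕ) : shift f i < n.card ↔ i < m.card := by
  unfold shift
  split_ifs with h
  · simp [h]
  · simp [h]

lemma hom_ext_shift {m n : LambdaCat} {f g : m ⟶ n} (h : ∀ i, shift f i = shift g i) : f = g :=
  DFunLike.ext (F := Fin m.card ↪ Fin n.card) _ _ fun i => Fin.ext (by
    have := h i
    simp only [shift, i.2, dif_pos] at this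
    exact this)

lemma shift_id (n : LambdaCat) (i : ℕ) : shift (𝟙 n) i = i := by
  unfold shift
  split_ifs with h
  · rfl
  · omega

lemma shift_comp {m n p : LambdaCat} (f : m ⟶ n) (g : n ⟶ p) (i : ℕ) :
    shift (f ≫ g) i = shift g (shift f i) := by
  by_cases h : i < m.card
  · have h2 : shift f i = inj f ⟨i, h⟩ := dif_pos h
    have h3 : shift (f ≫ g) i = inj g (inj f ⟨i, h⟩) := dif_pos h
    rw [h3, h2, shift, dif_pos (inj f ⟨i, h⟩).2]
  · have h2 : shift f i = i - m.card + n.card := dif_neg h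
    have h3 : shift (f ≫ g) i = i - m.card + p.card := dif_neg h
    rw [h3, h2, shift, dif_neg (by omega)]
    omega

/-- A bijection of finite sets as an isomorphism. -/
def isoMk {m n : LambdaCat} (e : Fin m.card ≃ Fin n.card) : m ≅ n where
  hom := e.toEmbedding
  inv := e.symm.toEmbedding
  hom_inv_id := DFunLike.ext (F := Fin m.card ↪ Fin m.card) _ _ e.symm_apply_apply
  inv_hom_id := DFunLike.ext (F := Fin n.card ↪ Fin n.card) _ _ e.apply_symm_apply

lemma shift_cast {m n : LambdaCat} (h : m.card = n.card) (i : ℕ) :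
    shift (isoMk (finCongr h)).hom i = i := by
  unfold shift
  split_ifs with h
  · rfl
  · omega

/-- The wedge of two injections, for the identification of `m ∨ n` with `m + n` in blocks. -/
def wedge {m n m' n' : LambdaCat} (f : m ⟶ m') (g : n ⟶ n') :
    (⟨m.card + n.card⟩ : LambdaCat) ⟶ ⟨m'.card + n'.card⟩ :=
  (finSumFinEquiv.symm.toEmbedding.trans (f.sumMap g)).trans finSumFinEquiv.toEmbedding

lemma shift_wedge {m n m' n' : LambdaCat} (f : m ⟶ m') (g : n ⟶ n') (i : ℕ) :
    shift (wedge f g) i = if i < m.card then shift f i else m'.card + shift g (i - m.card) := by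
  unfold shift
  by_cases h : i < m.card + n.card
  · rw [dif_pos h]
    generalize hj : (⟨i, h⟩ : Fin (m.card + n.card)) = j
    obtain rfl : i = j := congrArg Fin.val hj
    induction j using Fin.addCases with
    | left k => simp [wedge, inj]
    | right k => simp [wedge, inj]
  · rw [dif_neg h, if_neg (by omega), dif_neg (by omega)]
    dsimp only
    omega

/-- `Λ` is (strictly associative) symmetric monoidal under wedge. -/
instance : MonoidalCategoryStruct LambdaCat where
  tensorObj m n := ⟨m.card + n.card⟩
  tensorHom f g := wedge f g
  whiskerLeft m _ _ f := wedge (𝟙 m) f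
  whiskerRight f n := wedge f (𝟙 n)
  tensorUnit := ⟨0⟩
  associator a b c := isoMk (finCongr (Nat.add_assoc a.card b.card c.card))
  leftUnitor a := isoMk (finCongr (Nat.zero_add a.card))
  rightUnitor a := isoMk (finCongr (Nat.add_zero a.card))

lemma shift_tensorHom {m n m' n' : LambdaCat} (f : m ⟶ m') (g : n ⟶ n') (i : ℕ) :
    shift (f ⊗ₘ g) i = if i < m.card then shift f i else m'.card + shift g (i - m.card) :=
  shift_wedge f g i
lemma shift_whiskerLeft {m n n' : LambdaCat} (g : n ⟶ n') (i : ℕ) :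
    shift (m ◁ g) i = if i < m.card then i else m.card + shift g (i - m.card) := by
  have := shift_wedge (𝟙 m) g i
  rwa [shift_id] at this
lemma shift_whiskerRight {m n m' : LambdaCat} (f : m ⟶ m') (i : ℕ) :
    shift (f ▷ n) i = if i < m.card then shift f i else m'.card + (i - m.card) := by
  have := shift_wedge f (𝟙 n) i
  rwa [shift_id] at this
lemma shift_associator (a b c : LambdaCat) (i : ℕ) : shift (α_ a b c).hom i = i := shift_cast _ i
lemma shift_leftUnitor (a : LambdaCat) (i : ℕ) : shift (λ_ a).hom i = i := shift_cast _ i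
lemma shift_rightUnitor (a : LambdaCat) (i : ℕ) : shift (ρ_ a).hom i = i := shift_cast _ i
lemma card_tensor (m n : LambdaCat) : (m ⊗ n).card = m.card + n.card := rfl
lemma card_unit : (𝟙_ LambdaCat).card = 0 := rfl

instance : MonoidalCategory LambdaCat where
  tensorHom_def {m m' n n'} f g := hom_ext_shift fun i => by
    simp only [shift_tensorHom, shift_comp, shift_whiskerLeft, shift_whiskerRight]
    have := shift_lt f i
    grind
  id_tensorHom_id m n := hom_ext_shift fun i => by
    simp only [shift_tensorHom, shift_id]; grind
  tensorHom_comp_tensorHom f g f' g' := hom_ext_shift fun i => by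
    simp only [shift_tensorHom, shift_comp]
    have := shift_lt f i
    grind
  whiskerLeft_id m n := hom_ext_shift fun i => by
    simp only [shift_whiskerLeft, shift_id]; grind
  id_whiskerRight m n := hom_ext_shift fun i => by
    simp only [shift_whiskerRight, shift_id]; grind
  associator_naturality {a b c a' b' c'} f g h := hom_ext_shift fun i => by
    simp only [shift_tensorHom, shift_comp, shift_associator, card_tensor]
    grind
  leftUnitor_naturality f := hom_ext_shift fun i => by
    simp only [shift_whiskerLeft, shift_comp, shift_leftUnitor, card_unit]
    grind
  rightUnitor_naturality f := hom_ext_shift fun i => by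
    simp only [shift_whiskerRight, shift_comp, shift_rightUnitor]
    simp only [shift]
    grind
  pentagon a b c d := hom_ext_shift fun i => by
    simp only [shift_whiskerLeft, shift_whiskerRight, shift_comp, shift_associator, card_tensor]
    grind
  triangle a b := hom_ext_shift fun i => by
    simp only [shift_whiskerLeft, shift_whiskerRight, shift_comp, shift_associator, shift_leftUnitor,
      shift_rightUnitor, card_tensor, card_unit]
    grind

/-- The block transposition, which is the interchange of the two wedge summands. -/
def flip (m n : LambdaCat) : m ⊗ n ≅ n ⊗ m := isoMk finAddFlip

lemma shift_flip (m n : LambdaCat) (i : ℕ) : shift (flip m n).hom i =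
    if i < m.card then n.card + i else if i < m.card + n.card then i - m.card else i := by
  unfold shift
  by_cases h : i < m.card + n.card
  · rw [dif_pos (by exact h)]
    obtain ⟨j, rfl⟩ : ∃ j : Fin (m.card + n.card), i = j := ⟨⟨i, h⟩, rfl⟩
    change ((finAddFlip j : Fin (n.card + m.card)) : ℕ) = _
    refine Fin.addCases (fun k => ?_) (fun k => ?_) j
    · simp
    · simp
  · rw [dif_neg (by exact h), if_neg (by omega), if_neg h]
    simp only [card_tensor]
    omega

instance : SymmetricCategory LambdaCat where
  braiding m n := flip m n
  braiding_naturality_left {a a'} f c := hom_ext_shift fun i => by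
    simp only [shift_whiskerLeft, shift_whiskerRight, shift_comp, shift_flip]
    have := shift_lt f i
    simp only [shift] at *
    grind
  braiding_naturality_right c _ _ f := hom_ext_shift fun i => by
    simp only [shift_whiskerLeft, shift_whiskerRight, shift_comp, shift_flip]
    have := shift_lt f (i - c.card)
    simp only [shift] at *
    grind
  symmetry m n := hom_ext_shift fun i => by
    simp only [shift_comp, shift_flip, shift_id]
    grind
  hexagon_forward a b c := hom_ext_shift fun i => by
    simp only [shift_whiskerLeft, shift_whiskerRight, shift_comp, shift_flip, shift_associator, card_tensor]
    grind
  hexagon_reverse a b c := hom_ext_shift fun i => by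
    have h (a b c : LambdaCat) (i : ℕ) : shift (α_ a b c).inv i = i := shift_cast (Nat.add_assoc _ _ _).symm i
    simp only [shift_whiskerLeft, shift_whiskerRight, shift_comp, shift_flip, h, card_tensor]
    grind

/-- For `f : {1..m+1} → {1..n+1}` injective, delete `j` and its image. -/
def remove {m n : ℕ} (f : Fin (m + 1) ↪ Fin (n + 1)) (j : Fin (m + 1)) : Fin m ↪ Fin n where
  toFun k := (finSuccAboveEquiv (f j)).symm
    ⟨f (j.succAbove k), fun h => Fin.succAbove_ne j k (f.injective h)⟩
  inj' k l h := by
    have := congrArg Subtype.val ((finSuccAboveEquiv (f j)).symm.injective h)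
    exact Fin.succAbove_right_injective (f.injective this)

lemma succAbove_remove {m n : ℕ} (f : Fin (m + 1) ↪ Fin (n + 1)) (j : Fin (m + 1)) (k : Fin m) :
    (f j).succAbove (remove f j k) = f (j.succAbove k) :=
  congrArg Subtype.val ((finSuccAboveEquiv (f j)).apply_symm_apply
    ⟨f (j.succAbove k), fun h => Fin.succAbove_ne j k (f.injective h)⟩)

lemma remove_eq {m n : ℕ} (f : Fin (m + 1) ↪ Fin (n + 1)) (j : Fin (m + 1)) (g : Fin m ↪ Fin n)
    (h : ∀ k, (f j).succAbove (g k) = f (j.succAbove k)) : remove f j = g :=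
  DFunLike.ext _ _ fun k => Fin.succAbove_right_injective (p := f j) <| by
    rw [succAbove_remove, h]

lemma remove_refl (m : ℕ) (j : Fin (m + 1)) :
    remove (Function.Embedding.refl _) j = Function.Embedding.refl (Fin m) :=
  remove_eq _ _ _ fun _ => rfl

lemma remove_trans {m n p : ℕ} (f : Fin (m + 1) ↪ Fin (n + 1)) (g : Fin (n + 1) ↪ Fin (p + 1))
    (j : Fin (m + 1)) : remove (f.trans g) j = (remove f j).trans (remove g (f j)) :=
  remove_eq _ _ _ fun k => by
    change (g (f j)).succAbove (remove g (f j) (remove f j k)) = g (f (j.succAbove k))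
    rw [succAbove_remove, succAbove_remove]

lemma succAbove_exchange {n : ℕ} {a a' : Fin (n + 1)} {b b' : Fin (n + 2)}
    (h : b.succAbove a = b') (h' : b'.succAbove a' = b) (t : Fin n) :
    b.succAbove (a.succAbove t) = b'.succAbove (a'.succAbove t) := by
  subst h
  simp only [Fin.succAbove, Fin.lt_def, Fin.ext_iff] at h' ⊢
  split_ifs at h' ⊢ <;> simp_all <;> omega

lemma remove_remove {m n : ℕ} (f : Fin (m + 2) ↪ Fin (n + 2)) (j : Fin (m + 1)) :
    remove (remove f 0) j = remove (remove f j.succ) 0 := by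
  refine remove_eq _ _ _ fun k => ?_
  apply Fin.succAbove_right_injective (p := f 0)
  have h1 : (f 0).succAbove (remove f 0 j) = f j.succ := succAbove_remove f 0 j
  have h2 : (f j.succ).succAbove (remove f j.succ 0) = f 0 := succAbove_remove f j.succ 0
  rw [succAbove_remove, succAbove_exchange h1 h2, succAbove_remove, succAbove_remove]
  refine congrArg f ?_
  simp
end LambdaCat

universe v u

noncomputable section Pow
variable {W : Type u} [Category.{v} W] [MonoidalCategory W] [SymmetricCategory W]

/-- `X ⊗ (X ⊗ ⋯)`, with `tpow X 0 = 𝟙_`. -/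
@[reducible] def tpow (X : W) : ℕ → W
  | 0 => 𝟙_ W
  | n + 1 => X ⊗ tpow X n

/-- The interchange of the first two factors. -/
def swapFirst (X Y Z : W) : X ⊗ (Y ⊗ Z) ⟶ Y ⊗ (X ⊗ Z) :=
  (α_ X Y Z).inv ≫ (β_ X Y).hom ▷ Z ≫ (α_ Y X Z).hom

lemma swapFirst_swapFirst (X Y Z : W) : swapFirst X Y Z ≫ swapFirst Y X Z = 𝟙 _ := by
  simp [swapFirst, ← comp_whiskerRight_assoc]

lemma swapFirst_natural {X X' Y Y' Z Z' : W} (f : X ⟶ X') (g : Y ⟶ Y') (h : Z ⟶ Z') :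
    (f ⊗ₘ (g ⊗ₘ h)) ≫ swapFirst X' Y' Z' = swapFirst X Y Z ≫ (g ⊗ₘ (f ⊗ₘ h)) := by
  simp only [swapFirst, Category.assoc]
  rw [associator_inv_naturality_assoc, ← associator_naturality]
  rw [← tensorHom_id, ← tensorHom_id, tensorHom_comp_tensorHom_assoc,
    tensorHom_comp_tensorHom_assoc, BraidedCategory.braiding_naturality, Category.comp_id,
    Category.id_comp]

lemma swapFirst_whisker (X Y : W) {Z Z' : W} (h : Z ⟶ Z') :
    X ◁ Y ◁ h ≫ swapFirst X Y Z' = swapFirst X Y Z ≫ Y ◁ X ◁ h := by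
  simpa using swapFirst_natural (𝟙 X) (𝟙 Y) h

lemma swapFirst_braid (X Y Z T : W) :
    swapFirst X Y (Z ⊗ T) ≫ Y ◁ swapFirst X Z T ≫ swapFirst Y Z (X ⊗ T) =
      X ◁ swapFirst Y Z T ≫ swapFirst X Z (Y ⊗ T) ≫ Z ◁ swapFirst X Y T := by
  simp only [swapFirst]
  calc
    _ = 𝟙 _ ⊗≫ ((β_ X Y).hom ▷ Z ⊗≫ Y ◁ (β_ X Z).hom ⊗≫ (β_ Y Z).hom ▷ X) ▷ T ⊗≫ 𝟙 _ := by
      monoidal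
    _ = _ := by
      rw [BraidedCategory.yang_baxter']
      monoidal

/-- Insert the first factor of `X ⊗ X^n` in position `j`. -/
def insertAt (X : W) : (n : ℕ) → Fin (n + 1) → (X ⊗ tpow X n ⟶ tpow X (n + 1))
  | 0, _ => 𝟙 _
  | n + 1, j => Fin.cases (motive := fun _ => X ⊗ tpow X (n + 1) ⟶ tpow X (n + 2)) (𝟙 _)
      (fun i => swapFirst X X (tpow X n) ≫ X ◁ insertAt X n i) j

lemma insertAt_zero (X : W) (n : ℕ) : insertAt X n 0 = 𝟙 _ := by
  cases n <;> rfl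

lemma insertAt_succ (X : W) (n : ℕ) (i : Fin (n + 1)) :
    insertAt X (n + 1) i.succ = swapFirst X X (tpow X n) ≫ X ◁ insertAt X n i := rfl

lemma insertAt_exchange (X : W) (n : ℕ) (a a' : Fin (n + 1)) (b b' : Fin (n + 2))
    (h : b.succAbove a = b') (h' : b'.succAbove a' = b) :
    swapFirst X X (tpow X n) ≫ X ◁ insertAt X n a ≫ insertAt X (n + 1) b =
      X ◁ insertAt X n a' ≫ insertAt X (n + 1) b' := by
  induction n with
  | zero =>
    obtain rfl : a = 0 := Fin.fin_one_eq_zero _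
    obtain rfl : a' = 0 := Fin.fin_one_eq_zero _
    subst h
    have h0 : ∀ c : Fin 2, c = 0 ∨ c = Fin.succ 0 := by decide
    rcases h0 b with rfl | rfl
    · rw [Fin.zero_succAbove, insertAt_zero, insertAt_zero, insertAt_succ]
      simp [insertAt_zero]
    · rw [Fin.succ_succAbove_zero, insertAt_zero, insertAt_zero, insertAt_succ]
      simp [insertAt_zero, swapFirst_swapFirst]
  | succ n ih =>
    subst h
    induction b using Fin.cases with
    | zero =>
      rw [Fin.zero_succAbove] at h' ⊢
      obtain rfl : a' = 0 := by
        by_contra hne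
        obtain ⟨c, rfl⟩ := Fin.exists_succ_eq.2 hne
        rw [Fin.succ_succAbove_succ] at h'
        exact Fin.succ_ne_zero _ h'
      rw [insertAt_zero, insertAt_zero, insertAt_succ]
      simp
    | succ b =>
      induction a using Fin.cases with
      | zero =>
        rw [Fin.succ_succAbove_zero] at h' ⊢
        obtain rfl : a' = b := Fin.succ_injective _ (by simpa using h')
        rw [insertAt_zero, insertAt_zero, insertAt_succ, MonoidalCategory.whiskerLeft_id,
          Category.id_comp, reassoc_of% (swapFirst_swapFirst X X (tpow X (n + 1))), Category.comp_id]
      | succ a =>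
        rw [Fin.succ_succAbove_succ] at h' ⊢
        obtain ⟨c, rfl⟩ : ∃ c, a' = Fin.succ c := by
          refine (Fin.exists_succ_eq.2 ?_).imp fun _ h => h.symm
          rintro rfl
          rw [Fin.succ_succAbove_zero] at h'
          exact Fin.succ_ne_zero _ h'.symm
        rw [Fin.succ_succAbove_succ] at h'
        have key := ih a c b _ rfl (Fin.succ_injective _ h')
        simp only [insertAt_succ, MonoidalCategory.whiskerLeft_comp, Category.assoc]
        rw [reassoc_of% (swapFirst_whisker X X (insertAt X n a)), reassoc_of% (swapFirst_whisker X X (insertAt X n c))]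
        rw [← MonoidalCategory.whiskerLeft_comp, ← MonoidalCategory.whiskerLeft_comp, ← key]
        simp only [MonoidalCategory.whiskerLeft_comp]
        have := swapFirst_braid X X X (tpow X n)
        exact (reassoc_of% this) _

/-- The map `𝟙_ ⟶ X^n` given by `η` in each factor. -/
def unitPow {X : W} (η : 𝟙_ W ⟶ X) : (n : ℕ) → (𝟙_ W ⟶ tpow X n)
  | 0 => 𝟙 _
  | n + 1 => (λ_ (𝟙_ W)).inv ≫ (η ⊗ₘ unitPow η n)

lemma unitPow_insertAt {X : W} (η : 𝟙_ W ⟶ X) (n : ℕ) (j : Fin (n + 1)) :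
    unitPow η (n + 1) ≫ insertAt X n j = unitPow η (n + 1) := by
  induction n with
  | zero => exact Category.comp_id _
  | succ n ih =>
    induction j using Fin.cases with
    | zero => rw [insertAt_zero]; exact Category.comp_id _
    | succ j =>
      have h1 : 𝟙_ W ◁ (λ_ (𝟙_ W)).inv ≫ swapFirst (𝟙_ W) (𝟙_ W) (𝟙_ W) =
          𝟙_ W ◁ (λ_ (𝟙_ W)).inv := by
        simp [swapFirst, unitors_inv_equal]
      have h2 : unitPow η (n + 2) =
          (λ_ (𝟙_ W)).inv ≫ 𝟙_ W ◁ (λ_ (𝟙_ W)).inv ≫ (η ⊗ₘ (η ⊗ₘ unitPow η n)) := by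
        rw [← id_tensorHom, tensorHom_comp_tensorHom, Category.id_comp]
        rfl
      rw [insertAt_succ, h2]
      simp only [Category.assoc]
      rw [reassoc_of% (swapFirst_natural η η (unitPow η n)), reassoc_of% h1]
      have h3 : (λ_ (𝟙_ W)).inv ≫ (η ⊗ₘ unitPow η n) ≫ insertAt X n j =
          (λ_ (𝟙_ W)).inv ≫ (η ⊗ₘ unitPow η n) := (Category.assoc _ _ _).symm.trans (ih j)
      rw [← id_tensorHom, ← id_tensorHom X (insertAt X n j)]
      simp only [tensorHom_comp_tensorHom, Category.id_comp, Category.comp_id, h3]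

/-- The map `X^m ⟶ X^n` induced by an injection `f`: the factor `i` goes to the factor `f i`, and the
factors that are not in the image of `f` are filled with `η`. -/
def powMap {X : W} (η : 𝟙_ W ⟶ X) : {m n : ℕ} → (Fin m ↪ Fin n) → (tpow X m ⟶ tpow X n)
  | 0, n, _ => unitPow η n
  | _ + 1, 0, f => (f 0).elim0
  | _ + 1, n + 1, f => X ◁ powMap η (LambdaCat.remove f 0) ≫ insertAt X n (f 0)

lemma powMap_succ {X : W} (η : 𝟙_ W ⟶ X) {m n : ℕ} (f : Fin (m + 1) ↪ Fin (n + 1)) :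
    powMap η f = X ◁ powMap η (LambdaCat.remove f 0) ≫ insertAt X n (f 0) := by
  rw [powMap]

lemma powMap_refl {X : W} (η : 𝟙_ W ⟶ X) (n : ℕ) :
    powMap η (Function.Embedding.refl (Fin n)) = 𝟙 _ := by
  induction n with
  | zero => rw [powMap]; rfl
  | succ n ih =>
    rw [powMap_succ, LambdaCat.remove_refl, ih]
    simp [insertAt_zero]

lemma unitPow_powMap {X : W} (η : 𝟙_ W ⟶ X) {n p : ℕ} (g : Fin n ↪ Fin p) :
    unitPow η n ≫ powMap η g = unitPow η p := by
  induction n generalizing p with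
  | zero => rw [powMap, unitPow, Category.id_comp]
  | succ n ih =>
    obtain _ | p := p
    · exact (g 0).elim0
    · rw [powMap_succ, unitPow, Category.assoc, ← id_tensorHom, tensorHom_comp_tensorHom_assoc,
        ih, Category.comp_id, ← Category.assoc]
      exact unitPow_insertAt η p (g 0)

lemma insertAt_powMap {X : W} (η : 𝟙_ W ⟶ X) {n p : ℕ} (g : Fin (n + 1) ↪ Fin (p + 1))
    (j : Fin (n + 1)) :
    insertAt X n j ≫ powMap η g = X ◁ powMap η (LambdaCat.remove g j) ≫ insertAt X p (g j) := by
  induction n generalizing p with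
  | zero =>
    obtain rfl : j = 0 := Fin.fin_one_eq_zero _
    rw [insertAt_zero, powMap_succ]
    exact Category.id_comp _
  | succ n ih =>
    induction j using Fin.cases with
    | zero =>
      rw [insertAt_zero, powMap_succ]
      exact Category.id_comp _
    | succ j =>
      obtain _ | p := p
      · have := g.injective ((Fin.fin_one_eq_zero (g 0)).trans (Fin.fin_one_eq_zero (g j.succ)).symm)
        exact absurd this (Fin.succ_ne_zero j).symm
      · rw [insertAt_succ, powMap_succ η g, Category.assoc,
          ← MonoidalCategory.whiskerLeft_comp_assoc, ih, powMap_succ η (LambdaCat.remove g j.succ), LambdaCat.remove_remove]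
        have := insertAt_exchange X p (LambdaCat.remove g 0 j) (LambdaCat.remove g j.succ 0)
          (g 0) (g j.succ) (LambdaCat.succAbove_remove g 0 j) (LambdaCat.succAbove_remove g j.succ 0)
        simp only [MonoidalCategory.whiskerLeft_comp, Category.assoc]
        rw [← reassoc_of% (swapFirst_whisker X X (powMap η (LambdaCat.remove (LambdaCat.remove g j.succ) 0))), this]

lemma powMap_trans {X : W} (η : 𝟙_ W ⟶ X) {m n p : ℕ} (f : Fin m ↪ Fin n) (g : Fin n ↪ Fin p) :
    powMap η (f.trans g) = powMap η f ≫ powMap η g := by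
  induction m generalizing n p with
  | zero => rw [powMap, powMap, unitPow_powMap]
  | succ m ih =>
    obtain _ | n := n
    · exact (f 0).elim0
    obtain _ | p := p
    · exact (g 0).elim0
    rw [powMap_succ, LambdaCat.remove_trans, ih, powMap_succ η f, Category.assoc, insertAt_powMap,
      MonoidalCategory.whiskerLeft_comp, Category.assoc]
    rfl

/-- The `n`-th tensor power of a morphism. -/
def tpowHom {X Y : W} (φ : X ⟶ Y) : (n : ℕ) → (tpow X n ⟶ tpow Y n)
  | 0 => 𝟙 _
  | n + 1 => φ ⊗ₘ tpowHom φ n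

lemma tpowHom_id (X : W) (n : ℕ) : tpowHom (𝟙 X) n = 𝟙 _ := by
  induction n with
  | zero => rfl
  | succ n ih => rw [tpowHom, ih, id_tensorHom_id]

lemma tpowHom_comp {X Y Z : W} (φ : X ⟶ Y) (ψ : Y ⟶ Z) (n : ℕ) :
    tpowHom (φ ≫ ψ) n = tpowHom φ n ≫ tpowHom ψ n := by
  induction n with
  | zero => exact (Category.comp_id _).symm
  | succ n ih => rw [tpowHom, ih, ← tensorHom_comp_tensorHom]; rfl

lemma insertAt_natural {X Y : W} (φ : X ⟶ Y) (n : ℕ) (j : Fin (n + 1)) :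
    tpowHom φ (n + 1) ≫ insertAt Y n j = insertAt X n j ≫ tpowHom φ (n + 1) := by
  induction n with
  | zero => exact (Category.comp_id _).trans (Category.id_comp _).symm
  | succ n ih =>
    induction j using Fin.cases with
    | zero => 
      rw [insertAt_zero, insertAt_zero]
      exact (Category.comp_id _).trans (Category.id_comp _).symm
    | succ j =>
      rw [insertAt_succ, insertAt_succ, Category.assoc]
      have h : tpowHom φ (n + 1 + 1) = φ ⊗ₘ (φ ⊗ₘ tpowHom φ n) := rfl
      have h' : φ ⊗ₘ tpowHom φ n = tpowHom φ (n + 1) := rfl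
      rw [h, reassoc_of% (swapFirst_natural φ φ (tpowHom φ n)), h', ← id_tensorHom, ← id_tensorHom,
        tensorHom_comp_tensorHom, tensorHom_comp_tensorHom, ih, Category.comp_id, Category.id_comp]

lemma unitPow_natural {X Y : W} {η : 𝟙_ W ⟶ X} {θ : 𝟙_ W ⟶ Y} (φ : X ⟶ Y) (h : η ≫ φ = θ)
    (n : ℕ) : unitPow η n ≫ tpowHom φ n = unitPow θ n := by
  induction n with
  | zero => exact Category.comp_id _
  | succ n ih => rw [unitPow, unitPow, tpowHom, Category.assoc, tensorHom_comp_tensorHom, h, ih]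

lemma powMap_natural {X Y : W} {η : 𝟙_ W ⟶ X} {θ : 𝟙_ W ⟶ Y} (φ : X ⟶ Y) (h : η ≫ φ = θ)
    {m n : ℕ} (f : Fin m ↪ Fin n) :
    powMap η f ≫ tpowHom φ n = tpowHom φ m ≫ powMap θ f := by
  induction m generalizing n with
  | zero => rw [powMap, powMap, unitPow_natural φ h]; exact (Category.id_comp _).symm
  | succ m ih =>
    obtain _ | n := n
    · exact (f 0).elim0
    rw [powMap_succ, powMap_succ, Category.assoc, ← insertAt_natural, tpowHom, tpowHom,
      ← id_tensorHom, ← id_tensorHom, tensorHom_comp_tensorHom_assoc,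
      tensorHom_comp_tensorHom_assoc, ih, Category.comp_id, Category.id_comp]

/-- For `X` under the unit, the tensor powers of `X` as a covariant functor on `Λ`. -/
def tensorPowers (W : Type u) [Category.{v} W] [MonoidalCategory W] [SymmetricCategory W] :
    Under (𝟙_ W) ⥤ LambdaCat ⥤ W where
  obj X :=
    { obj := fun n => tpow X.right n.card
      map := fun f => powMap X.hom (LambdaCat.inj f)
      map_id := fun n => powMap_refl X.hom n.card
      map_comp := fun f g => powMap_trans X.hom (LambdaCat.inj f) (LambdaCat.inj g) }
  map φ :=
    { app := fun n => tpowHom φ.right n.card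
      naturality := fun _ _ f => powMap_natural φ.right (Under.w φ) (LambdaCat.inj f) }
  map_id X := by ext n; exact tpowHom_id _ _
  map_comp φ ψ := by ext n; exact tpowHom_comp _ _ _

end Pow

section Day
open MonoidalCategory.DayFunctor LawfulDayConvolutionMonoidalCategoryStruct
noncomputable section

instance opSymmetric {C : Type*} [Category C] [MonoidalCategory C] [SymmetricCategory C] :
    SymmetricCategory Cᵒᵖ where
  symmetry X Y := Quiver.Hom.unop_inj (SymmetricCategory.symmetry _ _)

section
variable (V : Type u) [Category.{v} V] [MonoidalCategory V] [SymmetricCategory V] [HasColimits V]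
  [∀ X : V, PreservesColimits (tensorLeft X)]

instance preservesColimits_tensorLeft (X : V) :
    PreservesColimitsOfSize.{0, 0} (tensorLeft X) :=
  preservesSmallestColimits_of_preservesColimits _

instance preservesColimits_tensorRight (X : V) :
    PreservesColimitsOfSize.{0, 0} (tensorRight X) :=
  preservesColimits_of_natIso (BraidedCategory.tensorLeftIsoTensorRight X)

/-- The functors `Λᵒᵖ ⥤ V`, with Day convolution `⊠` as the tensor product. -/
abbrev DayLambda := DayFunctor LambdaCatᵒᵖ V

instance (F G : LambdaCatᵒᵖ ⥤ V) : (tensor LambdaCatᵒᵖ).HasPointwiseLeftKanExtension (externalProduct F G) := inferInstance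
instance : (Functor.fromPUnit.{0} <| 𝟙_ LambdaCatᵒᵖ).HasPointwiseLeftKanExtension
        (Functor.fromPUnit.{0} <| 𝟙_ V) := inferInstance
instance : ∀ (v : V) (d : LambdaCatᵒᵖ), Limits.PreservesColimitsOfShape
      (CostructuredArrow (tensor LambdaCatᵒᵖ) d) (tensorLeft v) := inferInstance
instance : ∀ (v : V) (d : LambdaCatᵒᵖ), Limits.PreservesColimitsOfShape
      (CostructuredArrow (tensor LambdaCatᵒᵖ) d) (tensorRight v) := inferInstance
instance : ∀ (v : V) (d : LambdaCatᵒᵖ), Limits.PreservesColimitsOfShape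
      (CostructuredArrow (Functor.fromPUnit.{0} <| 𝟙_ LambdaCatᵒᵖ) d) (tensorLeft v) := inferInstance
instance : ∀ (v : V) (d : LambdaCatᵒᵖ), Limits.PreservesColimitsOfShape
      (CostructuredArrow (Functor.fromPUnit.{0} <| 𝟙_ LambdaCatᵒᵖ) d) (tensorRight v) := inferInstance
instance : ∀ (v : V) (d : LambdaCatᵒᵖ × LambdaCatᵒᵖ),
      Limits.PreservesColimitsOfShape
        (CostructuredArrow ((𝟭 LambdaCatᵒᵖ).prod <| Functor.fromPUnit.{0} <| 𝟙_ LambdaCatᵒᵖ) d)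
        (tensorRight v) := inferInstance
instance : ∀ (v : V) (d : LambdaCatᵒᵖ × LambdaCatᵒᵖ),
      Limits.PreservesColimitsOfShape
        (CostructuredArrow ((tensor LambdaCatᵒᵖ).prod (𝟭 LambdaCatᵒᵖ)) d) (tensorRight v) := inferInstance
instance : MonoidalCategory (DayLambda V) := inferInstance

variable {V}

/-- `F ⊗ G` as a Day convolution of the underlying functors. -/
@[reducible] def dayConv (F G : DayLambda V) : DayConvolution F.functor G.functor :=
  convolution LambdaCatᵒᵖ V (DayLambda V) F G

/-- The braiding of Day convolution. -/
def dayBraiding (F G : DayLambda V) : F ⊗ G ≅ G ⊗ F :=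
  let := dayConv F G
  let := dayConv G F
  { hom := ⟨(DayConvolution.braiding F.functor G.functor).hom⟩
    inv := ⟨(DayConvolution.braiding F.functor G.functor).inv⟩
    hom_inv_id := DayFunctor.hom_ext
      ((DayConvolution.braiding F.functor G.functor).hom_inv_id)
    inv_hom_id := DayFunctor.hom_ext
      ((DayConvolution.braiding F.functor G.functor).inv_hom_id) }

lemma natTrans_tensorHom {F F' G G' : DayLambda V} (f : F ⟶ F') (g : G ⟶ G') :
    let := dayConv F G
    let := dayConv F' G'
    (f ⊗ₘ g).natTrans = DayConvolution.map f.natTrans g.natTrans :=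
  ι_map_tensorHom_hom_eq_tensorHom LambdaCatᵒᵖ V (DayLambda V) f g

lemma natTrans_associator (F G H : DayLambda V) :
    let := dayConv F G
    let := dayConv G H
    let : DayConvolution F.functor (DayConvolution.convolution G.functor H.functor) := dayConv F (G ⊗ H)
    let : DayConvolution (DayConvolution.convolution F.functor G.functor) H.functor := dayConv (F ⊗ G) H
    (α_ F G H).hom.natTrans = (DayConvolution.associator F.functor G.functor H.functor).hom :=
  ι_map_associator_hom_eq_associator_hom LambdaCatᵒᵖ V (DayLambda V) F G H

lemma natTrans_associator_inv (F G H : DayLambda V) :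
    let := dayConv F G
    let := dayConv G H
    let : DayConvolution F.functor (DayConvolution.convolution G.functor H.functor) := dayConv F (G ⊗ H)
    let : DayConvolution (DayConvolution.convolution F.functor G.functor) H.functor := dayConv (F ⊗ G) H
    (α_ F G H).inv.natTrans = (DayConvolution.associator F.functor G.functor H.functor).inv := by
  intro i1 i2 i3 i4
  have h : (⟨(DayConvolution.associator F.functor G.functor H.functor).inv⟩ :
      F ⊗ G ⊗ H ⟶ (F ⊗ G) ⊗ H) ≫ (α_ F G H).hom = 𝟙 _ := by
    apply DayFunctor.hom_ext
    rw [comp_natTrans, natTrans_associator]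
    exact Iso.inv_hom_id _
  exact congrArg DayFunctor.Hom.natTrans ((Iso.comp_hom_eq_id _).1 h).symm

/-- Day convolution is symmetric. -/
instance : SymmetricCategory (DayLambda V) where
  braiding F G := dayBraiding F G
  braiding_naturality_left {F G} f H := by
    let := dayConv F H
    let := dayConv G H
    let := dayConv H F
    let := dayConv H G
    apply DayFunctor.hom_ext
    rw [← tensorHom_id, ← id_tensorHom, comp_natTrans, comp_natTrans, natTrans_tensorHom, natTrans_tensorHom]
    exact DayConvolution.braiding_naturality_left f.natTrans H.functor
  braiding_naturality_right H {F G} f := by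
    let := dayConv F H
    let := dayConv G H
    let := dayConv H F
    let := dayConv H G
    apply DayFunctor.hom_ext
    rw [← tensorHom_id, ← id_tensorHom, comp_natTrans, comp_natTrans, natTrans_tensorHom, natTrans_tensorHom]
    exact DayConvolution.braiding_naturality_right H.functor f.natTrans
  symmetry F G := by
    let := dayConv F G
    let := dayConv G F
    exact DayFunctor.hom_ext (DayConvolution.symmetry F.functor G.functor)
  hexagon_forward F G H := by
    let := dayConv F G
    let := dayConv G H
    let := dayConv H F
    let := dayConv G F
    let := dayConv F H
    let : DayConvolution F.functor (DayConvolution.convolution G.functor H.functor) := dayConv F (G ⊗ H)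
    let : DayConvolution (DayConvolution.convolution F.functor G.functor) H.functor := dayConv (F ⊗ G) H
    let : DayConvolution G.functor (DayConvolution.convolution H.functor F.functor) := dayConv G (H ⊗ F)
    let : DayConvolution (DayConvolution.convolution G.functor H.functor) F.functor := dayConv (G ⊗ H) F
    let : DayConvolution G.functor (DayConvolution.convolution F.functor H.functor) := dayConv G (F ⊗ H)
    let : DayConvolution (DayConvolution.convolution G.functor F.functor) H.functor := dayConv (G ⊗ F) H
    apply DayFunctor.hom_ext
    rw [← tensorHom_id, ← id_tensorHom]
    simp only [comp_natTrans, natTrans_tensorHom, natTrans_associator]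
    exact DayConvolution.hexagon_forward F.functor G.functor H.functor
  hexagon_reverse F G H := by
    let := dayConv F G
    let := dayConv G H
    let := dayConv H F
    let := dayConv H G
    let := dayConv F H
    let : DayConvolution F.functor (DayConvolution.convolution G.functor H.functor) := dayConv F (G ⊗ H)
    let : DayConvolution (DayConvolution.convolution F.functor G.functor) H.functor := dayConv (F ⊗ G) H
    let : DayConvolution H.functor (DayConvolution.convolution F.functor G.functor) := dayConv H (F ⊗ G)
    let : DayConvolution (DayConvolution.convolution H.functor F.functor) G.functor := dayConv (H ⊗ F) G
    let : DayConvolution F.functor (DayConvolution.convolution H.functor G.functor) := dayConv F (H ⊗ G)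
    let : DayConvolution (DayConvolution.convolution F.functor H.functor) G.functor := dayConv (F ⊗ H) G
    apply DayFunctor.hom_ext
    rw [← tensorHom_id, ← id_tensorHom]
    simp only [comp_natTrans, natTrans_tensorHom, natTrans_associator_inv]
    exact DayConvolution.hexagon_reverse F.functor G.functor H.functor
end
end
end Day

section UnderUnit
variable {C : Type*} [Category C] [MonoidalCategory C]

/-- Objects under the unit of a monoidal category: the structure map of `X ⊗ Y` is
`𝟙_ ≅ 𝟙_ ⊗ 𝟙_ ⟶ X ⊗ Y`, and the associator and the unitors are those of `C`. -/
instance underUnitStruct : MonoidalCategoryStruct (Under (𝟙_ C)) where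
  tensorObj X Y := Under.mk ((λ_ (𝟙_ C)).inv ≫ (X.hom ⊗ₘ Y.hom))
  tensorHom f g := Under.homMk (f.right ⊗ₘ g.right) (by simp)
  whiskerLeft X _ _ g := Under.homMk (X.right ◁ g.right) (by simp [← id_tensorHom])
  whiskerRight f Y := Under.homMk (f.right ▷ Y.right) (by simp [← tensorHom_id])
  tensorUnit := Under.mk (𝟙 (𝟙_ C))
  associator X Y Z := Under.isoMk (α_ X.right Y.right Z.right) (by
    have h1 : ((λ_ (𝟙_ C)).inv ≫ (X.hom ⊗ₘ Y.hom)) ⊗ₘ Z.hom =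
        (λ_ (𝟙_ C)).inv ▷ 𝟙_ C ≫ ((X.hom ⊗ₘ Y.hom) ⊗ₘ Z.hom) := by
      rw [← tensorHom_id, tensorHom_comp_tensorHom, Category.id_comp]
    have h2 : X.hom ⊗ₘ ((λ_ (𝟙_ C)).inv ≫ (Y.hom ⊗ₘ Z.hom)) =
        𝟙_ C ◁ (λ_ (𝟙_ C)).inv ≫ (X.hom ⊗ₘ (Y.hom ⊗ₘ Z.hom)) := by
      rw [← id_tensorHom, tensorHom_comp_tensorHom, Category.id_comp]
    dsimp
    rw [h1, h2]
    simp only [Category.assoc, associator_naturality]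
    have h3 : (λ_ (𝟙_ C)).inv ▷ 𝟙_ C ≫ (α_ (𝟙_ C) (𝟙_ C) (𝟙_ C)).hom =
        𝟙_ C ◁ (λ_ (𝟙_ C)).inv := by
      rw [unitors_inv_equal]
      simp
    rw [reassoc_of% h3])
  leftUnitor X := Under.isoMk (λ_ X.right) (by
    simp [MonoidalCategory.tensorHom_def])
  rightUnitor X := Under.isoMk (ρ_ X.right) (by
    simp [tensorHom_def', unitors_inv_equal])

instance underUnit : MonoidalCategory (Under (𝟙_ C)) where
  tensorHom_def f g := Under.UnderMorphism.ext (MonoidalCategory.tensorHom_def f.right g.right)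
  id_tensorHom_id X Y := Under.UnderMorphism.ext (id_tensorHom_id X.right Y.right)
  tensorHom_comp_tensorHom f g h k := Under.UnderMorphism.ext
    (tensorHom_comp_tensorHom f.right g.right h.right k.right)
  whiskerLeft_id X Y := Under.UnderMorphism.ext (whiskerLeft_id X.right Y.right)
  id_whiskerRight X Y := Under.UnderMorphism.ext (id_whiskerRight X.right Y.right)
  associator_naturality f g h := Under.UnderMorphism.ext
    (associator_naturality f.right g.right h.right)
  leftUnitor_naturality f := Under.UnderMorphism.ext (leftUnitor_naturality f.right)
  rightUnitor_naturality f := Under.UnderMorphism.ext (rightUnitor_naturality f.right)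
  pentagon X Y Z T := Under.UnderMorphism.ext (pentagon X.right Y.right Z.right T.right)
  triangle X Y := Under.UnderMorphism.ext (triangle X.right Y.right)

lemma baseMap_left {A A' P Q Q' : C} (d : 𝟙_ C ⟶ A) (f : A ⟶ A') (n : 𝟙_ C ⟶ P)
    (t : A ⊗ P ⟶ Q) (t' : A' ⊗ P ⟶ Q') (q : Q ⟶ Q') (h : t ≫ q = f ▷ P ≫ t') :
    (d ≫ (ρ_ A).inv ≫ A ◁ n ≫ t) ≫ q = (d ≫ f) ≫ (ρ_ A').inv ≫ A' ◁ n ≫ t' := by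
  simp only [Category.assoc, h]
  rw [whisker_exchange_assoc, ← rightUnitor_inv_naturality_assoc]

lemma baseMap_right {A P Q Q' : C} (d : 𝟙_ C ⟶ A) (n : 𝟙_ C ⟶ P)
    (t : A ⊗ P ⟶ Q) (t' : A ⊗ P ⟶ Q') (q : Q ⟶ Q') (h : t ≫ q = A ◁ 𝟙 P ≫ t') :
    (d ≫ (ρ_ A).inv ≫ A ◁ n ≫ t) ≫ q = d ≫ (ρ_ A).inv ≫ A ◁ n ≫ t' := by
  simp only [Category.assoc, h, whiskerLeft_id, Category.id_comp]

end UnderUnit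

section MonoidalOn
variable {C : Type*} [Category C]

/-- The tensor product of morphisms given by a bifunctor. -/
def bifunctorMap (T : C ⥤ C ⥤ C) {X X' Y Y' : C} (f : X ⟶ X') (g : Y ⟶ Y') :
    (T.obj X).obj Y ⟶ (T.obj X').obj Y' :=
  (T.map f).app Y ≫ (T.obj X').map g

/-- A monoidal structure on `C` whose product is the given bifunctor `T` and whose unit is the
given object `U`. -/
structure MonoidalOn (T : C ⥤ C ⥤ C) (U : C) where
  associator (X Y Z : C) : (T.obj ((T.obj X).obj Y)).obj Z ≅ (T.obj X).obj ((T.obj Y).obj Z)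
  leftUnitor (X : C) : (T.obj U).obj X ≅ X
  rightUnitor (X : C) : (T.obj X).obj U ≅ X
  associator_naturality {X Y Z X' Y' Z' : C} (f : X ⟶ X') (g : Y ⟶ Y') (h : Z ⟶ Z') :
    bifunctorMap T (bifunctorMap T f g) h ≫ (associator X' Y' Z').hom =
      (associator X Y Z).hom ≫ bifunctorMap T f (bifunctorMap T g h)
  leftUnitor_naturality {X Y : C} (f : X ⟶ Y) :
    (T.obj U).map f ≫ (leftUnitor Y).hom = (leftUnitor X).hom ≫ f
  rightUnitor_naturality {X Y : C} (f : X ⟶ Y) :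
    (T.map f).app U ≫ (rightUnitor Y).hom = (rightUnitor X).hom ≫ f
  pentagon (X Y Z W : C) :
    (T.map (associator X Y Z).hom).app W ≫ (associator X ((T.obj Y).obj Z) W).hom ≫
        (T.obj X).map (associator Y Z W).hom =
      (associator ((T.obj X).obj Y) Z W).hom ≫ (associator X Y ((T.obj Z).obj W)).hom
  triangle (X Y : C) :
    (associator X U Y).hom ≫ (T.obj X).map (leftUnitor Y).hom = (T.map (rightUnitor X).hom).app Y

namespace MonoidalOn
variable {T : C ⥤ C ⥤ C} {U : C} (S : MonoidalOn T U)

/-- The monoidal category that the structure amounts to. -/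
@[reducible] def monoidalCategory : MonoidalCategory C where
  tensorObj X Y := (T.obj X).obj Y
  whiskerLeft X _ _ f := (T.obj X).map f
  whiskerRight f Y := (T.map f).app Y
  tensorHom f g := bifunctorMap T f g
  tensorUnit := U
  associator := S.associator
  leftUnitor := S.leftUnitor
  rightUnitor := S.rightUnitor
  tensorHom_def _ _ := rfl
  id_tensorHom_id X Y := by simp [bifunctorMap]
  tensorHom_comp_tensorHom f g h k := by simp [bifunctorMap]
  associator_naturality := S.associator_naturality
  leftUnitor_naturality := S.leftUnitor_naturality
  rightUnitor_naturality := S.rightUnitor_naturality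
  pentagon := S.pentagon
  triangle := S.triangle

/-- The induced monoidal structure on the category of objects under the unit. -/
@[reducible] def under : MonoidalCategory (Under U) :=
  letI := S.monoidalCategory
  inferInstanceAs (MonoidalCategory (Under (𝟙_ C)))

end MonoidalOn
end MonoidalOn

noncomputable section Kelly

variable (V : Type u) [Category.{v} V] [MonoidalCategory V]

/-- The category of `Λ`-sequences: functors `D : Λᵒᵖ ⥤ V` with a base map `𝟙_ V ⟶ D(0)`;
morphisms are the natural transformations that are compatible with the base maps. -/
abbrev LambdaSeq := StructuredArrow (𝟙_ V) ((evaluation LambdaCatᵒᵖ V).obj (op ⟨0⟩))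

/-- A `Λ`-sequence is unital if its base map identifies `D(0)` with the unit of `V`. -/
def isUnital : ObjectProperty (LambdaSeq V) := fun D => IsIso D.hom

section
variable [HasColimits V]

/-- The values of `I₁`. -/
@[reducible] def I1Obj : ℕ → V
  | 0 => 𝟙_ V
  | 1 => 𝟙_ V
  | _ + 2 => ⊥_ V

/-- The map `I₁(n) ⟶ I₁(m)` induced by any injection from `m` to `n`. -/
def I1Map : (m n : ℕ) → m ≤ n → (I1Obj V n ⟶ I1Obj V m)
  | _, _ + 2, _ => initial.to _
  | 0, 0, _ => 𝟙 _
  | 0, 1, _ => 𝟙 _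
  | 1, 1, _ => 𝟙 _

lemma card_le {m n : LambdaCat} (f : m ⟶ n) : m.card ≤ n.card := by
  simpa using Fintype.card_le_of_embedding (LambdaCat.inj f)

lemma I1Map_refl (n : ℕ) (h : n ≤ n) : I1Map V n n h = 𝟙 _ := by
  match n with
  | 0 => rfl
  | 1 => rfl
  | _ + 2 => exact initial.hom_ext _ _

lemma I1Map_comp (m n p : ℕ) (h : m ≤ n) (h' : n ≤ p) :
    I1Map V m p (h.trans h') = I1Map V n p h' ≫ I1Map V m n h := by
  obtain _ | _ | p := p
  · obtain rfl : n = 0 := by omega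
    obtain rfl : m = 0 := by omega
    exact (Category.comp_id _).symm
  · obtain rfl | rfl : n = 0 ∨ n = 1 := by omega
    · obtain rfl : m = 0 := by omega
      exact (Category.comp_id _).symm
    · obtain rfl | rfl : m = 0 ∨ m = 1 := by omega
      all_goals exact (Category.comp_id _).symm
  · exact initial.hom_ext _ _

/-- The `Λ`-sequence `I₁`: the unit of `V` at levels `0` and `1`, the initial object above. -/
def I1 : LambdaSeq V :=
  StructuredArrow.mk (Y :=
    ({ obj := fun n => I1Obj V n.unop.card
       map := fun f => I1Map V _ _ (card_le f.unop)
       map_id := fun n => I1Map_refl V _ _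
       map_comp := fun f g => I1Map_comp V _ _ _ (card_le g.unop) (card_le f.unop) } :
      LambdaCatᵒᵖ ⥤ V)) (𝟙 (𝟙_ V))

/-- The functor `X ↦ X ⊗ I₁`, with the levelwise tensor product, from objects under the unit of `V`
to `Λ`-sequences under `I₁`. -/
def i1 : Under (𝟙_ V) ⥤ Under (I1 V) where
  obj X := Under.mk (Y := StructuredArrow.mk (Y := (I1 V).right ⋙ tensorLeft X.right)
      (X.hom ≫ (ρ_ X.right).inv))
    (StructuredArrow.homMk
      { app := fun n => (λ_ ((I1 V).right.obj n)).inv ≫ X.hom ▷ (I1 V).right.obj n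
        naturality := fun m n f => by
          change (I1 V).right.map f ≫ _ ≫ _ = (_ ≫ _) ≫ X.right ◁ (I1 V).right.map f
          rw [Category.assoc, ← whisker_exchange, leftUnitor_inv_naturality_assoc] }
      (by
        change 𝟙 (𝟙_ V) ≫ (λ_ (𝟙_ V)).inv ≫ X.hom ▷ 𝟙_ V = X.hom ≫ (ρ_ X.right).inv
        rw [Category.id_comp, rightUnitor_inv_naturality, unitors_inv_equal]))
  map {X Y} φ := Under.homMk (StructuredArrow.homMk
      { app := fun n => φ.right ▷ (I1 V).right.obj n
        naturality := fun _ _ f => by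
          simp [whisker_exchange] }
      (by
        change (X.hom ≫ (ρ_ X.right).inv) ≫ φ.right ▷ 𝟙_ V = Y.hom ≫ (ρ_ Y.right).inv
        rw [Category.assoc, ← rightUnitor_inv_naturality, ← Category.assoc]
        exact congrArg (· ≫ (ρ_ Y.right).inv) (Under.w φ)))
      (by
        ext n
        change ((λ_ ((I1 V).right.obj n)).inv ≫ X.hom ▷ (I1 V).right.obj n) ≫
          φ.right ▷ (I1 V).right.obj n = (λ_ ((I1 V).right.obj n)).inv ≫ Y.hom ▷ (I1 V).right.obj n
        rw [Category.assoc, ← comp_whiskerRight, Under.w φ])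
  map_id X := by
    ext n
    exact id_whiskerRight X.right ((I1 V).right.obj n)
  map_comp f g := by
    ext n
    exact comp_whiskerRight f.right g.right ((I1 V).right.obj n)

/-- The bifunctor `(F, G) ↦ ∫^k F(k) ⊗ G(k)`. -/
def tensorOver : (LambdaCatᵒᵖ ⥤ V) ⥤ (LambdaCat ⥤ V) ⥤ V :=
  externalProductBifunctorCurried LambdaCatᵒᵖ LambdaCat V ⋙
    (Functor.whiskeringRight _ _ _).obj (coendFunctor LambdaCat V)

/-- The component `F(k) ⊗ G(k) ⟶ ∫^k F(k) ⊗ G(k)`. -/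
def tensorOverι (F : LambdaCatᵒᵖ ⥤ V) (G : LambdaCat ⥤ V) (k : LambdaCat) :
    F.obj (op k) ⊗ G.obj k ⟶ ((tensorOver V).obj F).obj G :=
  coend.ι (((externalProductBifunctorCurried LambdaCatᵒᵖ LambdaCat V).obj F).obj G) k


lemma tensorOverι_map (D : LambdaCatᵒᵖ ⥤ V) {G G' : LambdaCat ⥤ V} (g : G ⟶ G') (k : LambdaCat) :
    tensorOverι V D G k ≫ ((tensorOver V).obj D).map g =
      D.obj (op k) ◁ g.app k ≫ tensorOverι V D G' k := by
  refine (coend.ι_map _ _).trans ?_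
  simp [externalProductBifunctorCurried]
  rfl

lemma tensorOverι_app {D D' : LambdaCatᵒᵖ ⥤ V} (f : D ⟶ D') (G : LambdaCat ⥤ V) (k : LambdaCat) :
    tensorOverι V D G k ≫ ((tensorOver V).map f).app G =
      f.app (op k) ▷ G.obj k ≫ tensorOverι V D' G k := by
  refine (coend.ι_map _ _).trans ?_
  simp [externalProductBifunctorCurried]
  rfl

end

section
variable [SymmetricCategory V] [HasColimits V] [∀ X : V, PreservesColimits (tensorLeft X)]

/-- A `Λ`-sequence as an object of the Day convolution category with a map from its unit `I₀`;
by the universal property of `I₀`, this is the map that is the base map at level `0`. -/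
def toDay : LambdaSeq V ⥤ Under (𝟙_ (DayLambda V)) where
  obj D := Under.mk (DayFunctor.unitDesc (F := ⟨D.right⟩) D.hom)
  map {D E} φ := Under.homMk ⟨φ.right⟩ (by
    apply DayFunctor.unit_hom_ext
    have h : D.hom ≫ φ.right.app (op ⟨0⟩) = E.hom := StructuredArrow.w φ
    change DayFunctor.ν _ _ ≫ (DayFunctor.unitDesc (F := ⟨D.right⟩) D.hom).natTrans.app _ ≫
      φ.right.app (op ⟨0⟩) = DayFunctor.ν _ _ ≫ (DayFunctor.unitDesc (F := ⟨E.right⟩) E.hom).natTrans.app _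
    erw [DayFunctor.ν_comp_unitDesc_assoc, DayFunctor.ν_comp_unitDesc]
    exact h)

/-- `E ↦ (k ↦ E^{⊠k})`, the tensor powers for Day convolution, as covariant functors of `k`. -/
def dayPow : LambdaSeq V ⥤ LambdaCat ⥤ LambdaCatᵒᵖ ⥤ V :=
  toDay V ⋙ tensorPowers (DayLambda V) ⋙
    (Functor.whiskeringRight _ _ _).obj (DayFunctor.equiv LambdaCatᵒᵖ V).functor

/-- The underlying functor `n ↦ ∫^k D(k) ⊗ E^{⊠k}(n)` of the Kelly product, as a functor of `D`
and `E`. -/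
def kellyUnderlying : LambdaSeq V ⥤ LambdaSeq V ⥤ LambdaCatᵒᵖ ⥤ V :=
  StructuredArrow.proj _ _ ⋙ tensorOver V ⋙ Functor.whiskeringRight _ _ _ ⋙
    (Functor.whiskeringLeft _ _ _).obj (dayPow V ⋙ flipFunctor _ _ _)

/-- The base map `𝟙_ ⟶ D(0) ≅ D(0) ⊗ 𝟙_ ⟶ D(0) ⊗ I₀(0) = D(0) ⊗ E^{⊠0}(0) ⟶ (D ⊙ E)(0)`. -/
def kellyBase (D E : LambdaSeq V) : 𝟙_ V ⟶ (((kellyUnderlying V).obj D).obj E).obj (op ⟨0⟩) :=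
  D.hom ≫ (ρ_ _).inv ≫ D.right.obj (op ⟨0⟩) ◁ DayFunctor.ν LambdaCatᵒᵖ V ≫
    tensorOverι V D.right (((dayPow V).obj E).flip.obj (op ⟨0⟩)) ⟨0⟩

lemma kellyBase_map_left {D D' : LambdaSeq V} (φ : D ⟶ D') (E : LambdaSeq V) :
    kellyBase V D E ≫ (((kellyUnderlying V).map φ).app E).app (op ⟨0⟩) = kellyBase V D' E := by
  have h : D.hom ≫ φ.right.app (op ⟨0⟩) = D'.hom := StructuredArrow.w φ
  exact (baseMap_left _ _ _ _ _ _
    (tensorOverι_app V φ.right (((dayPow V).obj E).flip.obj (op ⟨0⟩)) ⟨0⟩)).trans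
    (congrArg (· ≫ _) h)

lemma kellyBase_map_right (D : LambdaSeq V) {E E' : LambdaSeq V} (ψ : E ⟶ E') :
    kellyBase V D E ≫ (((kellyUnderlying V).obj D).map ψ).app (op ⟨0⟩) = kellyBase V D E' :=
  baseMap_right _ _ _ _ _
    (tensorOverι_map V D.right
      (((flipFunctor _ _ _).map ((dayPow V).map ψ)).app (op ⟨0⟩)) ⟨0⟩)

/-- The Kelly product `D ⊙ E = D ⊗_Λ E^{⊠*}` of `Λ`-sequences. -/
def kelly : LambdaSeq V ⥤ LambdaSeq V ⥤ LambdaSeq V where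
  obj D :=
    { obj := fun E => StructuredArrow.mk (Y := ((kellyUnderlying V).obj D).obj E) (kellyBase V D E)
      map := fun ψ => StructuredArrow.homMk (((kellyUnderlying V).obj D).map ψ)
        (kellyBase_map_right V D ψ)
      map_id := fun E => StructuredArrow.hom_ext _ _ (((kellyUnderlying V).obj D).map_id E)
      map_comp := fun f g => StructuredArrow.hom_ext _ _ (((kellyUnderlying V).obj D).map_comp f g) }
  map φ :=
    { app := fun E => StructuredArrow.homMk (((kellyUnderlying V).map φ).app E)
        (kellyBase_map_left V φ E)
      naturality := fun _ _ ψ => StructuredArrow.hom_ext _ _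
        (((kellyUnderlying V).map φ).naturality ψ) }
  map_id D := by
    ext E : 2
    exact StructuredArrow.hom_ext _ _ (congrArg (fun f => f.app E) ((kellyUnderlying V).map_id D))
  map_comp f g := by
    ext E : 2
    exact StructuredArrow.hom_ext _ _
      (congrArg (fun f => f.app E) ((kellyUnderlying V).map_comp f g))

end
end Kelly

/-! Write `x · A` for the levelwise tensor product of an object of `V` with a functor on `Λᵒᵖ`
(`act`), and `Φ_G(X) = ∫^k X(k) · G(k)` for a functor `G` from `Λ` to Day functors (`phi`). For `G =
E^{⊠*}` (`pw E`) this is `X ⊙ E`.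

Associativity rests on three properties of `Φ_E = (-) ⊙ E`: it preserves colimits
(`preservesColimits_phiFunctor`), it commutes with the action of `V` (`phiAct`), and it is a strong
braided monoidal functor for `⊠` (`phiFunctorLaxBraided`, `isIso_phi_μ`). The last property holds
because `k ↦ E^{⊠k}` is itself strong braided monoidal on `Λ` under concatenation, and because the
coend of a Day convolution is the double coend `∫^{k,l} (X(k) ⊗ Y(l)) · E^{⊠(k+l)}`. A strong
braided monoidal functor takes powers to powers, so `(D ⊙ E)^{⊠k} ≅ Φ_E(D^{⊠k})` (`pwComp`), and by
linearity and cocontinuity (`phiComp`) X ⊙ (D ⊙ E) ≅ ∫^k X(k) · Φ_E(D^{⊠k}) ≅ Φ_E(∫^k X(k) · D^{⊠k})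
= (X ⊙ D) ⊙ E. The base map of `D ⊙ E` is the unit map of `Φ_E` followed by `Φ_E` of the base map of
`D`, so compatibility with base maps is the unit axiom of a monoidal transformation. The pentagon
combines a cocycle identity for the interchange of coends (`phiComp_cocycle`) with the fact that
monoidal transformations commute with the comparison of powers.

The coherence of the units is formal. By `exists_monoidalOn`, the pentagon and natural isomorphisms
of `U ⊗ -` and `- ⊗ U` with the identity suffice: unit isomorphisms satisfying the triangle can then
be constructed. On the left, `I₁ ⊙ E` collapses to the component `k = 1`. On the right, `I₁`
represents level `1`, hence `I₁^{⊠k}` represents level `k` (`Represents.tensor`), and `D ⊙ I₁ ≅ D`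
is the co-Yoneda lemma.

For unital sequences, `0` is initial in `Λ`, so all powers of a unital `E` agree at level `0`, and
the coend reduces there to its component `k = 0`. For `i1`, linearity gives `(x · I₁) ⊙ E ≅ x · (I₁
⊙ E) ≅ x · E`, and `E = y · I₁` gives the monoidal comparison. Since the unit isomorphisms are known
only through the axioms, compatibility with them is derived from the pentagon and the triangle
(`dayLeft_tensor`, `dayRight_eq`). -/

set_option linter.unusedSectionVars false

/-! ### Concatenation of tensor powers, and its compatibility with injections and with the braiding.
-/

noncomputable section Powers
variable {W : Type u} [Category.{v} W] [MonoidalCategory W] [SymmetricCategory W]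

/-- The concatenation `X^m ⊗ X^n ⟶ X^p` for `p = m + n`. -/
def powMul (X : W) : (m n p : ℕ) → m + n = p → (tpow X m ⊗ tpow X n ⟶ tpow X p)
  -- The target exponent is a variable `p` with a proof of `m + n = p`, because `m + 1 + n` and `m +
  -- n + 1` are not definitionally equal. The recursion then needs a transport only here, where `n =
  -- p`.
  | 0, _, _, h => (λ_ _).hom ≫ eqToHom (congrArg (tpow X) ((Nat.zero_add _).symm.trans h))
  | m + 1, n, 0, h => absurd h (by omega)
  | m + 1, n, p + 1, h => (α_ _ _ _).hom ≫ X ◁ powMul X m n p (by omega)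

lemma powMul_zero (X : W) (n : ℕ) (h : 0 + n = n) : powMul X 0 n n h = (λ_ _).hom := by
  simp [powMul]

lemma powMul_succ (X : W) (m n p : ℕ) (h : m + 1 + n = p + 1) (h' : m + n = p) :
    powMul X (m + 1) n (p + 1) h = (α_ _ _ _).hom ≫ X ◁ powMul X m n p h' := rfl

instance isIso_powMul (X : W) (m n p : ℕ) (h : m + n = p) : IsIso (powMul X m n p h) := by
  induction m generalizing p with
  | zero => 
    obtain rfl : n = p := by omega
    rw [powMul_zero]; infer_instance
  | succ m ih =>
    obtain _ | p := p
    · omega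
    have h' : m + n = p := by omega
    have := ih p h'
    rw [powMul_succ X m n p h h']
    infer_instance

lemma swapFirst_unit (X A : W) :
    swapFirst X (𝟙_ W) A ≫ (λ_ _).hom = X ◁ (λ_ A).hom := by
  simp [swapFirst, braiding_tensorUnit_right]

lemma powMul_right_unit (X : W) (m : ℕ) (h : m + 0 = m) :
    powMul X m 0 m h = (ρ_ _).hom := by
  induction m with
  | zero => rw [powMul_zero]; exact unitors_equal
  | succ m ih => rw [powMul_succ X m 0 m h rfl, ih]; simp

lemma powMul_assoc (X : W) (a b c ab bc p : ℕ) (h1 : a + b = ab) (h2 : ab + c = p) (h3 : b + c = bc)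
    (h4 : a + bc = p) : powMul X a b ab h1 ▷ tpow X c ≫ powMul X ab c p h2 =
      (α_ _ _ _).hom ≫ tpow X a ◁ powMul X b c bc h3 ≫ powMul X a bc p h4 := by
  induction a generalizing ab p with
  | zero =>
    obtain rfl : b = ab := by omega
    obtain rfl : bc = p := by omega
    rw [powMul_zero, powMul_zero]
    simp [tpow]
  | succ a ih =>
    obtain _ | p := p
    · omega
    obtain _ | ab := ab
    · omega
    rw [powMul_succ X a b ab h1 (by omega), powMul_succ X ab c p h2 (by omega),
      powMul_succ X a bc p h4 (by omega)]
    have := ih ab p (by omega) (by omega) (by omega)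
    simp only [comp_whiskerRight, Category.assoc, whisker_assoc, Iso.inv_hom_id_assoc,
      ← MonoidalCategory.whiskerLeft_comp, this]
    simp

lemma powMul_tpowHom {X Y : W} (φ : X ⟶ Y) (m n p : ℕ) (h : m + n = p) :
    (tpowHom φ m ⊗ₘ tpowHom φ n) ≫ powMul Y m n p h = powMul X m n p h ≫ tpowHom φ p := by
  induction m generalizing p with
  | zero =>
    obtain rfl : n = p := by omega
    rw [powMul_zero, powMul_zero, tpowHom]
    simp
  | succ m ih =>
    obtain _ | p := p
    · omega
    have h' : m + n = p := by omega
    rw [powMul_succ X m n p h h', powMul_succ Y m n p h h', tpowHom, tpowHom,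
      associator_naturality_assoc, Category.assoc, ← id_tensorHom, ← id_tensorHom,
      tensorHom_comp_tensorHom, tensorHom_comp_tensorHom, ih p h']
    simp

/-- An injection that misses `0` factors through this one. Hence a power map that fills the first
target factors with `η` can be peeled off one factor at a time, as in `unitPow_powMul`. -/
lemma powMap_succEmb {X : W} (η : 𝟙_ W ⟶ X) (p : ℕ) :
    powMap η (Fin.succEmb p) = (λ_ _).inv ≫ η ▷ tpow X p := by
  induction p with
  | zero =>
    rw [powMap, unitPow, unitPow, tensorHom_id]
  | succ p ih =>
    have hr : LambdaCat.remove (Fin.succEmb (p + 1)) 0 = Fin.succEmb p :=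
      LambdaCat.remove_eq _ _ _ fun k => by
        simp [Fin.succAbove]
    rw [powMap_succ, hr, ih]
    have : (Fin.succEmb (p + 1)) 0 = Fin.succ 0 := rfl
    rw [this, insertAt_succ, insertAt_zero]
    simp only [whiskerLeft_id, Category.comp_id]
    have h := swapFirst_natural (𝟙 X) η (𝟙 (tpow X p))
    simp only [id_tensorHom, tensorHom_id] at h
    rw [MonoidalCategory.whiskerLeft_comp, Category.assoc, h]
    simp only [swapFirst, Category.assoc]
    simp [braiding_tensorUnit_right]
    

/-- `w` is the wedge of `f` and `g`. -/
structure IsWedge {m n p m' n' p' : ℕ} (h : m + n = p) (f : Fin m ↪ Fin m') (g : Fin n ↪ Fin n')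
    (w : Fin p ↪ Fin p') : Prop where
  left (i : Fin m) : (w ⟨i, by omega⟩ : ℕ) = f i
  right (i : Fin n) : (w ⟨m + i, by omega⟩ : ℕ) = m' + g i

/-- `succAbove_remove` with values in `ℕ`, where the conditions on wedges become linear arithmetic.
-/
lemma val_remove {m n : ℕ} (f : Fin (m + 1) ↪ Fin (n + 1)) (k : Fin m) :
    (if (LambdaCat.remove f 0 k : ℕ) < f 0 then (LambdaCat.remove f 0 k : ℕ)
      else LambdaCat.remove f 0 k + 1) = f k.succ := by
  have := congrArg Fin.val (LambdaCat.succAbove_remove f 0 k)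
  rw [Fin.zero_succAbove] at this
  simp only [Fin.succAbove, Fin.lt_def, Fin.val_castSucc] at this
  split_ifs at this ⊢ with h1 <;> simpa using this

lemma IsWedge.remove {m n p m' n' p' : ℕ} {h : m + 1 + n = p + 1} {f : Fin (m + 1) ↪ Fin (m' + 1)}
    {g : Fin n ↪ Fin n'} {w : Fin (p + 1) ↪ Fin (p' + 1)} (hw : IsWedge h f g w)
    (h' : m + n = p) :
    IsWedge h' (LambdaCat.remove f 0) g (LambdaCat.remove w 0) where
  left i := by
    have h1 := val_remove f i
    have h2 := val_remove w ⟨i, by omega⟩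
    have h3 : (w 0 : ℕ) = f 0 := hw.left 0
    have h4 : (w (Fin.succ ⟨i, by omega⟩) : ℕ) = f i.succ := hw.left i.succ
    rw [h4, h3] at h2
    split_ifs at h1 h2 <;> omega
  right i := by
    have h2 := val_remove w ⟨m + i, by omega⟩
    have h3 : (w 0 : ℕ) = f 0 := hw.left 0
    have h4 : (w (Fin.succ ⟨m + i, by omega⟩) : ℕ) = m' + 1 + g i := by
      rw [← hw.right i]
      congr 3
      simp; omega
    rw [h4, h3] at h2
    have := (f 0).2
    split_ifs at h2 <;> omega

/-- The base case of `powMul_powMap`, in which the left block of the target consists of copies of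
`η` only. -/
lemma unitPow_powMul {X : W} (η : 𝟙_ W ⟶ X) {n n' m' p' : ℕ} (h : m' + n' = p')
    (g : Fin n ↪ Fin n') (w : Fin n ↪ Fin p') (hw : ∀ i, (w i : ℕ) = m' + g i) :
    (unitPow η m' ⊗ₘ powMap η g) ≫ powMul X m' n' p' h = (λ_ _).hom ≫ powMap η w := by
  induction m' generalizing p' with
  | zero =>
    obtain rfl : n' = p' := by omega
    have : w = g := DFunLike.ext _ _ fun i => Fin.ext (by simpa using hw i)
    rw [this, powMul_zero, unitPow]
    simp
  | succ m' ih =>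
    obtain _ | p' := p'
    · omega
    -- As the left block is not empty, `w` misses `0`; `w'` is `w` followed by the predecessor.
    let w' : Fin n ↪ Fin p' := ⟨fun i => ⟨m' + g i, by omega⟩, fun i j hij => by
      simpa [Fin.ext_iff, ← Fin.ext_iff] using hij⟩
    have e : w = w'.trans (Fin.succEmb p') := DFunLike.ext _ _ fun i => Fin.ext (by
      have : (w i : ℕ) = m' + g i + 1 := by rw [hw i]; omega
      rw [this]; rfl)
    have hi := ih (by omega) w' fun i => rfl
    rw [e, powMap_trans, powMap_succEmb, reassoc_of% hi.symm, powMul_succ X m' n' p' h (by omega), unitPow]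
    have h1 : ((λ_ (𝟙_ W)).inv ≫ (η ⊗ₘ unitPow η m')) ⊗ₘ powMap η g =
        (λ_ (𝟙_ W)).inv ▷ _ ≫ ((η ⊗ₘ unitPow η m') ⊗ₘ powMap η g) := by
      rw [← tensorHom_id, tensorHom_comp_tensorHom, Category.id_comp]
    rw [h1, Category.assoc, associator_naturality_assoc, ← id_tensorHom X, tensorHom_comp_tensorHom,
      Category.comp_id]
    generalize (unitPow η m' ⊗ₘ powMap η g) = P
    rw [← Category.assoc P, leftUnitor_inv_naturality_assoc, ← MonoidalCategory.tensorHom_def' η]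
    simp

/-- An insertion is a composite of interchanges of adjacent factors, and concatenation, being made
of associators, slides past each of them. -/
lemma insertAt_powMul (X : W) (n p m : ℕ) (h : m + 1 + n = p + 1) (j : Fin (m + 1)) (j' : Fin (p + 1))
    (hj : (j' : ℕ) = j) :
    insertAt X m j ▷ tpow X n ≫ powMul X (m + 1) n (p + 1) h =
      powMul X (m + 1) n (p + 1) h ≫ insertAt X p j' := by
  induction m generalizing p with
  | zero =>
    obtain rfl : j = 0 := Fin.fin_one_eq_zero _
    obtain rfl : j' = 0 := Fin.ext hj
    simp [insertAt_zero]
  | succ m ih =>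
    induction j using Fin.cases with
    | zero =>
      obtain rfl : j' = 0 := Fin.ext hj
      simp [insertAt_zero]
    | succ j =>
      obtain _ | p := p
      · omega
      obtain ⟨j', rfl⟩ : ∃ i, j' = Fin.succ i := ⟨j'.pred (by rintro rfl; simp at hj), by simp⟩
      have h' : m + 1 + n = p + 1 := by omega
      have hi := ih p h' j j' (by simpa using hj)
      have h'' : m + n = p := by omega
      rw [powMul_succ X (m + 1) n (p + 1) h h', insertAt_succ, insertAt_succ]
      have e : powMul X (m+1) n (p+1) h' = (α_ _ _ _).hom ≫ X ◁ powMul X m n p h'' := rfl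
      have hn := swapFirst_whisker X X (powMul X m n p h'')
      calc _ = swapFirst X X (tpow X m) ▷ tpow X n ≫ (α_ _ _ _).hom ≫
            X ◁ (insertAt X m j ▷ tpow X n ≫ powMul X (m + 1) n (p + 1) h') := by
            simp
        _ = swapFirst X X (tpow X m) ▷ tpow X n ≫ (α_ _ _ _).hom ≫ X ◁ (α_ _ _ _).hom ≫
            X ◁ X ◁ powMul X m n p h'' ≫ X ◁ insertAt X p j' := by
            rw [hi, e]; simp only [MonoidalCategory.whiskerLeft_comp, Category.assoc]
        _ = (α_ _ _ _).hom ≫ X ◁ (α_ _ _ _).hom ≫ (swapFirst X X _ ≫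
            X ◁ X ◁ powMul X m n p h'') ≫ X ◁ insertAt X p j' := by
            simp only [swapFirst]; monoidal
        _ = _ := by
            rw [← hn, e]; simp only [MonoidalCategory.whiskerLeft_comp, Category.assoc]

/-- Induction on `m`: `powMap` inserts the first factor at `f 0`, this insertion slides out of the
left block by `insertAt_powMul`, and a wedge with its first element deleted is again a wedge. This
is the naturality of concatenation on `Λ`. -/
lemma powMul_powMap {X : W} (η : 𝟙_ W ⟶ X) {m n p m' n' p' : ℕ} (h : m + n = p) (h' : m' + n' = p')
    (f : Fin m ↪ Fin m') (g : Fin n ↪ Fin n') (w : Fin p ↪ Fin p') (hw : IsWedge h f g w) :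
    (powMap η f ⊗ₘ powMap η g) ≫ powMul X m' n' p' h' = powMul X m n p h ≫ powMap η w := by
  induction m generalizing m' p p' with
  | zero =>
    obtain rfl : n = p := by omega
    have e : powMap η f = unitPow η m' := by rw [powMap]
    rw [e, powMul_zero]
    exact unitPow_powMul η h' g w fun i => by
      rw [← hw.right i]; congr 3; simp
  | succ m ih =>
    obtain _ | p := p
    · omega
    obtain _ | p' := p'
    · exact (w 0).elim0
    obtain _ | m' := m'
    · exact (f 0).elim0
    have h0 : m + n = p := by omega
    have h0' : m' + n' = p' := by omega
    have hi := ih h0 h0' _ _ (hw.remove h0)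
    have hB := insertAt_powMul X n' p' m' h' (f 0) (w 0) (hw.left 0)
    have e : powMul X (m'+1) n' (p'+1) h' = (α_ _ _ _).hom ≫ X ◁ powMul X m' n' p' h0' := rfl
    rw [powMap_succ, powMap_succ, powMul_succ X m n p h h0]
    calc _ = ((X ◁ powMap η (LambdaCat.remove f 0)) ⊗ₘ powMap η g) ≫
          insertAt X m' (f 0) ▷ tpow X n' ≫ powMul X (m' + 1) n' (p' + 1) h' := by
          simp [tensorHom_def']
      _ = (α_ _ _ _).hom ≫ X ◁ ((powMap η (LambdaCat.remove f 0) ⊗ₘ powMap η g) ≫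
            powMul X m' n' p' h0') ≫ insertAt X p' (w 0) := by
          rw [hB, e]; simp [← id_tensorHom]
      _ = _ := by
          rw [hi]; simp

/-- By the hexagon, moving a factor past a block of `n` factors is moving it past them one at a
time, and this is how `insertAt` is built at position `n`. -/
lemma swapFirst_powMul (X : W) (n m p : ℕ) (h : n + m = p) (h' : n + (m + 1) = p + 1)
    (j : Fin (p + 1)) (hj : (j : ℕ) = n) :
    swapFirst X (tpow X n) (tpow X m) ≫ powMul X n (m + 1) (p + 1) h' =
      X ◁ powMul X n m p h ≫ insertAt X p j := by
  induction n generalizing p with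
  | zero =>
    obtain rfl : m = p := by omega
    obtain rfl : j = 0 := Fin.ext hj
    rw [powMul_zero, powMul_zero, insertAt_zero]
    simpa using swapFirst_unit X (tpow X m)
  | succ n ih =>
    obtain _ | p := p
    · omega
    obtain ⟨j, rfl⟩ : ∃ i, j = Fin.succ i := ⟨j.pred (by rintro rfl; simp at hj), by simp⟩
    have h0 : n + m = p := by omega
    have h0' : n + (m + 1) = p + 1 := by omega
    have hi := ih p h0 h0' j (by simpa using hj)
    rw [powMul_succ X n (m + 1) (p + 1) h' h0', powMul_succ X n m p h h0, insertAt_succ]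
    have hn := swapFirst_whisker X X (powMul X n m p h0)
    have key : swapFirst X (X ⊗ tpow X n) (tpow X m) ≫ (α_ X (tpow X n) (X ⊗ tpow X m)).hom =
        X ◁ (α_ _ _ _).hom ≫ swapFirst X X _ ≫ X ◁ swapFirst X (tpow X n) (tpow X m) := by
      simp only [swapFirst, BraidedCategory.braiding_tensor_right_hom]
      monoidal
    calc _ = (swapFirst X (X ⊗ tpow X n) (tpow X m) ≫ (α_ X (tpow X n) (X ⊗ tpow X m)).hom) ≫
          X ◁ powMul X n (m + 1) (p + 1) h0' := by simp
      _ = X ◁ (α_ _ _ _).hom ≫ swapFirst X X _ ≫ X ◁ (X ◁ powMul X n m p h0 ≫ insertAt X p j) := by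
          rw [key, ← hi]; simp
      _ = _ := by
          simp only [MonoidalCategory.whiskerLeft_comp, Category.assoc, reassoc_of% hn]

/-- By the hexagon, the braiding of `X ⊗ X^m` with `X^n` first braids `X^m` (the induction, for `w`
with its first element removed) and then passes the remaining factor by `X^n`, which inserts it at
`w 0 = n`. -/
lemma powMul_braiding {X : W} (η : 𝟙_ W ⟶ X) (m n p : ℕ) (h : m + n = p) (h' : n + m = p)
    (w : Fin p ↪ Fin p) (hl : ∀ i : Fin m, (w ⟨i, by omega⟩ : ℕ) = n + i)
    (hr : ∀ i : Fin n, (w ⟨m + i, by omega⟩ : ℕ) = i) :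
    (β_ _ _).hom ≫ powMul X n m p h' = powMul X m n p h ≫ powMap η w := by
  induction m generalizing p with
  | zero =>
    obtain rfl : n = p := by omega
    have : w = Function.Embedding.refl _ := DFunLike.ext _ _ fun i => Fin.ext (by
      have := hr i
      simp only [Nat.zero_add] at this
      simpa using this)
    rw [this, powMap_refl, powMul_zero, powMul_right_unit]
    simp [braiding_tensorUnit_left]
  | succ m ih =>
    obtain _ | p := p
    · omega
    have h0 : m + n = p := by omega
    have h0' : n + m = p := by omega
    have e0 : (w 0 : ℕ) = n := hl 0
    have hi := ih p h0 h0' (LambdaCat.remove w 0) (fun i => by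
        have h2 := val_remove w ⟨i, by omega⟩
        have := hl i.succ
        simp only [Fin.val_succ] at this
        rw [e0] at h2
        simp only [Fin.succ_mk] at h2
        split_ifs at h2 <;> omega) (fun i => by
        have h2 := val_remove w ⟨m + i, by omega⟩
        have : (w (Fin.succ ⟨m + i, by omega⟩) : ℕ) = i := by
          refine Eq.trans (congrArg (fun t => (w t : ℕ)) (Fin.ext ?_)) (hr i)
          simp; omega
        rw [e0, this] at h2
        split_ifs at h2 <;> omega)
    have hs := swapFirst_powMul X n m p h0' h' (w 0) e0
    rw [powMap_succ, powMul_succ X m n p h h0]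
    have key : (β_ (X ⊗ tpow X m) (tpow X n)).hom = (α_ _ _ _).hom ≫ X ◁ (β_ _ _).hom ≫
        swapFirst X (tpow X n) (tpow X m) := by
      simp only [swapFirst, BraidedCategory.braiding_tensor_left_hom]
    rw [key]
    simp only [Category.assoc]
    rw [hs, ← MonoidalCategory.whiskerLeft_comp_assoc, hi]
    simp

end Powers

/-! ### Tensor powers as a braided monoidal functor on `Λ`, and their behaviour under monoidal
functors. -/

noncomputable section Powers
open Functor.LaxMonoidal
variable {W : Type u} [Category.{v} W] [MonoidalCategory W] [SymmetricCategory W]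

/-- The associator and the unitors of `Λ` are the identity on numbers, so that after a concatenation
they only rename the exponent. -/
lemma powMul_cast {X : W} (η : 𝟙_ W ⟶ X) (m n p p' : ℕ) (h : m + n = p) (h' : m + n = p')
    (f : Fin p ↪ Fin p') (hf : ∀ i, (f i : ℕ) = i) :
    powMul X m n p h ≫ powMap η f = powMul X m n p' h' := by
  obtain rfl : p = p' := h.symm.trans h'
  obtain rfl : f = Function.Embedding.refl _ := DFunLike.ext _ _ fun i => Fin.ext (hf i)
  rw [powMap_refl, Category.comp_id]

lemma isWedge_wedge {m n m' n' : LambdaCat} (f : m ⟶ m') (g : n ⟶ n') :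
    IsWedge rfl (LambdaCat.inj f) (LambdaCat.inj g) (LambdaCat.inj (f ⊗ₘ g)) where
  left i := by
    have := LambdaCat.shift_tensorHom f g i
    unfold LambdaCat.shift at this
    rw [dif_pos (by simp [LambdaCat.card_tensor]; omega), if_pos i.2, dif_pos i.2] at this
    exact this
  right i := by
    have := LambdaCat.shift_tensorHom f g (m.card + i)
    unfold LambdaCat.shift at this
    rw [dif_pos (by simp [LambdaCat.card_tensor]), if_neg (by omega),
      dif_pos (by simp)] at this
    simpa using this

/-- Only the lax structure is recorded, since this is what the multiplication of coends is built
from; that its maps are invertible is a separate statement below. -/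
instance tensorPowersLaxMonoidal (X : Under (𝟙_ W)) : ((tensorPowers W).obj X).LaxMonoidal where
  ε := 𝟙 (𝟙_ W)
  μ := fun m n => powMul X.right m.card n.card _ rfl
  μ_natural_left {m m'} f n := by
    have := powMul_powMap X.hom rfl rfl _ _ _ (isWedge_wedge f (𝟙 n))
    have e : powMap X.hom (LambdaCat.inj (𝟙 n)) = 𝟙 _ := powMap_refl X.hom n.card
    rw [e, tensorHom_id] at this
    exact this
  μ_natural_right {m m'} n f := by
    have := powMul_powMap X.hom rfl rfl _ _ _ (isWedge_wedge (𝟙 n) f)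
    have e : powMap X.hom (LambdaCat.inj (𝟙 n)) = 𝟙 _ := powMap_refl X.hom n.card
    rw [e, id_tensorHom] at this
    exact this
  associativity a b c := by
    have h1 := powMul_assoc X.right a.card b.card c.card _ _ _ rfl rfl rfl (Nat.add_assoc _ _ _).symm
    have h2 := powMul_cast X.hom a.card (b.card + c.card) (a.card + b.card + c.card)
      _ (Nat.add_assoc _ _ _).symm rfl (LambdaCat.inj (α_ a b c).hom) fun i => rfl
    have h3 := congrArg (· ≫ powMap X.hom (LambdaCat.inj (α_ a b c).hom)) h1
    simp only [Category.assoc] at h3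
    exact h3.trans (congrArg (fun t => (α_ _ _ _).hom ≫ _ ◁ _ ≫ t) h2)
  left_unitality n := by
    have h := powMul_cast X.hom 0 n.card _ _ rfl (Nat.zero_add _) (LambdaCat.inj (λ_ n).hom) fun i => rfl
    have e : powMul X.right 0 n.card _ rfl ≫ powMap X.hom (LambdaCat.inj (λ_ n).hom) =
        𝟙 (𝟙_ W) ▷ tpow X.right n.card ≫ powMul X.right 0 n.card _ rfl ≫
          powMap X.hom (LambdaCat.inj (λ_ n).hom) := by rw [id_whiskerRight, Category.id_comp]
    exact ((e.symm.trans h).trans (powMul_zero _ _ _)).symm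
  right_unitality n := by
    have h := powMul_cast X.hom n.card 0 _ _ rfl (Nat.add_zero _) (LambdaCat.inj (ρ_ n).hom) fun i => rfl
    have e : powMul X.right n.card 0 _ rfl ≫ powMap X.hom (LambdaCat.inj (ρ_ n).hom) =
        tpow X.right n.card ◁ 𝟙 (𝟙_ W) ≫ powMul X.right n.card 0 _ rfl ≫
          powMap X.hom (LambdaCat.inj (ρ_ n).hom) := by
      rw [whiskerLeft_id, Category.id_comp]
    exact ((e.symm.trans h).trans (powMul_right_unit _ _ _)).symm

lemma powMul_braiding' {X : W} (η : 𝟙_ W ⟶ X) (m n p q : ℕ) (h : m + n = p) (h' : n + m = q)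
    (w : Fin p ↪ Fin q) (hl : ∀ i : Fin m, (w ⟨i, by omega⟩ : ℕ) = n + i)
    (hr : ∀ i : Fin n, (w ⟨m + i, by omega⟩ : ℕ) = i) :
    (β_ _ _).hom ≫ powMul X n m q h' = powMul X m n p h ≫ powMap η w := by
  obtain rfl : p = q := by omega
  exact powMul_braiding η m n p h h' w hl hr

instance tensorPowersLaxBraided (X : Under (𝟙_ W)) : ((tensorPowers W).obj X).LaxBraided where
  braided m n := by
    refine (powMul_braiding' X.hom m.card n.card _ _ rfl rfl (LambdaCat.inj (β_ m n).hom)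
      (fun i => ?_) (fun i => ?_)).symm
    · have := LambdaCat.shift_flip m n i
      rw [LambdaCat.shift, dif_pos (by simp [LambdaCat.card_tensor]; omega), if_pos i.2] at this
      exact this
    · have := LambdaCat.shift_flip m n (m.card + i)
      rw [LambdaCat.shift, dif_pos (by simp [LambdaCat.card_tensor]), if_neg (by omega),
        if_pos (by omega), Nat.add_sub_cancel_left] at this
      exact this

instance (X : Under (𝟙_ W)) : IsIso (ε ((tensorPowers W).obj X)) :=
  inferInstanceAs (IsIso (𝟙 (𝟙_ W)))

instance (X : Under (𝟙_ W)) (m n : LambdaCat) : IsIso (μ ((tensorPowers W).obj X) m n) :=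
  inferInstanceAs (IsIso (powMul X.right m.card n.card _ rfl))

instance tensorPowersMap_isMonoidal {X Y : Under (𝟙_ W)} (φ : X ⟶ Y) :
    NatTrans.IsMonoidal ((tensorPowers W).map φ) where
  unit := Category.comp_id _
  tensor m n := (powMul_tpowHom φ.right m.card n.card _ rfl).symm

variable {W' : Type*} [Category W'] [MonoidalCategory W'] [SymmetricCategory W']
  {W'' : Type*} [Category W''] [MonoidalCategory W''] [SymmetricCategory W'']

/-- The comparison of the powers of `F X` with the images of the powers of `X`. -/
def powComp (F : W ⥤ W') [F.LaxMonoidal] (X : W) : (n : ℕ) → (tpow (F.obj X) n ⟶ F.obj (tpow X n))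
  | 0 => ε F
  | n + 1 => F.obj X ◁ powComp F X n ≫ μ F X (tpow X n)

lemma unitPow_powComp (F : W ⥤ W') [F.LaxMonoidal] {X : W} (η : 𝟙_ W ⟶ X) (n : ℕ) :
    unitPow (ε F ≫ F.map η) n ≫ powComp F X n = ε F ≫ F.map (unitPow η n) := by
  induction n with
  | zero => simp [unitPow, powComp]
  | succ n ih =>
    rw [unitPow, unitPow, powComp, Category.assoc, ← id_tensorHom, tensorHom_comp_tensorHom_assoc,
      ih, Category.comp_id, ← tensorHom_comp_tensorHom, Category.assoc, μ_natural, Functor.map_comp]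
    have : (λ_ (𝟙_ W')).inv ≫ (ε F ⊗ₘ ε F) ≫ μ F _ _ = ε F ≫ F.map (λ_ (𝟙_ W)).inv := by
      rw [MonoidalCategory.tensorHom_def', Category.assoc, ← leftUnitor_inv_naturality_assoc,
        left_unitality_inv]
    rw [reassoc_of% this]

lemma swapFirst_μ (F : W ⥤ W') [F.LaxBraided] (X Y Z : W) :
    swapFirst (F.obj X) (F.obj Y) (F.obj Z) ≫ F.obj Y ◁ μ F X Z ≫ μ F Y (X ⊗ Z) =
      F.obj X ◁ μ F Y Z ≫ μ F X (Y ⊗ Z) ≫ F.map (swapFirst X Y Z) := by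
  simp only [swapFirst, Category.assoc, Functor.map_comp]
  rw [associativity_inv_assoc, ← μ_natural_left_assoc, ← comp_whiskerRight_assoc,
    Functor.LaxBraided.braided, comp_whiskerRight_assoc, associativity]

lemma insertAt_powComp (F : W ⥤ W') [F.LaxBraided] (X : W) (n : ℕ) (j : Fin (n + 1)) :
    insertAt (F.obj X) n j ≫ powComp F X (n + 1) = powComp F X (n + 1) ≫ F.map (insertAt X n j) := by
  induction n with
  | zero =>
    obtain rfl : j = 0 := Fin.fin_one_eq_zero _
    simp [insertAt_zero]
  | succ n ih =>
    induction j using Fin.cases with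
    | zero => simp [insertAt_zero]
    | succ j =>
      have e : powComp F X (n + 1) = F.obj X ◁ powComp F X n ≫ μ F X (tpow X n) := rfl
      have e' : powComp F X (n + 2) = F.obj X ◁ powComp F X (n + 1) ≫ μ F X (tpow X (n + 1)) := rfl
      rw [insertAt_succ, insertAt_succ, e', Category.assoc, ← MonoidalCategory.whiskerLeft_comp_assoc,
        ih j, MonoidalCategory.whiskerLeft_comp, Category.assoc, μ_natural_right, e, Functor.map_comp]
      simp only [MonoidalCategory.whiskerLeft_comp, Category.assoc]
      rw [← reassoc_of% (swapFirst_whisker (F.obj X) (F.obj X) (powComp F X n)),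
        reassoc_of% (swapFirst_μ F X X (tpow X n))]

/-- This is where `F` has to be braided: the insertions in `powMap` are made of braidings, which `F`
must respect (`insertAt_powComp`). It makes the comparison of powers natural on `Λ`. -/
lemma powMap_powComp (F : W ⥤ W') [F.LaxBraided] {X : W} (η : 𝟙_ W ⟶ X) {m n : ℕ}
    (f : Fin m ↪ Fin n) :
    powMap (ε F ≫ F.map η) f ≫ powComp F X n = powComp F X m ≫ F.map (powMap η f) := by
  induction m generalizing n with
  | zero => rw [powMap, powMap, unitPow_powComp]; rfl
  | succ m ih =>
    obtain _ | n := n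
    · exact (f 0).elim0
    rw [powMap_succ, powMap_succ, Category.assoc, insertAt_powComp]
    simp only [powComp]
    rw [Category.assoc, ← MonoidalCategory.whiskerLeft_comp_assoc, ih]
    simp

lemma powMul_powComp (F : W ⥤ W') [F.LaxMonoidal] (X : W) (m n p : ℕ) (h : m + n = p) :
    powMul (F.obj X) m n p h ≫ powComp F X p =
      (powComp F X m ⊗ₘ powComp F X n) ≫ μ F _ _ ≫ F.map (powMul X m n p h) := by
  induction m generalizing p with
  | zero =>
    obtain rfl : n = p := by omega
    rw [powMul_zero, powMul_zero, powComp, MonoidalCategory.tensorHom_def']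
    simp
  | succ m ih =>
    obtain _ | p := p
    · omega
    have h0 : m + n = p := by omega
    rw [powMul_succ _ m n p h h0, powMul_succ _ m n p h h0, Functor.map_comp]
    have e : powComp F X (m + 1) = F.obj X ◁ powComp F X m ≫ μ F X (tpow X m) := rfl
    have e' : powComp F X (p + 1) = F.obj X ◁ powComp F X p ≫ μ F X (tpow X p) := rfl
    have key : (powComp F X (m + 1) ⊗ₘ powComp F X n) ≫ μ F (tpow X (m + 1)) (tpow X n) ≫
        F.map (α_ X (tpow X m) (tpow X n)).hom = (α_ _ _ _).hom ≫
        F.obj X ◁ (powComp F X m ⊗ₘ powComp F X n) ≫ F.obj X ◁ μ F (tpow X m) (tpow X n) ≫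
          μ F X _ := by
      have h1 : powComp F X (m + 1) ⊗ₘ powComp F X n =
          ((F.obj X ◁ powComp F X m) ⊗ₘ powComp F X n) ≫ μ F X (tpow X m) ▷ _ := by
        rw [e, ← tensorHom_id, tensorHom_comp_tensorHom, Category.comp_id]
      rw [h1, Category.assoc, associativity, ← id_tensorHom, associator_naturality_assoc,
        id_tensorHom]
    rw [reassoc_of% key, e', Category.assoc, ← MonoidalCategory.whiskerLeft_comp_assoc, ih p h0]
    simp

/-- A monoidal transformation respects the unit and multiplication maps that `powComp` is composed
of. Applied to `phiNat (pwMap ψ)` and to `kellyAssocNat E F`, this serves the naturality of the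
associator in the last variable and the pentagon. -/
lemma powComp_natTrans {F F' : W ⥤ W'} [F.LaxMonoidal] [F'.LaxMonoidal] (θ : F ⟶ F')
    [NatTrans.IsMonoidal θ] (X : W) (n : ℕ) :
    powComp F X n ≫ θ.app (tpow X n) = tpowHom (θ.app X) n ≫ powComp F' X n := by
  induction n with
  | zero =>
    exact (NatTrans.IsMonoidal.unit).trans (Category.id_comp _).symm
  | succ n ih =>
    rw [powComp, powComp, tpowHom, Category.assoc, NatTrans.IsMonoidal.tensor,
      ← id_tensorHom, ← id_tensorHom, tensorHom_comp_tensorHom_assoc, tensorHom_comp_tensorHom_assoc,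
      ih, Category.id_comp, Category.comp_id]

lemma powComp_natural (F : W ⥤ W') [F.LaxMonoidal] {X Y : W} (φ : X ⟶ Y) (n : ℕ) :
    tpowHom (F.map φ) n ≫ powComp F Y n = powComp F X n ≫ F.map (tpowHom φ n) := by
  induction n with
  | zero => simp [tpowHom, powComp]
  | succ n ih =>
    rw [powComp, powComp, tpowHom, Category.assoc, tpowHom, ← μ_natural,
      ← id_tensorHom, ← id_tensorHom, tensorHom_comp_tensorHom_assoc, tensorHom_comp_tensorHom_assoc,
      ih, Category.id_comp, Category.comp_id]

lemma powComp_comp (F : W ⥤ W') [F.LaxMonoidal] (F' : W' ⥤ W'') [F'.LaxMonoidal] (X : W) (n : ℕ) :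
    powComp (F ⋙ F') X n = powComp F' (F.obj X) n ≫ F'.map (powComp F X n) := by
  induction n with
  | zero => rfl
  | succ n ih =>
    rw [powComp, powComp, powComp, ih]
    simp

instance isIso_powComp (F : W ⥤ W') [F.LaxMonoidal] [IsIso (ε F)] [∀ X Y, IsIso (μ F X Y)] (X : W)
    (n : ℕ) : IsIso (powComp F X n) := by
  induction n with
  | zero => rw [powComp]; infer_instance
  | succ n ih => rw [powComp]; infer_instance

end Powers

/-! ### Universal maps, colimit formulas and cocontinuity of Day convolution. -/

noncomputable section DayLevels
open MonoidalCategory.DayFunctor LawfulDayConvolutionMonoidalCategoryStruct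
open scoped ExternalProduct

variable {V : Type u} [Category.{v} V] [MonoidalCategory V] [SymmetricCategory V] [HasColimits V]
  [∀ X : V, PreservesColimits (tensorLeft X)]

/-- The universal map `A(k) ⊗ B(l) ⟶ (A ⊠ B)(k ∨ l)`. -/
def dayη (A B : DayLambda V) (k l : LambdaCat) :
    A.functor.obj (op k) ⊗ B.functor.obj (op l) ⟶ (A ⊗ B).functor.obj (op (k ⊗ l)) :=
  (DayFunctor.η A B).app (op k, op l)

variable (V) in
/-- The universal map from the unit of `V` to the unit of Day convolution at level `0`. -/
def dayν : 𝟙_ V ⟶ (𝟙_ (DayLambda V)).functor.obj (op (𝟙_ LambdaCat)) := ν LambdaCatᵒᵖ V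

lemma dayη_natural (A B : DayLambda V) {k k' l l' : LambdaCat} (f : k ⟶ k') (g : l ⟶ l') :
    (A.functor.map f.op ⊗ₘ B.functor.map g.op) ≫ dayη A B k l =
      dayη A B k' l' ≫ (A ⊗ B).functor.map (f ⊗ₘ g).op := by
  have := (DayFunctor.η A B).naturality (X := (op k', op l')) (Y := (op k, op l)) (f.op, g.op)
  rw [MonoidalCategory.tensorHom_def]
  simpa [dayη] using this

lemma dayη_tensorHom {A A' B B' : DayLambda V} (φ : A ⟶ A') (ψ : B ⟶ B') (k l : LambdaCat) :
    dayη A B k l ≫ (φ ⊗ₘ ψ).natTrans.app (op (k ⊗ l)) =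
      (φ.natTrans.app (op k) ⊗ₘ ψ.natTrans.app (op l)) ≫ dayη A' B' k l :=
  convolutionExtensionUnit_comp_ι_map_tensorHom_app LambdaCatᵒᵖ V (D := DayLambda V) φ ψ (op k) (op l)

lemma dayη_whiskerLeft (A : DayLambda V) {B B' : DayLambda V} (ψ : B ⟶ B') (k l : LambdaCat) :
    dayη A B k l ≫ (A ◁ ψ).natTrans.app (op (k ⊗ l)) =
      (A.functor.obj (op k) ◁ ψ.natTrans.app (op l)) ≫ dayη A B' k l :=
  convolutionExtensionUnit_comp_ι_map_whiskerLeft_app V (D := DayLambda V) A ψ (op k) (op l)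

lemma dayη_whiskerRight {A A' : DayLambda V} (φ : A ⟶ A') (B : DayLambda V) (k l : LambdaCat) :
    dayη A B k l ≫ (φ ▷ B).natTrans.app (op (k ⊗ l)) =
      (φ.natTrans.app (op k) ▷ B.functor.obj (op l)) ≫ dayη A' B k l :=
  convolutionExtensionUnit_comp_ι_map_whiskerRight_app LambdaCatᵒᵖ V (D := DayLambda V) φ B (op k) (op l)

lemma dayη_associator (A B C : DayLambda V) (a b c : LambdaCat) :
    dayη A B a b ▷ C.functor.obj (op c) ≫ dayη (A ⊗ B) C (a ⊗ b) c ≫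
        (α_ A B C).hom.natTrans.app (op ((a ⊗ b) ⊗ c)) =
      (α_ _ _ _).hom ≫ A.functor.obj (op a) ◁ dayη B C b c ≫ dayη A (B ⊗ C) a (b ⊗ c) ≫
        (A ⊗ B ⊗ C).functor.map (α_ a b c).hom.op :=
  associator_hom_unit_unit V (D := DayLambda V) A B C (op a) (op b) (op c)

lemma dayη_leftUnitor (A : DayLambda V) (a : LambdaCat) :
    dayν V ▷ A.functor.obj (op a) ≫ dayη (𝟙_ _) A (𝟙_ _) a ≫
        (λ_ A).hom.natTrans.app (op (𝟙_ _ ⊗ a)) =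
      (λ_ _).hom ≫ A.functor.map (λ_ a).hom.op :=
  leftUnitor_hom_unit_app V (D := DayLambda V) A (op a)

lemma dayη_braiding (A B : DayLambda V) (a b : LambdaCat) :
    dayη A B a b ≫ (β_ A B).hom.natTrans.app (op (a ⊗ b)) =
      (β_ _ _).hom ≫ dayη B A b a ≫ (B ⊗ A).functor.map (β_ a b).hom.op := by
  let := dayConv A B
  let := dayConv B A
  exact DayConvolution.unit_app_braiding_hom_app (F := A.functor) (G := B.functor) (op a) (op b)

lemma day_ext {A B : DayLambda V} {f g : A ⟶ B}
    (h : ∀ k, f.natTrans.app (op k) = g.natTrans.app (op k)) : f = g :=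
  DayFunctor.hom_ext (NatTrans.ext (funext fun k => h k.unop))

lemma day_tensor_ext {A B Z : DayLambda V} {f g : A ⊗ B ⟶ Z}
    (h : ∀ k l, dayη A B k l ≫ f.natTrans.app (op (k ⊗ l)) =
      dayη A B k l ≫ g.natTrans.app (op (k ⊗ l))) : f = g :=
  tensor_hom_ext fun x y => h x.unop y.unop

section
variable {C : Type*} [Category C]
  (T : V ⥤ C) [PreservesColimitsOfSize.{0, 0} T] (A B : DayLambda V) (n : LambdaCat) {Z : C}

/-- The level `n` of a Day convolution is the colimit of `A(k) ⊗ B(l)` over the maps `n ⟶ k ∨ l`. A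
colimit-preserving `T` is carried along because the formula is also needed after tensoring with an
object or acting on a Day functor. -/
lemma tensorLevel_hom_ext {f g : T.obj ((A ⊗ B).functor.obj (op n)) ⟶ Z}
    (h : ∀ k l (u : n ⟶ k ⊗ l), T.map (dayη A B k l ≫ (A ⊗ B).functor.map u.op) ≫ f =
      T.map (dayη A B k l ≫ (A ⊗ B).functor.map u.op) ≫ g) : f = g := by
  have hc := isColimitOfPreserves T
    (isPointwiseLeftKanExtensionConvolutionExtensionUnit (C := LambdaCatᵒᵖ) (V := V) A B (op n))
  refine hc.hom_ext fun j => ?_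
  exact h j.left.1.unop j.left.2.unop j.hom.unop

lemma exists_tensorLevel_desc
    (h : ∀ k l (_ : n ⟶ k ⊗ l), T.obj (A.functor.obj (op k) ⊗ B.functor.obj (op l)) ⟶ Z)
    (w : ∀ {k k' l l'} (f : k ⟶ k') (g : l ⟶ l') (u : n ⟶ k ⊗ l),
      T.map (A.functor.map f.op ⊗ₘ B.functor.map g.op) ≫ h k l u = h k' l' (u ≫ (f ⊗ₘ g))) :
    ∃ d : T.obj ((A ⊗ B).functor.obj (op n)) ⟶ Z, ∀ k l (u : n ⟶ k ⊗ l),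
      T.map (dayη A B k l ≫ (A ⊗ B).functor.map u.op) ≫ d = h k l u := by
  have hc := isColimitOfPreserves T
    (isPointwiseLeftKanExtensionConvolutionExtensionUnit (C := LambdaCatᵒᵖ) (V := V) A B (op n))
  let s : Cocone ((CostructuredArrow.proj (tensor LambdaCatᵒᵖ) (op n) ⋙
      A.functor ⊠ B.functor) ⋙ T) :=
    { pt := Z
      ι :=
        { app := fun j => h j.left.1.unop j.left.2.unop j.hom.unop
          naturality := fun i j φ => by
            have e := w φ.left.1.unop φ.left.2.unop j.hom.unop
            have e2 : j.hom.unop ≫ (φ.left.1.unop ⊗ₘ φ.left.2.unop) = i.hom.unop :=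
              Quiver.Hom.op_inj (CostructuredArrow.w φ)
            rw [e2] at e
            refine Eq.trans (congrArg (fun t => T.map t ≫ h j.left.1.unop j.left.2.unop j.hom.unop)
              (?_ : (A.functor ⊠ B.functor).map φ.left = _)) (e.trans (Category.comp_id _).symm)
            rw [MonoidalCategory.tensorHom_def]
            rfl } }
  exact ⟨hc.desc s, fun k l u => hc.fac s
    (CostructuredArrow.mk (S := tensor LambdaCatᵒᵖ) (Y := (op k, op l)) u.op)⟩

lemma unitLevel_hom_ext {f g : T.obj ((𝟙_ (DayLambda V)).functor.obj (op n)) ⟶ Z}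
    (h : ∀ u : n ⟶ 𝟙_ _, T.map (dayν V ≫ (𝟙_ (DayLambda V)).functor.map u.op) ≫ f =
      T.map (dayν V ≫ (𝟙_ (DayLambda V)).functor.map u.op) ≫ g) : f = g := by
  have hc := isColimitOfPreserves T
    (isPointwiseLeftKanExtensionUnitUnit LambdaCatᵒᵖ V (DayLambda V) (op n))
  refine hc.hom_ext fun j => ?_
  exact h j.hom.unop

lemma exists_unitLevel_desc (h : (n ⟶ 𝟙_ _) → (T.obj (𝟙_ V) ⟶ Z)) :
    ∃ d : T.obj ((𝟙_ (DayLambda V)).functor.obj (op n)) ⟶ Z, ∀ u : n ⟶ 𝟙_ _,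
      T.map (dayν V ≫ (𝟙_ (DayLambda V)).functor.map u.op) ≫ d = h u := by
  have hc := isColimitOfPreserves T
    (isPointwiseLeftKanExtensionUnitUnit LambdaCatᵒᵖ V (DayLambda V) (op n))
  let s : Cocone ((CostructuredArrow.proj (Functor.fromPUnit.{0} (𝟙_ LambdaCatᵒᵖ)) (op n) ⋙
      Functor.fromPUnit.{0} (𝟙_ V)) ⋙ T) :=
    { pt := Z
      ι :=
        { app := fun j => h j.hom.unop
          naturality := fun i j φ => by
            have e2 : j.hom.unop = i.hom.unop :=
              Quiver.Hom.op_inj ((Category.id_comp _).symm.trans (CostructuredArrow.w φ))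
            rw [e2]
            refine Eq.trans (congrArg (· ≫ _) (T.map_id _)) ?_
            exact (Category.id_comp _).trans (Category.comp_id _).symm } }
  exact ⟨hc.desc s, fun u => hc.fac s
    (CostructuredArrow.mk (S := Functor.fromPUnit.{0} (𝟙_ LambdaCatᵒᵖ)) (Y := ⟨⟨⟩⟩) u.op)⟩

end

/-- A natural family `A(k) ⊗ B(l) ⟶ Z(k ∨ l)` as a map out of the Day convolution. -/
def dayDesc {A B Z : DayLambda V}
    (h : ∀ k l, A.functor.obj (op k) ⊗ B.functor.obj (op l) ⟶ Z.functor.obj (op (k ⊗ l)))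
    (w : ∀ {k k' l l' : LambdaCat} (f : k ⟶ k') (g : l ⟶ l'),
      (A.functor.map f.op ⊗ₘ B.functor.map g.op) ≫ h k l =
        h k' l' ≫ Z.functor.map (f ⊗ₘ g).op) : A ⊗ B ⟶ Z :=
  tensorDesc
    { app := fun x => h x.1.unop x.2.unop
      naturality := fun x y f => by
        have := w f.1.unop f.2.unop
        rw [MonoidalCategory.tensorHom_def] at this
        simpa using this }

lemma dayη_desc {A B Z : DayLambda V}
    (h : ∀ k l, A.functor.obj (op k) ⊗ B.functor.obj (op l) ⟶ Z.functor.obj (op (k ⊗ l)))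
    (w : ∀ {k k' l l' : LambdaCat} (f : k ⟶ k') (g : l ⟶ l'),
      (A.functor.map f.op ⊗ₘ B.functor.map g.op) ≫ h k l =
        h k' l' ≫ Z.functor.map (f ⊗ₘ g).op) (k l : LambdaCat) :
    dayη A B k l ≫ (dayDesc h w).natTrans.app (op (k ⊗ l)) = h k l :=
  η_comp_tensorDesc_app _ (op k) (op l)

lemma isIso_of_level {A B : DayLambda V} (f : A ⟶ B) (h : ∀ k, IsIso (f.natTrans.app (op k))) :
    IsIso f := by
  have h1 : IsIso f.natTrans := (NatTrans.isIso_iff_isIso_app _).2 fun k => h k.unop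
  have h2 : IsIso ((DayFunctor.equiv LambdaCatᵒᵖ V).functor.map f) := h1
  exact isIso_of_reflects_iso f (DayFunctor.equiv LambdaCatᵒᵖ V).functor

/-- Evaluation at `k`. -/
abbrev levelFunctor (k : LambdaCat) : DayLambda V ⥤ V :=
  (DayFunctor.equiv LambdaCatᵒᵖ V).functor ⋙ (evaluation _ _).obj (op k)

lemma preservesColimits_of_levels {C : Type*} [Category C] (F : C ⥤ DayLambda V)
    (h : ∀ k, PreservesColimitsOfSize.{0, 0} (F ⋙ levelFunctor k)) :
    PreservesColimitsOfSize.{0, 0} F := by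
  have h1 : PreservesColimitsOfSize.{0, 0} (F ⋙ (DayFunctor.equiv LambdaCatᵒᵖ V).functor) :=
    ⟨fun {J} _ => preservesColimitsOfShape_of_evaluation _ _ fun k => (h k.unop).preservesColimitsOfShape⟩
  exact preservesColimits_of_reflects_of_preserves F (DayFunctor.equiv LambdaCatᵒᵖ V).functor

instance preservesColimits_levelFunctor (k : LambdaCat) :
    PreservesColimitsOfSize.{0, 0} (levelFunctor (V := V) k) := by
  have : HasColimitsOfSize.{0, 0} V := hasSmallestColimitsOfHasColimits V
  have : PreservesColimitsOfSize.{0, 0} ((evaluation LambdaCatᵒᵖ V).obj (op k)) :=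
    ⟨fun {J} _ => evaluation_preservesColimitsOfShape _⟩
  infer_instance

/-- Day convolution with a fixed functor as a left Kan extension functor. -/
def tensorLeftIsoLan (A : DayLambda V) :
    tensorLeft A ⋙ (DayFunctor.equiv LambdaCatᵒᵖ V).functor ≅
      (DayFunctor.equiv LambdaCatᵒᵖ V).functor ⋙
        (Prod.sectR A.functor (LambdaCatᵒᵖ ⥤ V) ⋙
        externalProductBifunctor LambdaCatᵒᵖ LambdaCatᵒᵖ V) ⋙ (tensor LambdaCatᵒᵖ).lan :=
  NatIso.ofComponents (fun B => Functor.leftKanExtensionUnique (A ⊗ B).functor (DayFunctor.η A B)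
      ((tensor LambdaCatᵒᵖ).lan.obj (A.functor ⊠ B.functor))
      ((tensor LambdaCatᵒᵖ).lanUnit.app (A.functor ⊠ B.functor)))
    (fun {B B'} f => by
      apply Functor.hom_ext_of_isLeftKanExtension (A ⊗ B).functor (DayFunctor.η A B)
      ext ⟨k, l⟩
      have h1 := dayη_whiskerLeft A f k.unop l.unop
      have h2 : dayη A B k.unop l.unop ≫ (Functor.leftKanExtensionUnique (A ⊗ B).functor
          (DayFunctor.η A B) ((tensor LambdaCatᵒᵖ).lan.obj (A.functor ⊠ B.functor))
          ((tensor LambdaCatᵒᵖ).lanUnit.app (A.functor ⊠ B.functor))).hom.app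
            ((tensor LambdaCatᵒᵖ).obj (k, l)) = ((tensor LambdaCatᵒᵖ).lanUnit.app (A.functor ⊠ B.functor)).app (k, l) :=
        (Functor.descOfIsLeftKanExtension_fac_app (A ⊗ B).functor (DayFunctor.η A B)
        ((tensor LambdaCatᵒᵖ).lan.obj (A.functor ⊠ B.functor))
        ((Iso.refl _).hom ≫ (tensor LambdaCatᵒᵖ).lanUnit.app (A.functor ⊠ B.functor)) (k, l)).trans
          (Category.id_comp _)
      have h3 : dayη A B' k.unop l.unop ≫ (Functor.leftKanExtensionUnique (A ⊗ B').functor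
          (DayFunctor.η A B') ((tensor LambdaCatᵒᵖ).lan.obj (A.functor ⊠ B'.functor))
          ((tensor LambdaCatᵒᵖ).lanUnit.app (A.functor ⊠ B'.functor))).hom.app
            ((tensor LambdaCatᵒᵖ).obj (k, l)) = ((tensor LambdaCatᵒᵖ).lanUnit.app (A.functor ⊠ B'.functor)).app (k, l) :=
        (Functor.descOfIsLeftKanExtension_fac_app (A ⊗ B').functor (DayFunctor.η A B')
        ((tensor LambdaCatᵒᵖ).lan.obj (A.functor ⊠ B'.functor))
        ((Iso.refl _).hom ≫ (tensor LambdaCatᵒᵖ).lanUnit.app (A.functor ⊠ B'.functor)) (k, l)).trans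
          (Category.id_comp _)
      have h4 := congrArg (fun t => t.app (k, l))
        ((tensor LambdaCatᵒᵖ).lanUnit.naturality
        ((externalProductBifunctor LambdaCatᵒᵖ LambdaCatᵒᵖ V).map
          (((𝟙 A.functor, f.natTrans) : (A.functor, B.functor) ⟶ (A.functor, B'.functor)))))
      have h5 : A.functor.obj (op k.unop) ◁ f.natTrans.app (op l.unop) =
          ((externalProductBifunctor LambdaCatᵒᵖ LambdaCatᵒᵖ V).map
          (((𝟙 A.functor, f.natTrans) : (A.functor, B.functor) ⟶ (A.functor, B'.functor)))).app
            (k, l) := by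
        simp
      refine (Category.assoc _ _ _).symm.trans ((congrArg (· ≫ _) h1).trans ?_)
      refine (Category.assoc _ _ _).trans ((congrArg (fun t =>
        A.functor.obj (op k.unop) ◁ f.natTrans.app (op l.unop) ≫ t) h3).trans ?_)
      refine Eq.trans ?_ (h4.trans ((congrArg (· ≫ _) h2).symm.trans (Category.assoc _ _ _)))
      exact congrArg (· ≫ _) h5)

instance preservesColimits_externalProduct (A : LambdaCatᵒᵖ ⥤ V) :
    PreservesColimitsOfSize.{0, 0} (Prod.sectR A (LambdaCatᵒᵖ ⥤ V) ⋙
        externalProductBifunctor LambdaCatᵒᵖ LambdaCatᵒᵖ V) := by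
  have : HasColimitsOfSize.{0, 0} V := hasSmallestColimitsOfHasColimits V
  refine ⟨fun {J} _ => preservesColimitsOfShape_of_evaluation _ _ fun k => ?_⟩
  have : PreservesColimitsOfShape J ((evaluation LambdaCatᵒᵖ V).obj k.2) :=
    evaluation_preservesColimitsOfShape _
  have e : (evaluation LambdaCatᵒᵖ V).obj k.2 ⋙ tensorLeft (A.obj k.1) ≅
      (Prod.sectR A (LambdaCatᵒᵖ ⥤ V) ⋙ externalProductBifunctor LambdaCatᵒᵖ LambdaCatᵒᵖ V) ⋙
        (evaluation (LambdaCatᵒᵖ × LambdaCatᵒᵖ) V).obj k :=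
    NatIso.ofComponents (fun _ => Iso.refl _) (fun f => (Category.comp_id _).trans
      ((by simp : A.obj k.1 ◁ f.app k.2 = (𝟙 _ ▷ _) ≫ A.obj k.1 ◁ f.app k.2).trans
        (Category.id_comp _).symm))
  exact preservesColimitsOfShape_of_natIso e

/-- Convolution with `A` is the external product with `A`, which preserves colimits levelwise,
followed by the left Kan extension along `∨`, which is a left adjoint. -/
instance preservesColimits_dayTensorLeft (A : DayLambda V) :
    PreservesColimitsOfSize.{0, 0} (tensorLeft A) := by
  have h : PreservesColimitsOfSize.{0, 0} ((tensor LambdaCatᵒᵖ).lan (H := V)) :=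
    ((tensor LambdaCatᵒᵖ).lanAdjunction V).leftAdjoint_preservesColimits
  have : PreservesColimitsOfSize.{0, 0} (tensorLeft A ⋙ (DayFunctor.equiv LambdaCatᵒᵖ V).functor) :=
    preservesColimits_of_natIso (tensorLeftIsoLan A).symm
  exact preservesColimits_of_reflects_of_preserves _ (DayFunctor.equiv LambdaCatᵒᵖ V).functor

instance preservesColimits_dayTensorRight (A : DayLambda V) :
    PreservesColimitsOfSize.{0, 0} (tensorRight A) :=
  preservesColimits_of_natIso (BraidedCategory.tensorLeftIsoTensorRight A)

end DayLevels

/-! ### The levelwise action of `V` on Day functors, and its interchange with Day convolution. -/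

lemma tensorμ_braiding {C : Type u} [Category.{v} C] [MonoidalCategory C] [SymmetricCategory C]
    (a b c d : C) : tensorμ a b c d ≫ ((β_ a c).hom ⊗ₘ (β_ b d).hom) =
      (β_ (a ⊗ b) (c ⊗ d)).hom ≫ tensorμ c d a b := by
  -- In the composite the braidings of `a` with `d` in the two directions meet and cancel by
  -- symmetry.
  have h : c ◁ (β_ a d).hom ▷ b ≫ c ◁ (β_ d a).hom ▷ b = 𝟙 _ := by
    rw [← whiskerLeft_comp, ← comp_whiskerRight, SymmetricCategory.symmetry, id_whiskerRight,
      whiskerLeft_id]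
  simp [tensorμ, SymmetricCategory.braiding_swap_eq_inv_braiding c b, MonoidalCategory.tensorHom_def,
    reassoc_of% h]

noncomputable section Action
open MonoidalCategory.DayFunctor

variable {V : Type u} [Category.{v} V] [MonoidalCategory V] [SymmetricCategory V] [HasColimits V]
  [∀ X : V, PreservesColimits (tensorLeft X)]

/-- The levelwise tensor product of an object of `V` with a functor. -/
@[reducible] def act (x : V) (A : DayLambda V) : DayLambda V :=
  ⟨{ obj := fun k => x ⊗ A.functor.obj k
     map := fun f => x ◁ A.functor.map f
     map_id := fun k => by rw [CategoryTheory.Functor.map_id, MonoidalCategory.whiskerLeft_id]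
     map_comp := fun f g => by rw [Functor.map_comp, MonoidalCategory.whiskerLeft_comp] }⟩

/-- The levelwise tensor product of morphisms. -/
def actMap {x y : V} {A B : DayLambda V} (f : x ⟶ y) (g : A ⟶ B) : act x A ⟶ act y B :=
  ⟨{ app := fun k => f ⊗ₘ g.natTrans.app k
     naturality := fun k l u => by
      change x ◁ A.functor.map u ≫ (f ⊗ₘ g.natTrans.app l) =
        (f ⊗ₘ g.natTrans.app k) ≫ y ◁ B.functor.map u
      rw [← id_tensorHom, ← id_tensorHom, tensorHom_comp_tensorHom, tensorHom_comp_tensorHom,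
        g.natTrans.naturality, Category.id_comp, Category.comp_id] }⟩

lemma actMap_app {x y : V} {A B : DayLambda V} (f : x ⟶ y) (g : A ⟶ B) (k : LambdaCatᵒᵖ) :
    (actMap f g).natTrans.app k = f ⊗ₘ g.natTrans.app k := rfl

lemma day_comp_app {A B C : DayLambda V} (f : A ⟶ B) (g : B ⟶ C) (k : LambdaCatᵒᵖ) :
    (f ≫ g).natTrans.app k = f.natTrans.app k ≫ g.natTrans.app k := rfl

lemma day_id_app (A : DayLambda V) (k : LambdaCatᵒᵖ) :
    (𝟙 A : A ⟶ A).natTrans.app k = 𝟙 (A.functor.obj k) := rfl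

@[simp] lemma actMap_id (x : V) (A : DayLambda V) : actMap (𝟙 x) (𝟙 A) = 𝟙 (act x A) :=
  day_ext fun _ => id_tensorHom_id _ _

lemma actMap_comp {x y z : V} {A B C : DayLambda V} (f : x ⟶ y) (f' : y ⟶ z) (g : A ⟶ B)
    (g' : B ⟶ C) : actMap f g ≫ actMap f' g' = actMap (f ≫ f') (g ≫ g') :=
  day_ext fun _ => tensorHom_comp_tensorHom _ _ _ _

/-- `A ↦ x · A`. -/
@[simps] def actL (x : V) : DayLambda V ⥤ DayLambda V where
  obj A := act x A
  map g := actMap (𝟙 x) g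
  map_id A := actMap_id x A
  map_comp f g := by rw [actMap_comp, Category.comp_id]

/-- `x ↦ x · A`. -/
@[simps] def actR (A : DayLambda V) : V ⥤ DayLambda V where
  obj x := act x A
  map f := actMap f (𝟙 A)
  map_id x := actMap_id x A
  map_comp f g := by rw [actMap_comp, Category.comp_id]

instance preservesColimits_actL (x : V) : PreservesColimitsOfSize.{0, 0} (actL (V := V) x) :=
  preservesColimits_of_levels _ fun k => preservesColimits_of_natIso
    (NatIso.ofComponents (fun _ => Iso.refl _) (fun g =>
      (Category.comp_id _).trans ((id_tensorHom x (g.natTrans.app (op k))).symm.trans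
        (Category.id_comp _).symm)) : levelFunctor k ⋙ tensorLeft x ≅ actL x ⋙ levelFunctor k)

instance preservesColimits_actR (A : DayLambda V) : PreservesColimitsOfSize.{0, 0} (actR A) :=
  preservesColimits_of_levels _ fun k => preservesColimits_of_natIso
    (NatIso.ofComponents (fun _ => Iso.refl _) (fun g =>
      (Category.comp_id _).trans ((tensorHom_id g (A.functor.obj (op k))).symm.trans
        (Category.id_comp _).symm)) : tensorRight (A.functor.obj (op k)) ≅ actR A ⋙ levelFunctor k)

lemma tensorμ_dayη_natural (x y : V) (A B : DayLambda V) {k k' l l' : LambdaCat} (f : k ⟶ k')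
    (g : l ⟶ l') : (x ◁ A.functor.map f.op ⊗ₘ y ◁ B.functor.map g.op) ≫
      tensorμ x (A.functor.obj (op k)) y (B.functor.obj (op l)) ≫ (x ⊗ y) ◁ dayη A B k l =
    (tensorμ x (A.functor.obj (op k')) y (B.functor.obj (op l')) ≫ (x ⊗ y) ◁ dayη A B k' l') ≫
      (x ⊗ y) ◁ (A ⊗ B).functor.map (f ⊗ₘ g).op := by
  have := tensorμ_natural (𝟙 x) (A.functor.map f.op) (𝟙 y) (B.functor.map g.op)
  rw [id_tensorHom_id, id_tensorHom, id_tensorHom, id_tensorHom] at this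
  rw [reassoc_of% this, Category.assoc, ← whiskerLeft_comp, ← whiskerLeft_comp, dayη_natural]

/-- The interchange of the levelwise tensor product and Day convolution. -/
def actτ (x y : V) (A B : DayLambda V) : act x A ⊗ act y B ⟶ act (x ⊗ y) (A ⊗ B) :=
  dayDesc (A := act x A) (B := act y B) (Z := act (x ⊗ y) (A ⊗ B))
    (fun k l => tensorμ x (A.functor.obj (op k)) y (B.functor.obj (op l)) ≫ (x ⊗ y) ◁ dayη A B k l)
    (tensorμ_dayη_natural x y A B)

lemma dayη_actτ (x y : V) (A B : DayLambda V) (k l : LambdaCat) :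
    dayη (act x A) (act y B) k l ≫ (actτ x y A B).natTrans.app (op (k ⊗ l)) =
      tensorμ x (A.functor.obj (op k)) y (B.functor.obj (op l)) ≫ (x ⊗ y) ◁ dayη A B k l :=
  dayη_desc (A := act x A) (B := act y B) (Z := act (x ⊗ y) (A ⊗ B)) _
    (tensorμ_dayη_natural x y A B) k l

lemma actτ_natural {x x' y y' : V} {A A' B B' : DayLambda V} (f : x ⟶ x') (g : A ⟶ A')
    (f' : y ⟶ y') (g' : B ⟶ B') :
    (actMap f g ⊗ₘ actMap f' g') ≫ actτ x' y' A' B' =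
      actτ x y A B ≫ actMap (f ⊗ₘ f') (g ⊗ₘ g') := by
  refine day_tensor_ext fun k l => ?_
  rw [day_comp_app, day_comp_app, reassoc_of% dayη_tensorHom, reassoc_of% dayη_actτ, dayη_actτ]
  simp only [actMap_app]
  have h := tensorμ_natural f (g.natTrans.app (op k)) f' (g'.natTrans.app (op l))
  rw [reassoc_of% h]
  refine congrArg (fun t => tensorμ x (A.functor.obj (op k)) y (B.functor.obj (op l)) ≫ t) ?_
  rw [← id_tensorHom, ← id_tensorHom, tensorHom_comp_tensorHom, tensorHom_comp_tensorHom,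
    dayη_tensorHom, Category.id_comp, Category.comp_id]

lemma actτ_braiding (x y : V) (A B : DayLambda V) :
    actτ x y A B ≫ actMap (β_ x y).hom (β_ A B).hom = (β_ _ _).hom ≫ actτ y x B A := by
  refine day_tensor_ext fun k l => ?_
  rw [day_comp_app, day_comp_app, reassoc_of% dayη_actτ, reassoc_of% dayη_braiding]
  have h1 : (act y B ⊗ act x A).functor.map (β_ k l).hom.op ≫
      (actτ y x B A).natTrans.app (op (k ⊗ l)) =
      (actτ y x B A).natTrans.app (op (l ⊗ k)) ≫ (y ⊗ x) ◁ (B ⊗ A).functor.map (β_ k l).hom.op :=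
    (actτ y x B A).natTrans.naturality (β_ k l).hom.op
  rw [h1, reassoc_of% dayη_actτ, actMap_app, ← id_tensorHom, tensorHom_comp_tensorHom,
    dayη_braiding, ← whiskerLeft_comp, Category.id_comp]
  have h2 : tensorμ x (A.functor.obj (op k)) y (B.functor.obj (op l)) ≫ ((β_ _ _).hom ⊗ₘ (β_ _ _).hom)
      = (β_ _ _).hom ≫ tensorμ y (B.functor.obj (op l)) x (A.functor.obj (op k)) :=
    tensorμ_braiding _ _ _ _
  have h3 : ((β_ x y).hom ⊗ₘ (β_ (A.functor.obj (op k)) (B.functor.obj (op l))).hom ≫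
      dayη B A l k ≫ (B ⊗ A).functor.map (β_ k l).hom.op) = ((β_ x y).hom ⊗ₘ (β_ (A.functor.obj (op k))
        (B.functor.obj (op l))).hom) ≫ (y ⊗ x) ◁ (dayη B A l k ≫ (B ⊗ A).functor.map (β_ k l).hom.op) := by
    rw [← id_tensorHom, tensorHom_comp_tensorHom, Category.comp_id]
  rw [h3, reassoc_of% h2]

/-- The inner convolution is resolved under `- ⊗ C(c)`, which preserves its colimit. -/
lemma day_tensor_ext₃ {A B C Z : DayLambda V} {f g : (A ⊗ B) ⊗ C ⟶ Z}
    (h : ∀ a b c, dayη A B a b ▷ C.functor.obj (op c) ≫ dayη (A ⊗ B) C (a ⊗ b) c ≫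
        f.natTrans.app (op ((a ⊗ b) ⊗ c)) =
      dayη A B a b ▷ C.functor.obj (op c) ≫ dayη (A ⊗ B) C (a ⊗ b) c ≫
        g.natTrans.app (op ((a ⊗ b) ⊗ c))) : f = g := by
  refine day_tensor_ext fun k c => tensorLevel_hom_ext (tensorRight (C.functor.obj (op c))) A B k
    fun a b u => ?_
  have key (f : (A ⊗ B) ⊗ C ⟶ Z) : (dayη A B a b ≫ (A ⊗ B).functor.map u.op) ▷ C.functor.obj (op c) ≫
      dayη (A ⊗ B) C k c ≫ f.natTrans.app (op (k ⊗ c)) =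
      (dayη A B a b ▷ C.functor.obj (op c) ≫ dayη (A ⊗ B) C (a ⊗ b) c ≫
        f.natTrans.app (op ((a ⊗ b) ⊗ c))) ≫ Z.functor.map (u ⊗ₘ 𝟙 c).op := by
    have h1 := dayη_natural (A ⊗ B) C u (𝟙 c)
    rw [op_id, CategoryTheory.Functor.map_id, tensorHom_id] at h1
    rw [comp_whiskerRight, Category.assoc, reassoc_of% h1, f.natTrans.naturality]
    simp only [Category.assoc]
  exact (key f).trans ((congrArg (· ≫ _) (h a b c)).trans (key g).symm)

lemma day_unit_tensor_ext {A Z : DayLambda V} {f g : 𝟙_ (DayLambda V) ⊗ A ⟶ Z}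
    (h : ∀ a, dayν V ▷ A.functor.obj (op a) ≫ dayη (𝟙_ _) A (𝟙_ _) a ≫
        f.natTrans.app (op (𝟙_ _ ⊗ a)) =
      dayν V ▷ A.functor.obj (op a) ≫ dayη (𝟙_ _) A (𝟙_ _) a ≫
        g.natTrans.app (op (𝟙_ _ ⊗ a))) : f = g := by
  refine day_tensor_ext fun k c => unitLevel_hom_ext (tensorRight (A.functor.obj (op c))) k
    fun u => ?_
  have key (f : 𝟙_ (DayLambda V) ⊗ A ⟶ Z) :
      (dayν V ≫ (𝟙_ (DayLambda V)).functor.map u.op) ▷ A.functor.obj (op c) ≫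
      dayη (𝟙_ _) A k c ≫ f.natTrans.app (op (k ⊗ c)) =
      (dayν V ▷ A.functor.obj (op c) ≫ dayη (𝟙_ _) A (𝟙_ _) c ≫
        f.natTrans.app (op (𝟙_ _ ⊗ c))) ≫ Z.functor.map (u ⊗ₘ 𝟙 c).op := by
    have h1 := dayη_natural (𝟙_ (DayLambda V)) A u (𝟙 c)
    rw [op_id, CategoryTheory.Functor.map_id, tensorHom_id] at h1
    rw [comp_whiskerRight, Category.assoc, reassoc_of% h1, f.natTrans.naturality]
    simp only [Category.assoc]
  exact (key f).trans ((congrArg (· ≫ _) (h c)).trans (key g).symm)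

lemma day_hom_naturality {A B : DayLambda V} (f : A ⟶ B) {k l : LambdaCat} (u : k ⟶ l) :
    A.functor.map u.op ≫ f.natTrans.app (op k) = f.natTrans.app (op l) ≫ B.functor.map u.op :=
  f.natTrans.naturality u.op

/-- With `actτ_left_unit` and `actτ_braiding`, this makes `(x, A) ↦ x · A` a braided monoidal
functor of the pair. On the universal maps it becomes the corresponding statement for `⊗` on `V ×
V`, which is `tensor_associativity`. -/
lemma actτ_assoc (x y z : V) (A B C : DayLambda V) :
    actτ x y A B ▷ act z C ≫ actτ (x ⊗ y) z (A ⊗ B) C ≫ actMap (α_ x y z).hom (α_ A B C).hom =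
      (α_ _ _ _).hom ≫ act x A ◁ actτ y z B C ≫ actτ x (y ⊗ z) A (B ⊗ C) := by
  refine day_tensor_ext₃ fun a b c => ?_
  simp only [day_comp_app]
  have h2 := dayη_associator (act x A) (act y B) (act z C) a b c
  have h3 := dayη_whiskerRight (actτ x y A B) (act z C) (a ⊗ b) c
  have h4 := dayη_whiskerLeft (act x A) (actτ y z B C) a (b ⊗ c)
  have h5 := day_hom_naturality (act x A ◁ actτ y z B C) (α_ a b c).hom
  have h6 := day_hom_naturality (actτ x (y ⊗ z) A (B ⊗ C)) (α_ a b c).hom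
  have h7 := dayη_actτ x (y ⊗ z) A (B ⊗ C) a (b ⊗ c)
  have h8 := dayη_actτ (x ⊗ y) z (A ⊗ B) C (a ⊗ b) c
  have h9 := dayη_actτ x y A B a b
  have h10 := dayη_actτ y z B C b c
  have h11 := dayη_associator A B C a b c
  have h12 := tensor_associativity x (A.functor.obj (op a)) y (B.functor.obj (op b)) z
    (C.functor.obj (op c))
  have h13 := tensorμ_natural_left (𝟙 (x ⊗ y)) (dayη A B a b) z (C.functor.obj (op c))
  have h14 := tensorμ_natural_right x (A.functor.obj (op a)) (𝟙 (y ⊗ z)) (dayη B C b c)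
  dsimp only at h2 h3 h4 h5 h6 h7 h8 h9 h10
  rw [reassoc_of% h2, reassoc_of% h3, reassoc_of% h5, reassoc_of% h4, h6, reassoc_of% h7,
    reassoc_of% h8, ← comp_whiskerRight_assoc, h9, ← whiskerLeft_comp_assoc, h10, actMap_app]
  rw [id_tensorHom] at h13 h14
  rw [comp_whiskerRight, whiskerLeft_comp, Category.assoc, Category.assoc, reassoc_of% h13,
    reassoc_of% h14, ← reassoc_of% h12]
  simp only [← id_tensorHom, ← tensorHom_id, tensorHom_comp_tensorHom, Category.comp_id,
    Category.id_comp, id_tensorHom_id] at h11 ⊢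
  rw [h11]

/-- The unit of the action. -/
def actUnit (A : DayLambda V) : A ⟶ act (𝟙_ V) A :=
  ⟨{ app := fun k => (λ_ (A.functor.obj k)).inv
     naturality := fun _ _ f => leftUnitor_inv_naturality (A.functor.map f) }⟩

lemma actUnit_app (A : DayLambda V) (k : LambdaCatᵒᵖ) :
    (actUnit A).natTrans.app k = (λ_ (A.functor.obj k)).inv := rfl

instance isIso_actUnit (A : DayLambda V) : IsIso (actUnit A) := isIso_of_level _ fun k => by
  rw [actUnit_app]; infer_instance

lemma actUnit_natural {A B : DayLambda V} (f : A ⟶ B) :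
    f ≫ actUnit B = actUnit A ≫ actMap (𝟙 _) f :=
  day_ext fun k => by
    simp only [day_comp_app, actUnit_app, actMap_app, id_tensorHom]
    exact leftUnitor_inv_naturality _

/-- The associativity of the action. -/
def actAssoc (x y : V) (A : DayLambda V) : act (x ⊗ y) A ⟶ act x (act y A) :=
  ⟨{ app := fun k => (α_ x y (A.functor.obj k)).hom
     naturality := fun _ _ f => by
      change (x ⊗ y) ◁ A.functor.map f ≫ _ = _ ≫ x ◁ y ◁ A.functor.map f
      rw [associator_naturality_right] }⟩

lemma actAssoc_app (x y : V) (A : DayLambda V) (k : LambdaCatᵒᵖ) :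
    (actAssoc x y A).natTrans.app k = (α_ x y (A.functor.obj k)).hom := rfl

instance isIso_actAssoc (x y : V) (A : DayLambda V) : IsIso (actAssoc x y A) := isIso_of_level _ fun k => by
  rw [actAssoc_app]; infer_instance

lemma actAssoc_natural {x x' y y' : V} {A A' : DayLambda V} (f : x ⟶ x') (g : y ⟶ y')
    (φ : A ⟶ A') : actMap (f ⊗ₘ g) φ ≫ actAssoc x' y' A' =
      actAssoc x y A ≫ actMap f (actMap g φ) :=
  day_ext fun k => by
    simp only [day_comp_app, actAssoc_app, actMap_app]
    exact associator_naturality _ _ _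

lemma actτ_left_unit (x : V) (A : DayLambda V) :
    actUnit (𝟙_ (DayLambda V)) ▷ act x A ≫ actτ (𝟙_ V) x (𝟙_ _) A ≫
      actMap (λ_ x).hom (λ_ A).hom = (λ_ _).hom := by
  refine day_unit_tensor_ext fun a => ?_
  simp only [day_comp_app]
  have h1 := dayη_leftUnitor A a
  have h2 := dayη_leftUnitor (act x A) a
  have h3 := dayη_whiskerRight (actUnit (𝟙_ (DayLambda V))) (act x A) (𝟙_ _) a
  have h4 := dayη_actτ (𝟙_ V) x (𝟙_ _) A (𝟙_ _) a
  have h5 := leftUnitor_monoidal x (A.functor.obj (op a))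
  have h6 := tensorμ_natural_left (𝟙 (𝟙_ V)) (dayν V) x (A.functor.obj (op a))
  dsimp only at h2 h3 h4
  rw [h2, reassoc_of% h3, reassoc_of% h4, actMap_app, actUnit_app, ← comp_whiskerRight_assoc,
    leftUnitor_inv_naturality (dayν V), comp_whiskerRight, Category.assoc]
  rw [id_tensorHom, id_whiskerRight, id_tensorHom] at h6
  rw [reassoc_of% h6]
  rw [tensor_left_unitality, Category.assoc, Category.assoc]
  refine congrArg (fun t => (λ_ (𝟙_ V)).inv ▷ _ ≫ tensorμ _ _ _ _ ≫ t) ?_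
  rw [← id_tensorHom, ← id_tensorHom, ← id_tensorHom, tensorHom_comp_tensorHom,
    tensorHom_comp_tensorHom, tensorHom_comp_tensorHom, h1]
  simp

/-- On the universal maps this is `associator_monoidal`: the associator of `V` is compatible with
the interchange. -/
lemma actτ_actAssoc (x y z w : V) (A B : DayLambda V) :
    (actAssoc x z A ⊗ₘ actAssoc y w B) ≫ actτ x y (act z A) (act w B) ≫ actMap (𝟙 _) (actτ z w A B) =
      actτ (x ⊗ z) (y ⊗ w) A B ≫ actMap (tensorμ x z y w) (𝟙 _) ≫ actAssoc (x ⊗ y) (z ⊗ w) (A ⊗ B) := by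
  refine day_tensor_ext fun k l => ?_
  simp only [day_comp_app]
  have h1 := dayη_tensorHom (actAssoc x z A) (actAssoc y w B) k l
  have h2 := dayη_actτ x y (act z A) (act w B) k l
  have h3 := dayη_actτ (x ⊗ z) (y ⊗ w) A B k l
  have h4 := dayη_actτ z w A B k l
  have h5 := associator_monoidal x z (A.functor.obj (op k)) y w (B.functor.obj (op l))
  dsimp only at h1 h2 h3 h4
  rw [reassoc_of% h1, reassoc_of% h2, reassoc_of% h3]
  simp only [actMap_app, actAssoc_app, day_id_app]
  rw [id_tensorHom, tensorHom_id, ← whiskerLeft_comp, h4, whiskerLeft_comp, ← reassoc_of% h5,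
    whisker_exchange_assoc, associator_naturality_right]

/-- Tensoring with `x ⊗ y` preserves the colimit that defines `(A ⊠ B)(n)`, so the inverse can be
defined on the terms of this colimit, as the inverse interchange `tensorδ`. -/
instance isIso_actτ (x y : V) (A B : DayLambda V) : IsIso (actτ x y A B) := by
  refine isIso_of_level _ fun n => ?_
  obtain ⟨d, hd⟩ := exists_tensorLevel_desc (tensorLeft (x ⊗ y)) A B n
    (Z := (act x A ⊗ act y B).functor.obj (op n))
    (fun k l u => tensorδ _ _ _ _ ≫ dayη (act x A) (act y B) k l ≫ (act x A ⊗ act y B).functor.map u.op)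
    (fun {k k' l l'} f g u => by
      have h1 := tensorμ_natural (𝟙 x) (A.functor.map f.op) (𝟙 y) (B.functor.map g.op)
      rw [id_tensorHom_id, id_tensorHom, id_tensorHom, id_tensorHom] at h1
      have h2 := congrArg (fun t => tensorδ _ _ _ _ ≫ t ≫ tensorδ _ _ _ _) h1
      simp only [Category.assoc, tensorμ_tensorδ, Category.comp_id, tensorδ_tensorμ_assoc] at h2
      have h3 := dayη_natural (act x A) (act y B) f g
      dsimp only [curriedTensor_obj_map, curriedTensor_obj_obj, Functor.id_obj] at h3 ⊢
      rw [← reassoc_of% h2, reassoc_of% h3, op_comp, Functor.map_comp])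
  have h4 (k l) (u : n ⟶ k ⊗ l) := day_hom_naturality (actτ x y A B) u
  have h5 (k l) := dayη_actτ x y A B k l
  refine ⟨d, ?_, ?_⟩
  · refine tensorLevel_hom_ext (𝟭 V) (act x A) (act y B) n fun k l u => ?_
    specialize hd k l u
    dsimp only [curriedTensor_obj_map, curriedTensor_obj_obj, Functor.id_obj, Functor.id_map] at hd h4 h5 ⊢
    rw [whiskerLeft_comp, Category.assoc] at hd
    rw [Category.assoc, reassoc_of% h4, reassoc_of% h5, hd, tensorμ_tensorδ_assoc, Category.comp_id]
  · refine tensorLevel_hom_ext (tensorLeft (x ⊗ y)) A B n fun k l u => ?_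
    specialize hd k l u
    dsimp only [curriedTensor_obj_map, curriedTensor_obj_obj, Functor.id_obj, Functor.id_map] at hd h4 h5 ⊢
    rw [reassoc_of% hd, h4, reassoc_of% h5, tensorδ_tensorμ_assoc, ← whiskerLeft_comp,
      Category.comp_id]

end Action

/-! ### The coend `∫^k X(k) · G(k)` and its universal properties. -/

noncomputable section Phi
open MonoidalCategory.DayFunctor

variable {V : Type u} [Category.{v} V] [MonoidalCategory V] [SymmetricCategory V] [HasColimits V]
  [∀ X : V, PreservesColimits (tensorLeft X)]

/-- The coend `∫^k X(k) · G(k)`. -/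
def phi (X : DayLambda V) (G : LambdaCat ⥤ DayLambda V) : DayLambda V :=
  ⟨(G ⋙ (DayFunctor.equiv LambdaCatᵒᵖ V).functor).flip ⋙ (tensorOver V).obj X.functor⟩

/-- The components of the coend. -/
def phiι (X : DayLambda V) (G : LambdaCat ⥤ DayLambda V) (k : LambdaCat) :
    act (X.functor.obj (op k)) (G.obj k) ⟶ phi X G :=
  ⟨{ app := fun n => tensorOverι V X.functor
        ((G ⋙ (DayFunctor.equiv LambdaCatᵒᵖ V).functor).flip.obj n) k
     naturality := fun _ _ f => (tensorOverι_map V X.functor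
        ((G ⋙ (DayFunctor.equiv LambdaCatᵒᵖ V).functor).flip.map f) k).symm }⟩

lemma tensorOverι_condition (F : LambdaCatᵒᵖ ⥤ V) (G : LambdaCat ⥤ V) {k l : LambdaCat} (f : k ⟶ l) :
    F.map f.op ▷ G.obj k ≫ tensorOverι V F G k = F.obj (op l) ◁ G.map f ≫ tensorOverι V F G l := by
  have h := coend.condition (((externalProductBifunctorCurried LambdaCatᵒᵖ LambdaCat V).obj F).obj G) f
  have h1 : ((((externalProductBifunctorCurried LambdaCatᵒᵖ LambdaCat V).obj F).obj G).map f.op).app k =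
      F.map f.op ▷ G.obj k := by simp [externalProductBifunctorCurried]
  have h2 : ((((externalProductBifunctorCurried LambdaCatᵒᵖ LambdaCat V).obj F).obj G).obj (op l)).map f =
      F.obj (op l) ◁ G.map f := by simp [externalProductBifunctorCurried]
  exact (congrArg (· ≫ tensorOverι V F G k) h1).symm.trans
    (h.trans (congrArg (· ≫ tensorOverι V F G l) h2))

lemma tensorOver_hom_ext {F : LambdaCatᵒᵖ ⥤ V} {G : LambdaCat ⥤ V} {Z : V}
    {f g : ((tensorOver V).obj F).obj G ⟶ Z}
    (h : ∀ k, tensorOverι V F G k ≫ f = tensorOverι V F G k ≫ g) : f = g :=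
  coend.hom_ext h

lemma exists_tensorOver_desc {F : LambdaCatᵒᵖ ⥤ V} {G : LambdaCat ⥤ V} {Z : V}
    (h : ∀ k, F.obj (op k) ⊗ G.obj k ⟶ Z)
    (w : ∀ {k l : LambdaCat} (f : k ⟶ l), F.map f.op ▷ G.obj k ≫ h k = F.obj (op l) ◁ G.map f ≫ h l) :
    ∃ d : ((tensorOver V).obj F).obj G ⟶ Z, ∀ k, tensorOverι V F G k ≫ d = h k :=
  ⟨coend.desc h (fun k l f => by simpa [externalProductBifunctorCurried] using w f),
    fun k => coend.ι_desc _ _ k⟩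

lemma phiι_condition (X : DayLambda V) (G : LambdaCat ⥤ DayLambda V) {k l : LambdaCat} (f : k ⟶ l) :
    actMap (X.functor.map f.op) (𝟙 (G.obj k)) ≫ phiι X G k =
      actMap (𝟙 (X.functor.obj (op l))) (G.map f) ≫ phiι X G l :=
  day_ext fun n => by
    have := tensorOverι_condition X.functor
        ((G ⋙ (DayFunctor.equiv LambdaCatᵒᵖ V).functor).flip.obj (op n)) f
    rw [day_comp_app, day_comp_app, actMap_app, actMap_app, id_tensorHom, day_id_app, tensorHom_id]
    exact this

lemma phi_hom_ext' {X : DayLambda V} {G : LambdaCat ⥤ DayLambda V} {Z : DayLambda V}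
    {f g : phi X G ⟶ Z} (h : ∀ k, phiι X G k ≫ f = phiι X G k ≫ g) : f = g :=
  day_ext fun n => tensorOver_hom_ext fun k =>
    congrArg (fun t : act (X.functor.obj (op k)) (G.obj k) ⟶ Z => t.natTrans.app (op n)) (h k)

lemma exists_phi_desc' {X : DayLambda V} {G : LambdaCat ⥤ DayLambda V} {Z : DayLambda V}
    (h : ∀ k, act (X.functor.obj (op k)) (G.obj k) ⟶ Z)
    (w : ∀ {k l : LambdaCat} (f : k ⟶ l), actMap (X.functor.map f.op) (𝟙 (G.obj k)) ≫ h k =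
      actMap (𝟙 (X.functor.obj (op l))) (G.map f) ≫ h l) :
    ∃ d : phi X G ⟶ Z, ∀ k, phiι X G k ≫ d = h k := by
  have H (n : LambdaCatᵒᵖ) := exists_tensorOver_desc (F := X.functor)
    (G := (G ⋙ (DayFunctor.equiv LambdaCatᵒᵖ V).functor).flip.obj n) (Z := Z.functor.obj n)
    (fun k => (h k).natTrans.app n) (fun {k l} f => by
      have := congrArg (fun t => t.natTrans.app n) (w f)
      simp only [day_comp_app, actMap_app, id_tensorHom, day_id_app, tensorHom_id] at this
      exact this)
  choose d hd using H
  refine ⟨⟨{ app := d, naturality := fun m n f => tensorOver_hom_ext fun k => ?_ }⟩,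
    fun k => day_ext fun n => hd (op n) k⟩
  have h1 : tensorOverι V X.functor ((G ⋙ (DayFunctor.equiv LambdaCatᵒᵖ V).functor).flip.obj m) k ≫
      (phi X G).functor.map f = X.functor.obj (op k) ◁ (G.obj k).functor.map f ≫
        tensorOverι V X.functor ((G ⋙ (DayFunctor.equiv LambdaCatᵒᵖ V).functor).flip.obj n) k :=
    tensorOverι_map V X.functor ((G ⋙ (DayFunctor.equiv LambdaCatᵒᵖ V).functor).flip.map f) k
  have h2 : X.functor.obj (op k) ◁ (G.obj k).functor.map f ≫ (h k).natTrans.app n =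
      (h k).natTrans.app m ≫ Z.functor.map f := (h k).natTrans.naturality f
  refine (Category.assoc _ _ _).symm.trans ((congrArg (· ≫ d n) h1).trans ?_)
  refine (Category.assoc _ _ _).trans ((congrArg (fun t =>
    X.functor.obj (op k) ◁ (G.obj k).functor.map f ≫ t) (hd n k)).trans ?_)
  exact h2.trans ((congrArg (· ≫ Z.functor.map f) (hd m k)).symm.trans (Category.assoc _ _ _))

/-- The bifunctor `(k, l) ↦ X(k) · G(l)`. -/
def actBifunctor (X : DayLambda V) (G : LambdaCat ⥤ DayLambda V) :
    LambdaCatᵒᵖ ⥤ LambdaCat ⥤ DayLambda V where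
  obj k :=
    { obj := fun l => act (X.functor.obj k) (G.obj l)
      map := fun f => actMap (𝟙 _) (G.map f)
      map_id := fun l => by rw [CategoryTheory.Functor.map_id, actMap_id]
      map_comp := fun f g => by rw [actMap_comp, Functor.map_comp, Category.comp_id] }
  map f :=
    { app := fun l => actMap (X.functor.map f) (𝟙 _)
      naturality := fun l l' g => by
        simp only [actMap_comp, Category.id_comp, Category.comp_id] }
  map_id k := NatTrans.ext (funext fun l => by
    change actMap (X.functor.map (𝟙 k)) (𝟙 (G.obj l)) = 𝟙 _
    rw [CategoryTheory.Functor.map_id, actMap_id])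
  map_comp f g := NatTrans.ext (funext fun l => by
    change actMap (X.functor.map (f ≫ g)) (𝟙 (G.obj l)) = actMap _ _ ≫ actMap _ _
    rw [actMap_comp, Functor.map_comp, Category.comp_id])

/-- The universal cowedge. -/
def phiCowedge (X : DayLambda V) (G : LambdaCat ⥤ DayLambda V) : Cowedge (actBifunctor X G) :=
  Cowedge.mk (phi X G) (phiι X G) (fun _ _ f => phiι_condition X G f)

/-- `phi` is the coend in Day functors. -/
def isColimitPhiCowedge (X : DayLambda V) (G : LambdaCat ⥤ DayLambda V) :
    IsColimit (phiCowedge X G) :=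
  Multicofork.IsColimit.mk _
    (fun E => (exists_phi_desc' (fun k => E.π k) (fun f => E.condition (Arrow.mk f))).choose)
    (fun E k => (exists_phi_desc' (fun k => E.π k) (fun f => E.condition (Arrow.mk f))).choose_spec k)
    (fun E m hm => phi_hom_ext' fun k => (hm k).trans
      ((exists_phi_desc' (fun k => E.π k) (fun f => E.condition (Arrow.mk f))).choose_spec k).symm)

section
variable {C : Type*} [Category C] (T : DayLambda V ⥤ C) [PreservesColimitsOfSize.{0, 0} T]
  {X : DayLambda V} {G : LambdaCat ⥤ DayLambda V} {Z : C}

/-- `T` preserves the coend. The legs at the left vertices of the multispan factor through those at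
the right vertices, so that only the components `phiι` remain to be compared. -/
lemma phi_hom_ext {f g : T.obj (phi X G) ⟶ Z}
    (h : ∀ k, T.map (phiι X G k) ≫ f = T.map (phiι X G k) ≫ g) : f = g := by
  refine (isColimitOfPreserves T (isColimitPhiCowedge X G)).hom_ext fun j => ?_
  have hr (k : LambdaCat) : (T.mapCocone (phiCowedge X G)).ι.app (.right k) ≫ f =
    (T.mapCocone (phiCowedge X G)).ι.app (.right k) ≫ g := h k
  match j with
  | .right k => exact hr k
  | .left a =>
    have e := (T.mapCocone (phiCowedge X G)).w (WalkingMultispan.Hom.fst a)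
    refine Eq.trans (congrArg (· ≫ f) e.symm) (Eq.trans ?_ (congrArg (· ≫ g) e))
    exact (Category.assoc _ _ _).trans
      ((congrArg (T.map ((actBifunctor X G).map a.hom.op |>.app _) ≫ ·) (hr _)).trans
        (Category.assoc _ _ _).symm)

lemma exists_phi_desc
    (h : ∀ k, T.obj (act (X.functor.obj (op k)) (G.obj k)) ⟶ Z)
    (w : ∀ {k l : LambdaCat} (f : k ⟶ l), T.map (actMap (X.functor.map f.op) (𝟙 (G.obj k))) ≫ h k =
      T.map (actMap (𝟙 (X.functor.obj (op l))) (G.map f)) ≫ h l) :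
    ∃ d : T.obj (phi X G) ⟶ Z, ∀ k, T.map (phiι X G k) ≫ d = h k := by
  let I := multispanIndexCoend (actBifunctor X G)
  let s : Cocone (I.multispan ⋙ T) :=
    { pt := Z
      ι :=
        { app := fun j => match j with
            | .right k => h k
            | .left a => T.map (I.fst a) ≫ h _
          naturality := fun i j f => by
            refine Eq.trans ?_ (Category.comp_id _).symm
            match i, j, f with
            | _, _, .id _ => exact (congrArg (· ≫ _) (T.map_id _)).trans (Category.id_comp _)
            | _, _, .fst a => rfl
            | _, _, .snd a => exact (w a.hom).symm } }
  exact ⟨(isColimitOfPreserves T (isColimitPhiCowedge X G)).desc s,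
    fun k => (isColimitOfPreserves T (isColimitPhiCowedge X G)).fac s (.right k)⟩

end

/-- Functoriality of the coend in the first variable. -/
def phiMap {X Y : DayLambda V} (f : X ⟶ Y) (G : LambdaCat ⥤ DayLambda V) : phi X G ⟶ phi Y G :=
  ⟨Functor.whiskerLeft _ ((tensorOver V).map f.natTrans)⟩

/-- Functoriality of the coend in the second variable. -/
def phiMapRight (X : DayLambda V) {G H : LambdaCat ⥤ DayLambda V} (g : G ⟶ H) : phi X G ⟶ phi X H :=
  ⟨Functor.whiskerRight ((flipFunctor _ _ _).map
    (Functor.whiskerRight g (DayFunctor.equiv LambdaCatᵒᵖ V).functor))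
    ((tensorOver V).obj X.functor)⟩

lemma phiι_map {X Y : DayLambda V} (f : X ⟶ Y) (G : LambdaCat ⥤ DayLambda V) (k : LambdaCat) :
    phiι X G k ≫ phiMap f G = actMap (f.natTrans.app (op k)) (𝟙 _) ≫ phiι Y G k :=
  day_ext fun n => by
    rw [day_comp_app, day_comp_app, actMap_app, day_id_app, tensorHom_id]
    exact tensorOverι_app V f.natTrans
      ((G ⋙ (DayFunctor.equiv LambdaCatᵒᵖ V).functor).flip.obj (op n)) k

lemma phiι_mapRight (X : DayLambda V) {G H : LambdaCat ⥤ DayLambda V} (g : G ⟶ H) (k : LambdaCat) :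
    phiι X G k ≫ phiMapRight X g = actMap (𝟙 _) (g.app k) ≫ phiι X H k :=
  day_ext fun n => by
    rw [day_comp_app, day_comp_app, actMap_app, id_tensorHom]
    exact tensorOverι_map V X.functor (((flipFunctor _ _ _).map
      (Functor.whiskerRight g (DayFunctor.equiv LambdaCatᵒᵖ V).functor)).app (op n)) k

/-- The coend as a functor of the first variable. -/
@[simps]
def phiFunctor (G : LambdaCat ⥤ DayLambda V) : DayLambda V ⥤ DayLambda V where
  obj X := phi X G
  map f := phiMap f G
  map_id X := phi_hom_ext' fun k => by
    rw [phiι_map, day_id_app, actMap_id, Category.id_comp, Category.comp_id]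
  map_comp f g := phi_hom_ext' fun k => by
    rw [phiι_map, reassoc_of% phiι_map, phiι_map, ← Category.assoc, actMap_comp, Category.comp_id,
      day_comp_app]

/-- The coend is natural in the second variable. -/
@[simps]
def phiNat {G H : LambdaCat ⥤ DayLambda V} (g : G ⟶ H) : phiFunctor G ⟶ phiFunctor H where
  app X := phiMapRight X g
  naturality X Y f := phi_hom_ext' (Z := phi Y H) fun k => by
    change phiι X G k ≫ phiMap f G ≫ phiMapRight Y g = phiι X G k ≫ phiMapRight X g ≫ phiMap f H
    rw [reassoc_of% phiι_map, phiι_mapRight, reassoc_of% phiι_mapRight, phiι_map, ← Category.assoc,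
      ← Category.assoc, actMap_comp, actMap_comp, Category.id_comp, Category.comp_id,
      Category.id_comp, Category.comp_id]

/-- Colimits commute with coends: each `X(k) · G(k)` preserves colimits in `X`, so a map out of the
coend at a colimit is assembled first over the diagram and then over `k`. -/
instance preservesColimits_phiFunctor (G : LambdaCat ⥤ DayLambda V) :
    PreservesColimitsOfSize.{0, 0} (phiFunctor G) where
  preservesColimitsOfShape {J} _ := ⟨fun {K} => ⟨fun {c} hc => by
    -- Two indices are needed because the cowedge condition for `k ⟶ l` is an equation between maps
    -- out of `X(l) · G(k)`.
    have hT (k l : LambdaCat) := isColimitOfPreserves (levelFunctor k ⋙ actR (G.obj l)) hc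
    let cι (j : J) : K.obj j ⟶ c.pt := c.ι.app j
    have key (s : Cocone (K ⋙ phiFunctor G)) : ∃ d : phi c.pt G ⟶ s.pt,
        ∀ j, phiMap (cι j) G ≫ d = s.ι.app j := by
      let sι (j : J) : phi (K.obj j) G ⟶ s.pt := s.ι.app j
      have hs {i j : J} (f : i ⟶ j) : phiMap (K.map f) G ≫ sι j = sι i := s.w f
      have H (k : LambdaCat) : ∃ d : act (c.pt.functor.obj (op k)) (G.obj k) ⟶ s.pt, ∀ j,
          actMap ((cι j).natTrans.app (op k)) (𝟙 (G.obj k)) ≫ d = phiι (K.obj j) G k ≫ sι j :=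
        ⟨(hT k k).desc ⟨s.pt, { app := fun j => phiι (K.obj j) G k ≫ sι j
                                naturality := fun i j f => by
                                  refine Eq.trans ?_ (Category.comp_id _).symm
                                  have h2 := phiι_map (K.map f) G k
                                  change actMap ((K.map f).natTrans.app (op k)) (𝟙 (G.obj k)) ≫
                                    phiι (K.obj j) G k ≫ sι j = phiι (K.obj i) G k ≫ sι i
                                  rw [← reassoc_of% h2, hs] }⟩,
          fun j => (hT k k).fac _ j⟩
      choose d hd using H
      obtain ⟨e, he⟩ := exists_phi_desc' (X := c.pt) (G := G) d (fun {k l} f =>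
        (hT l k).hom_ext fun j => by
          have h1 : actMap ((cι j).natTrans.app (op l)) (𝟙 (G.obj k)) ≫
              actMap (c.pt.functor.map f.op) (𝟙 (G.obj k)) ≫ d k =
              actMap ((cι j).natTrans.app (op l)) (𝟙 (G.obj k)) ≫
                actMap (𝟙 (c.pt.functor.obj (op l))) (G.map f) ≫ d l := by
            rw [← Category.assoc, ← Category.assoc, actMap_comp, actMap_comp,
              ← day_hom_naturality (cι j), Category.id_comp, Category.id_comp, Category.comp_id,
              ← Category.comp_id (𝟙 (G.obj k)), ← actMap_comp, Category.assoc, hd,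
              ← Category.id_comp ((cι j).natTrans.app (op l)), ← Category.comp_id (G.map f),
              ← actMap_comp, Category.assoc, hd, ← Category.assoc, phiι_condition, Category.assoc]
          exact h1)
      refine ⟨e, fun j => phi_hom_ext' fun k => ?_⟩
      have h2 := phiι_map (cι j) G k
      rw [reassoc_of% h2, he, hd]
    exact ⟨{ desc := fun s => (key s).choose
             fac := fun s j => (key s).choose_spec j
             uniq := fun s (m : phi c.pt G ⟶ s.pt) hm => phi_hom_ext' fun k => (hT k k).hom_ext fun j => by
              have h3 : phiMap (cι j) G ≫ m = phiMap (cι j) G ≫ (key s).choose :=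
                (hm j).trans ((key s).choose_spec j).symm
              have h4 := phiι_map (cι j) G k
              change actMap ((cι j).natTrans.app (op k)) (𝟙 (G.obj k)) ≫ phiι c.pt G k ≫ m =
                actMap ((cι j).natTrans.app (op k)) (𝟙 (G.obj k)) ≫ phiι c.pt G k ≫ (key s).choose
              rw [← reassoc_of% h4, ← reassoc_of% h4]
              exact congrArg (fun t => phiι (K.obj j) G k ≫ t) h3 }⟩⟩⟩

/-- The components of `∫^n (A ⊠ B)(n) · G(n)` with respect to the Day convolution `A ⊠ B`. -/
def phiι₂ (A B : DayLambda V) (G : LambdaCat ⥤ DayLambda V) (k l : LambdaCat) :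
    act (A.functor.obj (op k) ⊗ B.functor.obj (op l)) (G.obj (k ⊗ l)) ⟶ phi (A ⊗ B) G :=
  actMap (dayη A B k l) (𝟙 _) ≫ phiι (A ⊗ B) G (k ⊗ l)

lemma actMap_phiι₂ (A B : DayLambda V) (G : LambdaCat ⥤ DayLambda V) {k l m : LambdaCat}
    (u : m ⟶ k ⊗ l) : actMap (dayη A B k l ≫ (A ⊗ B).functor.map u.op) (𝟙 (G.obj m)) ≫
      phiι (A ⊗ B) G m = actMap (𝟙 _) (G.map u) ≫ phiι₂ A B G k l := by
  have h := phiι_condition (A ⊗ B) G u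
  rw [phiι₂, ← Category.comp_id (𝟙 (G.obj m)), ← actMap_comp, Category.assoc, h, ← Category.assoc,
    ← Category.assoc, actMap_comp, actMap_comp, Category.comp_id, Category.id_comp,
    Category.id_comp, Category.comp_id]

section
variable {C : Type*} [Category C] (T : DayLambda V ⥤ C) [PreservesColimitsOfSize.{0, 0} T]
  {A B : DayLambda V} {G : LambdaCat ⥤ DayLambda V} {Z : C}

/-- Inserting the colimit formula for `(A ⊠ B)(m)` into `∫^m (A ⊠ B)(m) · G(m)` eliminates `m` and
leaves `∫^{k,l} (A(k) ⊗ B(l)) · G(k ∨ l)`; the relation `actMap_phiι₂` moves a map `m ⟶ k ∨ l` from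
the first variable to `G`. -/
lemma phi_tensor_hom_ext {f g : T.obj (phi (A ⊗ B) G) ⟶ Z}
    (h : ∀ k l, T.map (phiι₂ A B G k l) ≫ f = T.map (phiι₂ A B G k l) ≫ g) : f = g := by
  refine phi_hom_ext T fun m => tensorLevel_hom_ext (actR (G.obj m) ⋙ T) A B m fun k l u => ?_
  have key (f : T.obj (phi (A ⊗ B) G) ⟶ Z) : T.map (actMap (dayη A B k l ≫
      (A ⊗ B).functor.map u.op) (𝟙 (G.obj m))) ≫ T.map (phiι (A ⊗ B) G m) ≫ f =
      T.map (actMap (𝟙 _) (G.map u)) ≫ T.map (phiι₂ A B G k l) ≫ f := by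
    rw [← Functor.map_comp_assoc, actMap_phiι₂, Functor.map_comp_assoc]
  exact (key f).trans ((congrArg (fun t => T.map (actMap (𝟙 _) (G.map u)) ≫ t) (h k l)).trans
    (key g).symm)

lemma exists_phi_tensor_desc
    (h : ∀ k l, T.obj (act (A.functor.obj (op k) ⊗ B.functor.obj (op l)) (G.obj (k ⊗ l))) ⟶ Z)
    (w : ∀ {k k' l l' : LambdaCat} (f : k ⟶ k') (g : l ⟶ l'),
      T.map (actMap (A.functor.map f.op ⊗ₘ B.functor.map g.op) (𝟙 (G.obj (k ⊗ l)))) ≫ h k l =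
      T.map (actMap (𝟙 _) (G.map (f ⊗ₘ g))) ≫ h k' l') :
    ∃ d : T.obj (phi (A ⊗ B) G) ⟶ Z, ∀ k l, T.map (phiι₂ A B G k l) ≫ d = h k l := by
  -- On the term of `u : m ⟶ k ∨ l` the map is forced to be `G(u)` followed by `h k l`.
  have H (m : LambdaCat) : ∃ d : T.obj (act ((A ⊗ B).functor.obj (op m)) (G.obj m)) ⟶ Z,
      ∀ k l (u : m ⟶ k ⊗ l), T.map (actMap (dayη A B k l ≫ (A ⊗ B).functor.map u.op) (𝟙 (G.obj m))) ≫
        d = T.map (actMap (𝟙 _) (G.map u)) ≫ h k l :=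
    exists_tensorLevel_desc (actR (G.obj m) ⋙ T) A B m
      (fun k l u => T.map (actMap (𝟙 _) (G.map u)) ≫ h k l) (fun {k k' l l'} f g u => by
        change T.map (actMap (A.functor.map f.op ⊗ₘ B.functor.map g.op) (𝟙 (G.obj m))) ≫
          T.map (actMap (𝟙 _) (G.map u)) ≫ h k l = T.map (actMap (𝟙 _) (G.map (u ≫ (f ⊗ₘ g)))) ≫ h k' l'
        have h1 := w f g
        rw [← Functor.map_comp_assoc, actMap_comp, Category.id_comp, Category.comp_id]
        rw [Functor.map_comp, ← Category.comp_id (𝟙 (A.functor.obj (op k') ⊗ B.functor.obj (op l'))),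
          ← actMap_comp, Functor.map_comp_assoc, ← h1, ← Functor.map_comp_assoc, actMap_comp,
          Category.id_comp, Category.comp_id])
  choose d hd using H
  obtain ⟨e, he⟩ := exists_phi_desc T (X := A ⊗ B) (G := G) d (fun {m n} f =>
    tensorLevel_hom_ext (actR (G.obj m) ⋙ T) A B n fun k l u => by
      change T.map (actMap (dayη A B k l ≫ (A ⊗ B).functor.map u.op) (𝟙 (G.obj m))) ≫
        T.map (actMap ((A ⊗ B).functor.map f.op) (𝟙 (G.obj m))) ≫ d m =
        T.map (actMap (dayη A B k l ≫ (A ⊗ B).functor.map u.op) (𝟙 (G.obj m))) ≫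
        T.map (actMap (𝟙 _) (G.map f)) ≫ d n
      rw [← Functor.map_comp_assoc, ← Functor.map_comp_assoc, actMap_comp, actMap_comp,
        Category.id_comp, Category.comp_id, Category.id_comp, Category.assoc, ← Functor.map_comp,
        ← op_comp, hd, ← Category.id_comp (dayη A B k l ≫ (A ⊗ B).functor.map u.op),
        ← Category.comp_id (G.map f), ← actMap_comp, Functor.map_comp_assoc, hd,
        ← Functor.map_comp_assoc, actMap_comp, Category.id_comp, Functor.map_comp])
  refine ⟨e, fun k l => ?_⟩
  have h1 := hd (k ⊗ l) k l (𝟙 _)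
  rw [op_id, CategoryTheory.Functor.map_id, CategoryTheory.Functor.map_id, actMap_id,
    CategoryTheory.Functor.map_id, Category.id_comp, Category.comp_id] at h1
  rw [phiι₂, Functor.map_comp_assoc, he, h1]

end

/-- The component of `∫^n (𝟙_)(n) · G(n)`. -/
def phiι₀ (G : LambdaCat ⥤ DayLambda V) : act (𝟙_ V) (G.obj (𝟙_ _)) ⟶ phi (𝟙_ (DayLambda V)) G :=
  actMap (dayν V) (𝟙 _) ≫ phiι _ G (𝟙_ _)

lemma actMap_phiι₀ (G : LambdaCat ⥤ DayLambda V) {m : LambdaCat} (u : m ⟶ 𝟙_ _) :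
    actMap (dayν V ≫ (𝟙_ (DayLambda V)).functor.map u.op) (𝟙 (G.obj m)) ≫ phiι _ G m =
      actMap (𝟙 _) (G.map u) ≫ phiι₀ G := by
  have h := phiι_condition (𝟙_ (DayLambda V)) G u
  rw [phiι₀, ← Category.comp_id (𝟙 (G.obj m)), ← actMap_comp, Category.assoc, h, ← Category.assoc,
    ← Category.assoc, actMap_comp, actMap_comp, Category.comp_id, Category.id_comp,
    Category.id_comp, Category.comp_id]

/-- The same elimination for `I₀`, which reduces `∫^m I₀(m) · G(m)` to `I · G(0)`. -/
lemma phi_unit_hom_ext {G : LambdaCat ⥤ DayLambda V} {Z : DayLambda V}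
    {f g : phi (𝟙_ (DayLambda V)) G ⟶ Z} (h : phiι₀ G ≫ f = phiι₀ G ≫ g) : f = g := by
  refine phi_hom_ext' fun m => unitLevel_hom_ext (actR (G.obj m)) m fun u => ?_
  have key (f : phi (𝟙_ (DayLambda V)) G ⟶ Z) : actMap (dayν V ≫
      (𝟙_ (DayLambda V)).functor.map u.op) (𝟙 (G.obj m)) ≫ phiι _ G m ≫ f =
      actMap (𝟙 _) (G.map u) ≫ phiι₀ G ≫ f := by
    rw [← Category.assoc, actMap_phiι₀, Category.assoc]
  exact (key f).trans ((congrArg (fun t => actMap (𝟙 _) (G.map u) ≫ t) h).trans (key g).symm)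

lemma exists_phi_unit_desc {G : LambdaCat ⥤ DayLambda V} {Z : DayLambda V}
    (h : act (𝟙_ V) (G.obj (𝟙_ _)) ⟶ Z) :
    ∃ d : phi (𝟙_ (DayLambda V)) G ⟶ Z, phiι₀ G ≫ d = h := by
  have H (m : LambdaCat) : ∃ d : act ((𝟙_ (DayLambda V)).functor.obj (op m)) (G.obj m) ⟶ Z,
      ∀ u : m ⟶ 𝟙_ _, actMap (dayν V ≫ (𝟙_ (DayLambda V)).functor.map u.op) (𝟙 (G.obj m)) ≫
        d = actMap (𝟙 _) (G.map u) ≫ h :=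
    exists_unitLevel_desc (actR (G.obj m)) m (fun u => actMap (𝟙 _) (G.map u) ≫ h)
  choose d hd using H
  obtain ⟨e, he⟩ := exists_phi_desc' (X := 𝟙_ (DayLambda V)) (G := G) d (fun {m n} f =>
    unitLevel_hom_ext (actR (G.obj m)) n fun u => by
      change actMap (dayν V ≫ (𝟙_ (DayLambda V)).functor.map u.op) (𝟙 (G.obj m)) ≫
        actMap ((𝟙_ (DayLambda V)).functor.map f.op) (𝟙 (G.obj m)) ≫ d m =
        actMap (dayν V ≫ (𝟙_ (DayLambda V)).functor.map u.op) (𝟙 (G.obj m)) ≫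
        actMap (𝟙 _) (G.map f) ≫ d n
      rw [← Category.assoc, ← Category.assoc, actMap_comp, actMap_comp,
        Category.id_comp, Category.comp_id, Category.id_comp, Category.assoc, ← Functor.map_comp,
        ← op_comp, hd, ← Category.id_comp (dayν V ≫ (𝟙_ (DayLambda V)).functor.map u.op),
        ← Category.comp_id (G.map f), ← actMap_comp, Category.assoc, hd,
        ← Category.assoc, actMap_comp, Category.id_comp, Functor.map_comp])
  refine ⟨e, ?_⟩
  have h1 := hd (𝟙_ _) (𝟙 _)
  rw [op_id, CategoryTheory.Functor.map_id, CategoryTheory.Functor.map_id, actMap_id,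
    Category.id_comp, Category.comp_id] at h1
  rw [phiι₀, Category.assoc, he, h1]

lemma exists_phiAct (x : V) (X : DayLambda V) (G : LambdaCat ⥤ DayLambda V) :
    ∃ d : phi (act x X) G ⟶ act x (phi X G), ∀ k,
      phiι (act x X) G k ≫ d = actAssoc x _ _ ≫ actMap (𝟙 x) (phiι X G k) :=
  exists_phi_desc' (X := act x X) (fun k => actAssoc x _ _ ≫ actMap (𝟙 x) (phiι X G k))
    (fun {k l} f => by
      have h1 := actAssoc_natural (𝟙 x) (X.functor.map f.op) (𝟙 (G.obj k))
      have h2 := actAssoc_natural (𝟙 x) (𝟙 (X.functor.obj (op l))) (G.map f)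
      have h3 := phiι_condition X G f
      rw [id_tensorHom] at h1
      rw [id_tensorHom_id] at h2
      change actMap (x ◁ X.functor.map f.op) (𝟙 (G.obj k)) ≫ _ = actMap (𝟙 _) (G.map f) ≫ _
      rw [reassoc_of% h1, reassoc_of% h2, actMap_comp, actMap_comp, h3])

/-- The coend commutes with the action of `V`. -/
def phiAct (x : V) (X : DayLambda V) (G : LambdaCat ⥤ DayLambda V) :
    phi (act x X) G ⟶ act x (phi X G) := (exists_phiAct x X G).choose

lemma phiι_act (x : V) (X : DayLambda V) (G : LambdaCat ⥤ DayLambda V) (k : LambdaCat) :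
    phiι (act x X) G k ≫ phiAct x X G = actAssoc x _ _ ≫ actMap (𝟙 x) (phiι X G k) :=
  (exists_phiAct x X G).choose_spec k

/-- As `x · -` preserves the coend, the inverse of `phiAct` can be given on components too. -/
lemma exists_phiAct_inv (x : V) (X : DayLambda V) (G : LambdaCat ⥤ DayLambda V) :
    ∃ d : act x (phi X G) ⟶ phi (act x X) G, ∀ k,
      actMap (𝟙 x) (phiι X G k) ≫ d = inv (actAssoc x _ _) ≫ phiι (act x X) G k := by
  let h (k : LambdaCat) : act x (act (X.functor.obj (op k)) (G.obj k)) ⟶ phi (act x X) G :=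
    inv (actAssoc x _ _) ≫ phiι (act x X) G k
  exact exists_phi_desc (actL x) (X := X) (G := G) h (fun {k l} f => by
      have h1 := actAssoc_natural (𝟙 x) (X.functor.map f.op) (𝟙 (G.obj k))
      have h2 := actAssoc_natural (𝟙 x) (𝟙 (X.functor.obj (op l))) (G.map f)
      have h3 := phiι_condition (act x X) G f
      rw [id_tensorHom] at h1
      rw [id_tensorHom_id] at h2
      change actMap (𝟙 x) (actMap (X.functor.map f.op) (𝟙 (G.obj k))) ≫
        inv (actAssoc x (X.functor.obj (op k)) (G.obj k)) ≫ phiι (act x X) G k =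
        actMap (𝟙 x) (actMap (𝟙 _) (G.map f)) ≫
        inv (actAssoc x (X.functor.obj (op l)) (G.obj l)) ≫ phiι (act x X) G l
      rw [← IsIso.inv_comp_eq] at h1 h2
      rw [← h1, ← h2]
      simp only [Category.assoc, IsIso.hom_inv_id_assoc]
      exact congrArg (fun t => inv (actAssoc x (X.functor.obj (op l)) (G.obj k)) ≫ t) h3)

instance isIso_phiAct (x : V) (X : DayLambda V) (G : LambdaCat ⥤ DayLambda V) : IsIso (phiAct x X G) := by
  obtain ⟨d, hd⟩ := exists_phiAct_inv x X G
  refine ⟨d, phi_hom_ext' fun k => ?_, phi_hom_ext (actL x) fun k => ?_⟩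
  · rw [reassoc_of% phiι_act, hd, IsIso.hom_inv_id_assoc, Category.comp_id]
  · change actMap (𝟙 x) (phiι X G k) ≫ d ≫ phiAct x X G = actMap (𝟙 x) (phiι X G k) ≫ 𝟙 _
    rw [reassoc_of% (hd k), phiι_act, IsIso.inv_hom_id_assoc, Category.comp_id]

end Phi

/-! ### The coend against a braided monoidal functor is a braided monoidal functor. -/

noncomputable section PhiMonoidal
open MonoidalCategory.DayFunctor Functor.LaxMonoidal

variable {V : Type u} [Category.{v} V] [MonoidalCategory V] [SymmetricCategory V] [HasColimits V]
  [∀ X : V, PreservesColimits (tensorLeft X)]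

/-- A component of the coend, precomposed with morphisms in both variables. -/
def phiEl (X : DayLambda V) (G : LambdaCat ⥤ DayLambda V) (k : LambdaCat) {x : V} {P : DayLambda V}
    (p : x ⟶ X.functor.obj (op k)) (q : P ⟶ G.obj k) : act x P ⟶ phi X G :=
  actMap p q ≫ phiι X G k

section
variable (X : DayLambda V) (G : LambdaCat ⥤ DayLambda V) (k : LambdaCat) {x : V} {P : DayLambda V}
    (p : x ⟶ X.functor.obj (op k)) (q : P ⟶ G.obj k)

lemma phiEl_id : phiEl X G k (𝟙 _) (𝟙 _) = phiι X G k := by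
  rw [phiEl, actMap_id, Category.id_comp]

lemma actMap_phiEl {y : V} {Q : DayLambda V} (f : y ⟶ x) (g : Q ⟶ P) :
    actMap f g ≫ phiEl X G k p q = phiEl X G k (f ≫ p) (g ≫ q) := by
  rw [phiEl, phiEl, ← Category.assoc, actMap_comp]

/-- The coend relation for generalized components. It passes coherence maps of `Λ` from the first
variable, where the universal maps of Day convolution produce them, to `G`, where the monoidal
structure of `G` absorbs them. -/
lemma phiEl_map_eq {k l : LambdaCat} (f : k ⟶ l) (p : x ⟶ X.functor.obj (op l)) (q : P ⟶ G.obj k) :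
    phiEl X G k (p ≫ X.functor.map f.op) q = phiEl X G l p (q ≫ G.map f) := by
  have h := phiι_condition X G f
  rw [phiEl, phiEl, ← Category.comp_id q, ← actMap_comp, Category.assoc, h, ← Category.assoc,
    actMap_comp, Category.comp_id, Category.comp_id]

lemma phiEl_phiMap {Y : DayLambda V} (f : X ⟶ Y) :
    phiEl X G k p q ≫ phiMap f G = phiEl Y G k (p ≫ f.natTrans.app (op k)) q := by
  rw [phiEl, phiEl, Category.assoc, phiι_map, ← Category.assoc, actMap_comp, Category.comp_id]

lemma phiEl_phiMapRight {H : LambdaCat ⥤ DayLambda V} (g : G ⟶ H) :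
    phiEl X G k p q ≫ phiMapRight X g = phiEl X H k p (q ≫ g.app k) := by
  rw [phiEl, phiEl, Category.assoc, phiι_mapRight, ← Category.assoc, actMap_comp, Category.comp_id]

lemma phiEl_phiAct {y : V} (p : x ⟶ y ⊗ X.functor.obj (op k)) :
    phiEl (act y X) G k p q ≫ phiAct y X G =
      actMap p q ≫ actAssoc y _ _ ≫ actMap (𝟙 y) (phiι X G k) := by
  rw [phiEl, Category.assoc, phiι_act]

end

section
variable {A B C Z : DayLambda V} {G H K : LambdaCat ⥤ DayLambda V}

lemma phi_tensorPhi_hom_ext {f g : phi A G ⊗ phi B H ⟶ Z}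
    (h : ∀ k l, (phiι A G k ⊗ₘ phiι B H l) ≫ f = (phiι A G k ⊗ₘ phiι B H l) ≫ g) : f = g := by
  have key (f : phi A G ⊗ phi B H ⟶ Z) (k l) :
      act (A.functor.obj (op k)) (G.obj k) ◁ phiι B H l ≫ phiι A G k ▷ phi B H ≫ f =
      (phiι A G k ⊗ₘ phiι B H l) ≫ f := by
    rw [tensorHom_def'_assoc]
  have h1 (k) : phiι A G k ▷ phi B H ≫ f = phiι A G k ▷ phi B H ≫ g :=
    phi_hom_ext (tensorLeft (act (A.functor.obj (op k)) (G.obj k))) (X := B) (G := H)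
      (f := phiι A G k ▷ phi B H ≫ f) (g := phiι A G k ▷ phi B H ≫ g)
      fun l => (key f k l).trans ((h k l).trans (key g k l).symm)
  exact phi_hom_ext (tensorRight (phi B H)) (X := A) (G := G) (f := f) (g := g) h1

lemma phi_tensorPhi_hom_ext₃ {f g : (phi A G ⊗ phi B H) ⊗ phi C K ⟶ Z}
    (h : ∀ k l m, ((phiι A G k ⊗ₘ phiι B H l) ⊗ₘ phiι C K m) ≫ f =
      ((phiι A G k ⊗ₘ phiι B H l) ⊗ₘ phiι C K m) ≫ g) : f = g := by
  have h1 (m) : (phi A G ⊗ phi B H) ◁ phiι C K m ≫ f = (phi A G ⊗ phi B H) ◁ phiι C K m ≫ g := by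
    have key (f : (phi A G ⊗ phi B H) ⊗ phi C K ⟶ Z) (k l) :
        (act (A.functor.obj (op k)) (G.obj k) ◁ phiι B H l) ▷ _ ≫ (phiι A G k ▷ phi B H) ▷ _ ≫
          (phi A G ⊗ phi B H) ◁ phiι C K m ≫ f =
        ((phiι A G k ⊗ₘ phiι B H l) ⊗ₘ phiι C K m) ≫ f := by
      rw [MonoidalCategory.tensorHom_def, tensorHom_def', comp_whiskerRight]
      simp only [Category.assoc]
    have h2 (k) : (phiι A G k ▷ phi B H) ▷ _ ≫ (phi A G ⊗ phi B H) ◁ phiι C K m ≫ f =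
        (phiι A G k ▷ phi B H) ▷ _ ≫ (phi A G ⊗ phi B H) ◁ phiι C K m ≫ g :=
      phi_hom_ext (tensorLeft (act (A.functor.obj (op k)) (G.obj k)) ⋙
        tensorRight (act (C.functor.obj (op m)) (K.obj m))) (X := B) (G := H)
        (f := (phiι A G k ▷ phi B H) ▷ _ ≫ (phi A G ⊗ phi B H) ◁ phiι C K m ≫ f)
        (g := (phiι A G k ▷ phi B H) ▷ _ ≫ (phi A G ⊗ phi B H) ◁ phiι C K m ≫ g)
        fun l => (key f k l).trans ((h k l m).trans (key g k l).symm)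
    exact phi_hom_ext (tensorRight (phi B H) ⋙ tensorRight (act (C.functor.obj (op m)) (K.obj m)))
      (X := A) (G := G) (f := (phi A G ⊗ phi B H) ◁ phiι C K m ≫ f)
      (g := (phi A G ⊗ phi B H) ◁ phiι C K m ≫ g) h2
  exact phi_hom_ext (tensorLeft (phi A G ⊗ phi B H)) (X := C) (G := K) (f := f) (g := g) h1

/-- Day convolution preserves colimits in each variable, so a product of coends is a double coend;
the second variable is resolved first, for fixed `k`. -/
lemma exists_phi_tensorPhi_desc
    (h : ∀ k l, act (A.functor.obj (op k)) (G.obj k) ⊗ act (B.functor.obj (op l)) (H.obj l) ⟶ Z)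
    (w₁ : ∀ {k k' : LambdaCat} (f : k ⟶ k') l, (actMap (A.functor.map f.op) (𝟙 (G.obj k)) ▷ _) ≫ h k l =
      (actMap (𝟙 _) (G.map f)) ▷ _ ≫ h k' l)
    (w₂ : ∀ k {l l' : LambdaCat} (f : l ⟶ l'), (_ ◁ actMap (B.functor.map f.op) (𝟙 (H.obj l))) ≫ h k l =
      _ ◁ (actMap (𝟙 _) (H.map f)) ≫ h k l') :
    ∃ d : phi A G ⊗ phi B H ⟶ Z, ∀ k l, (phiι A G k ⊗ₘ phiι B H l) ≫ d = h k l := by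
  have H1 (k : LambdaCat) : ∃ d : act (A.functor.obj (op k)) (G.obj k) ⊗ phi B H ⟶ Z,
      ∀ l, _ ◁ phiι B H l ≫ d = h k l :=
    exists_phi_desc (tensorLeft (act (A.functor.obj (op k)) (G.obj k))) (X := B) (G := H) (Z := Z)
      (h k) (w₂ k)
  choose d hd using H1
  have H2 {k k' : LambdaCat} (f : k ⟶ k') : actMap (A.functor.map f.op) (𝟙 (G.obj k)) ▷ phi B H ≫ d k =
      actMap (𝟙 _) (G.map f) ▷ phi B H ≫ d k' :=
    phi_hom_ext (tensorLeft (act (A.functor.obj (op k')) (G.obj k))) (X := B) (G := H)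
      (f := actMap (A.functor.map f.op) (𝟙 (G.obj k)) ▷ phi B H ≫ d k)
      (g := actMap (𝟙 _) (G.map f) ▷ phi B H ≫ d k') fun l => by
        change _ ◁ phiι B H l ≫ actMap (A.functor.map f.op) (𝟙 (G.obj k)) ▷ phi B H ≫ d k =
          _ ◁ phiι B H l ≫ actMap (𝟙 _) (G.map f) ▷ phi B H ≫ d k'
        rw [whisker_exchange_assoc, whisker_exchange_assoc, hd, hd, w₁]
  obtain ⟨e, he⟩ : ∃ e : phi A G ⊗ phi B H ⟶ Z, ∀ k, phiι A G k ▷ _ ≫ e = d k :=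
    exists_phi_desc (tensorRight (phi B H)) (X := A) (G := G) (Z := Z) d H2
  refine ⟨e, fun k l => ?_⟩
  rw [tensorHom_def'_assoc, he, hd]

end

section
variable (G : LambdaCat ⥤ DayLambda V) [G.LaxMonoidal] (A B C : DayLambda V)

/-- On components, `(x · P) ⊠ (y · Q)` is interchanged to `(x ⊗ y) · (P ⊠ Q)`; then the universal
map of Day convolution is applied in the first variable and the structure map of `G` in the second.
Naturality of the three ingredients gives the conditions for both coends. -/
lemma exists_phiμ : ∃ d : phi A G ⊗ phi B G ⟶ phi (A ⊗ B) G, ∀ k l,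
    (phiι A G k ⊗ₘ phiι B G l) ≫ d =
      actτ _ _ _ _ ≫ phiEl (A ⊗ B) G (k ⊗ l) (dayη A B k l) (μ G k l) :=
  exists_phi_tensorPhi_desc
    (fun k l => actτ _ _ _ _ ≫ phiEl (A ⊗ B) G (k ⊗ l) (dayη A B k l) (μ G k l))
    (fun {k k'} f l => by
      have h1 := actτ_natural (A.functor.map f.op) (𝟙 (G.obj k)) (𝟙 (B.functor.obj (op l))) (𝟙 (G.obj l))
      have h2 := actτ_natural (𝟙 (A.functor.obj (op k'))) (G.map f) (𝟙 (B.functor.obj (op l))) (𝟙 (G.obj l))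
      have h3 := dayη_natural A B f (𝟙 l)
      have h4 := μ_natural_left G f l
      rw [actMap_id, tensorHom_id] at h1 h2
      rw [op_id, CategoryTheory.Functor.map_id] at h3
      rw [reassoc_of% h1, reassoc_of% h2, actMap_phiEl, actMap_phiEl, h3, phiEl_map_eq,
        id_tensorHom_id, id_tensorHom_id, Category.id_comp, Category.id_comp, tensorHom_id,
        tensorHom_id, h4])
    (fun k {l l'} f => by
      have h1 := actτ_natural (𝟙 (A.functor.obj (op k))) (𝟙 (G.obj k)) (B.functor.map f.op) (𝟙 (G.obj l))
      have h2 := actτ_natural (𝟙 (A.functor.obj (op k))) (𝟙 (G.obj k)) (𝟙 (B.functor.obj (op l'))) (G.map f)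
      have h3 := dayη_natural A B (𝟙 k) f
      have h4 := μ_natural_right G k f
      rw [actMap_id, id_tensorHom] at h1 h2
      rw [op_id, CategoryTheory.Functor.map_id] at h3
      rw [reassoc_of% h1, reassoc_of% h2, actMap_phiEl, actMap_phiEl, h3, phiEl_map_eq,
        id_tensorHom_id, id_tensorHom_id, Category.id_comp, Category.id_comp, id_tensorHom,
        id_tensorHom, h4])

/-- The tensor product of coends for a lax monoidal functor `G`. -/
def phiμ : phi A G ⊗ phi B G ⟶ phi (A ⊗ B) G := (exists_phiμ G A B).choose

lemma phiι_μ (k l : LambdaCat) : (phiι A G k ⊗ₘ phiι B G l) ≫ phiμ G A B =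
    actτ _ _ _ _ ≫ phiEl (A ⊗ B) G (k ⊗ l) (dayη A B k l) (μ G k l) :=
  (exists_phiμ G A B).choose_spec k l

lemma phiEl_μ (k l : LambdaCat) {x y : V} {P Q : DayLambda V}
    (p : x ⟶ A.functor.obj (op k)) (q : P ⟶ G.obj k)
    (p' : y ⟶ B.functor.obj (op l)) (q' : Q ⟶ G.obj l) :
    (phiEl A G k p q ⊗ₘ phiEl B G l p' q') ≫ phiμ G A B =
      actτ x y P Q ≫ phiEl (A ⊗ B) G (k ⊗ l) ((p ⊗ₘ p') ≫ dayη A B k l) ((q ⊗ₘ q') ≫ μ G k l) := by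
  rw [phiEl, phiEl, ← tensorHom_comp_tensorHom_assoc, phiι_μ, ← Category.assoc, actτ_natural,
    Category.assoc, actMap_phiEl]

lemma phiEl_μ_left (k l : LambdaCat) {x y : V} {P Q R : DayLambda V} (t : R ⟶ act x P)
    (p : x ⟶ A.functor.obj (op k)) (q : P ⟶ G.obj k)
    (p' : y ⟶ B.functor.obj (op l)) (q' : Q ⟶ G.obj l) :
    ((t ≫ phiEl A G k p q) ⊗ₘ phiEl B G l p' q') ≫ phiμ G A B = t ▷ act y Q ≫
      actτ x y P Q ≫ phiEl (A ⊗ B) G (k ⊗ l) ((p ⊗ₘ p') ≫ dayη A B k l) ((q ⊗ₘ q') ≫ μ G k l) := by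
  rw [← phiEl_μ, ← tensorHom_id, tensorHom_comp_tensorHom_assoc, Category.id_comp]

lemma phiEl_μ_right (k l : LambdaCat) {x y : V} {P Q R : DayLambda V} (t : R ⟶ act y Q)
    (p : x ⟶ A.functor.obj (op k)) (q : P ⟶ G.obj k)
    (p' : y ⟶ B.functor.obj (op l)) (q' : Q ⟶ G.obj l) :
    (phiEl A G k p q ⊗ₘ (t ≫ phiEl B G l p' q')) ≫ phiμ G A B = act x P ◁ t ≫
      actτ x y P Q ≫ phiEl (A ⊗ B) G (k ⊗ l) ((p ⊗ₘ p') ≫ dayη A B k l) ((q ⊗ₘ q') ≫ μ G k l) := by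
  rw [← phiEl_μ, ← id_tensorHom, tensorHom_comp_tensorHom_assoc, Category.id_comp]

/-- The unit for the tensor product of coends. -/
def phiε : 𝟙_ (DayLambda V) ⟶ phi (𝟙_ _) G :=
  actUnit _ ≫ phiEl (𝟙_ _) G (𝟙_ _) (dayν V) (ε G)

variable {A B} in
lemma phiμ_natural {A' B' : DayLambda V} (f : A ⟶ A') (g : B ⟶ B') :
    (phiMap f G ⊗ₘ phiMap g G) ≫ phiμ G A' B' = phiμ G A B ≫ phiMap (f ⊗ₘ g) G :=
  phi_tensorPhi_hom_ext fun k l => by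
    rw [tensorHom_comp_tensorHom_assoc, ← phiEl_id, ← phiEl_id, phiEl_phiMap, phiEl_phiMap, phiEl_μ,
      reassoc_of% phiEl_μ, phiEl_phiMap, id_tensorHom_id, id_tensorHom_id, Category.id_comp, Category.id_comp,
      Category.id_comp, Category.id_comp, dayη_tensorHom]

/-- The associators of the action, of Day convolution and of `G` enter once each (`actτ_assoc`,
`dayη_associator`, `associativity G`). The associator of `Λ` that the second leaves behind is handed
to the third by `phiEl_map_eq`. -/
lemma phiμ_assoc : phiμ G A B ▷ phi C G ≫ phiμ G (A ⊗ B) C ≫ phiMap (α_ A B C).hom G =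
    (α_ _ _ _).hom ≫ phi A G ◁ phiμ G B C ≫ phiμ G A (B ⊗ C) :=
  phi_tensorPhi_hom_ext₃ fun a b c => by
    have h1 := dayη_associator A B C a b c
    have h2 := associativity G a b c
    have h3 := actτ_assoc (A.functor.obj (op a)) (B.functor.obj (op b)) (C.functor.obj (op c))
      (G.obj a) (G.obj b) (G.obj c)
    have h4 := phiEl_map_eq (A ⊗ B ⊗ C) G (α_ a b c).hom
      ((α_ _ _ _).hom ≫ A.functor.obj (op a) ◁ dayη B C b c ≫ dayη A (B ⊗ C) a (b ⊗ c))
      (μ G a b ▷ G.obj c ≫ μ G (a ⊗ b) c)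
    simp only [Category.assoc] at h4
    rw [associator_naturality_assoc, ← tensorHom_id, ← id_tensorHom, tensorHom_comp_tensorHom_assoc,
      tensorHom_comp_tensorHom_assoc, phiι_μ, phiι_μ, Category.comp_id, Category.comp_id,
      ← phiEl_id, ← phiEl_id, phiEl_μ_right, reassoc_of% phiEl_μ_left]
    rw [phiEl_phiMap, tensorHom_id, id_tensorHom, tensorHom_id, id_tensorHom, Category.assoc, h1, h4,
      h2, ← actMap_phiEl, reassoc_of% h3]

lemma phiμ_left_unit :
    (λ_ (phi A G)).hom = phiε G ▷ phi A G ≫ phiμ G (𝟙_ _) A ≫ phiMap (λ_ A).hom G := by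
  refine phi_hom_ext (tensorLeft (𝟙_ (DayLambda V))) (X := A) (G := G)
    (f := (λ_ (phi A G)).hom) (g := phiε G ▷ phi A G ≫ phiμ G (𝟙_ _) A ≫ phiMap (λ_ A).hom G)
    fun k => ?_
  change 𝟙_ (DayLambda V) ◁ phiι A G k ≫ (λ_ (phi A G)).hom =
    𝟙_ (DayLambda V) ◁ phiι A G k ≫ phiε G ▷ phi A G ≫ phiμ G (𝟙_ _) A ≫ phiMap (λ_ A).hom G
  have h1 := dayη_leftUnitor A k
  have h2 := left_unitality G k
  have h3 := actτ_left_unit (A.functor.obj (op k)) (G.obj k)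
  have h4 := phiEl_map_eq A G (λ_ k).hom (λ_ (A.functor.obj (op k))).hom
    (ε G ▷ G.obj k ≫ μ G (𝟙_ _) k)
  simp only [Category.assoc] at h4
  rw [leftUnitor_naturality, ← tensorHom_def'_assoc, phiε, ← phiEl_id, reassoc_of% phiEl_μ_left]
  rw [phiEl_phiMap, tensorHom_id, tensorHom_id, Category.assoc, h1, h4, ← h2, ← h3, Category.assoc,
    Category.assoc, actMap_phiEl, Category.comp_id, Category.comp_id]

end

lemma phiμ_braiding (G : LambdaCat ⥤ DayLambda V) [G.LaxBraided] (A B : DayLambda V) :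
    phiμ G A B ≫ phiMap (β_ A B).hom G = (β_ _ _).hom ≫ phiμ G B A :=
  phi_tensorPhi_hom_ext fun k l => by
    have h1 := dayη_braiding A B k l
    have h2 := Functor.LaxBraided.braided (F := G) k l
    have h3 := actτ_braiding (A.functor.obj (op k)) (B.functor.obj (op l)) (G.obj k) (G.obj l)
    have h4 := phiEl_map_eq (B ⊗ A) G (β_ k l).hom
      ((β_ (A.functor.obj (op k)) (B.functor.obj (op l))).hom ≫ dayη B A l k) (μ G k l)
    rw [Category.assoc] at h4
    rw [reassoc_of% phiι_μ, BraidedCategory.braiding_naturality_assoc, phiι_μ, phiEl_phiMap, h1, h4, h2,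
      ← actMap_phiEl, reassoc_of% h3]

instance phiFunctorLaxMonoidal (G : LambdaCat ⥤ DayLambda V) [G.LaxBraided] :
    (phiFunctor G).LaxMonoidal where
  ε := phiε G
  μ := phiμ G
  μ_natural_left f X' := by
    have := phiμ_natural G f (𝟙 X')
    have e : phiMap (𝟙 X') G = 𝟙 _ := (phiFunctor G).map_id X'
    rwa [e, tensorHom_id, tensorHom_id] at this
  μ_natural_right X' f := by
    have := phiμ_natural G (𝟙 X') f
    have e : phiMap (𝟙 X') G = 𝟙 _ := (phiFunctor G).map_id X'
    rwa [e, id_tensorHom, id_tensorHom] at this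
  associativity A B C := phiμ_assoc G A B C
  left_unitality A := phiμ_left_unit G A
  right_unitality A := by
    change (ρ_ (phi A G)).hom = phi A G ◁ phiε G ≫ phiμ G A (𝟙_ _) ≫ phiMap (ρ_ A).hom G
    -- Right unitality is left unitality conjugated with the braiding.
    have h1 := phiμ_braiding G A (𝟙_ _)
    have h2 := (phiFunctor G).map_comp (β_ A (𝟙_ _)).hom (λ_ A).hom
    rw [braiding_leftUnitor] at h2
    change phiMap (ρ_ A).hom G = phiMap (β_ A (𝟙_ _)).hom G ≫ phiMap (λ_ A).hom G at h2
    rw [h2, reassoc_of% h1, BraidedCategory.braiding_naturality_right_assoc, ← phiμ_left_unit,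
      braiding_leftUnitor]

instance phiFunctorLaxBraided (G : LambdaCat ⥤ DayLambda V) [G.LaxBraided] :
    (phiFunctor G).LaxBraided where
  braided A B := phiμ_braiding G A B

instance phiNat_isMonoidal {G H : LambdaCat ⥤ DayLambda V} [G.LaxBraided] [H.LaxBraided]
    (g : G ⟶ H) [NatTrans.IsMonoidal g] : NatTrans.IsMonoidal (phiNat g) where
  unit := by
    change phiε G ≫ phiMapRight _ g = phiε H
    rw [phiε, Category.assoc, phiEl_phiMapRight, NatTrans.IsMonoidal.unit]
    rfl
  tensor A B := by
    change phiμ G A B ≫ phiMapRight _ g = (phiMapRight A g ⊗ₘ phiMapRight B g) ≫ phiμ H A B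
    refine phi_tensorPhi_hom_ext fun k l => ?_
    rw [tensorHom_comp_tensorHom_assoc, reassoc_of% phiι_μ, phiEl_phiMapRight, NatTrans.IsMonoidal.tensor,
      ← phiEl_id, ← phiEl_id, phiEl_phiMapRight, phiEl_phiMapRight, phiEl_μ, id_tensorHom_id,
      Category.id_comp, Category.id_comp, Category.id_comp]

instance isIso_actMap {x y : V} {A B : DayLambda V} (f : x ⟶ y) (g : A ⟶ B) [IsIso f] [IsIso g] :
    IsIso (actMap f g) :=
  ⟨actMap (inv f) (inv g), by simp [actMap_comp], by simp [actMap_comp]⟩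

lemma isIso_phiι₀ (G : LambdaCat ⥤ DayLambda V) : IsIso (phiι₀ G) := by
  obtain ⟨d, hd⟩ := exists_phi_unit_desc (G := G) (𝟙 _)
  exact ⟨d, hd, phi_unit_hom_ext (by rw [reassoc_of% hd, Category.comp_id])⟩

instance isIso_phi_ε (G : LambdaCat ⥤ DayLambda V) [G.LaxBraided] [IsIso (ε G)] :
    IsIso (ε (phiFunctor G)) := by
  have h : ε (phiFunctor G) = actUnit _ ≫ actMap (𝟙 _) (ε G) ≫ phiι₀ G := by
    change phiε G = _
    rw [phiε, phiEl, phiι₀, ← Category.assoc (actMap _ _), actMap_comp, Category.id_comp,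
      Category.comp_id]
  rw [h]
  exact @IsIso.comp_isIso _ _ _ _ _ _ _ (isIso_actUnit _)
    (@IsIso.comp_isIso _ _ _ _ _ _ _ (isIso_actMap _ _) (isIso_phiι₀ G))

lemma isIso_actτ_actMap {x y : V} {P Q R : DayLambda V} (f : P ⊗ Q ⟶ R) (hf : IsIso f) :
    IsIso (actτ x y P Q ≫ actMap (𝟙 _) f) :=
  @IsIso.comp_isIso _ _ _ _ _ _ _ (isIso_actτ _ _ _ _) (isIso_actMap _ _)

/-- Source and target are coends over `(k, l)`, of `(A(k) · G(k)) ⊠ (B(l) · G(l))` and of `(A(k) ⊗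
B(l)) · G(k ∨ l)`; the integrands are isomorphic by the interchange and `μ G k l`. -/
instance isIso_phi_μ (G : LambdaCat ⥤ DayLambda V) [G.LaxBraided] [hG : ∀ k l, IsIso (μ G k l)]
    (A B : DayLambda V) : IsIso (μ (phiFunctor G) A B) := by
  change IsIso (phiμ G A B)
  obtain ⟨t, ht, htι⟩ : ∃ t : ∀ k l, act (A.functor.obj (op k)) (G.obj k) ⊗
      act (B.functor.obj (op l)) (G.obj l) ⟶
      act (A.functor.obj (op k) ⊗ B.functor.obj (op l)) (G.obj (k ⊗ l)),
      (∀ k l, t k l = actτ _ _ _ _ ≫ actMap (𝟙 _) (μ G k l)) ∧ ∀ k l, IsIso (t k l) :=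
    ⟨_, fun _ _ => rfl, fun k l => isIso_actτ_actMap _ (hG k l)⟩
  have key (k l) : (phiι A G k ⊗ₘ phiι B G l) ≫ phiμ G A B = t k l ≫ phiι₂ A B G k l := by
    rw [phiι_μ, phiEl, phiι₂, ht, Category.assoc, ← Category.assoc (actMap _ _), actMap_comp,
      Category.id_comp, Category.comp_id]
  obtain ⟨d, hd⟩ : ∃ d : phi (A ⊗ B) G ⟶ phi A G ⊗ phi B G, ∀ k l, phiι₂ A B G k l ≫ d =
      inv (t k l) ≫ (phiι A G k ⊗ₘ phiι B G l) := by
    refine exists_phi_tensor_desc (𝟭 _) (A := A) (B := B) (G := G) (fun k l =>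
      inv (t k l) ≫ (phiι A G k ⊗ₘ phiι B G l)) (fun {k k' l l'} f g => ?_)
    change actMap (A.functor.map f.op ⊗ₘ B.functor.map g.op) (𝟙 (G.obj (k ⊗ l))) ≫
      inv (t k l) ≫ (phiι A G k ⊗ₘ phiι B G l) =
      actMap (𝟙 _) (G.map (f ⊗ₘ g)) ≫ inv (t k' l') ≫ (phiι A G k' ⊗ₘ phiι B G l')
    -- The analogue of `t` at mixed indices, with `A(k')` and `B(l')` but `G(k)` and `G(l)`. Both
    -- sides of the condition start at its target, and they are compared after precomposition with
    -- `s`.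
    obtain ⟨s, hs, _⟩ : ∃ s : act (A.functor.obj (op k')) (G.obj k) ⊗
        act (B.functor.obj (op l')) (G.obj l) ⟶
        act (A.functor.obj (op k') ⊗ B.functor.obj (op l')) (G.obj (k ⊗ l)),
        s = actτ _ _ _ _ ≫ actMap (𝟙 _) (μ G k l) ∧ IsIso s :=
      ⟨_, rfl, isIso_actτ_actMap _ (hG k l)⟩
    have h1 := actτ_natural (A.functor.map f.op) (𝟙 (G.obj k)) (B.functor.map g.op) (𝟙 (G.obj l))
    have h2 := actτ_natural (𝟙 (A.functor.obj (op k'))) (G.map f) (𝟙 (B.functor.obj (op l'))) (G.map g)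
    have h3 := μ_natural G f g
    have e1 : s ≫ actMap (A.functor.map f.op ⊗ₘ B.functor.map g.op) (𝟙 (G.obj (k ⊗ l))) =
        (actMap (A.functor.map f.op) (𝟙 (G.obj k)) ⊗ₘ actMap (B.functor.map g.op) (𝟙 (G.obj l))) ≫
          t k l := by
      rw [hs, ht, ← Category.assoc, h1, Category.assoc, Category.assoc, actMap_comp, actMap_comp,
        id_tensorHom_id, Category.id_comp, Category.id_comp, Category.comp_id, Category.comp_id]
    have e2 : s ≫ actMap (𝟙 _) (G.map (f ⊗ₘ g)) =
        (actMap (𝟙 _) (G.map f) ⊗ₘ actMap (𝟙 _) (G.map g)) ≫ t k' l' := by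
      rw [hs, ht, ← Category.assoc, h2, Category.assoc, Category.assoc, actMap_comp, actMap_comp,
        id_tensorHom_id, h3]
    rw [← cancel_epi s, ← Category.assoc, e1, ← Category.assoc s, e2, Category.assoc, Category.assoc,
      IsIso.hom_inv_id_assoc, IsIso.hom_inv_id_assoc, tensorHom_comp_tensorHom,
      tensorHom_comp_tensorHom, phiι_condition, phiι_condition]
  refine ⟨d, phi_tensorPhi_hom_ext fun k l => ?_, phi_tensor_hom_ext (𝟭 _) fun k l => ?_⟩
  · rw [reassoc_of% key, hd, IsIso.hom_inv_id_assoc, Category.comp_id]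
  · change phiι₂ A B G k l ≫ d ≫ phiμ G A B = phiι₂ A B G k l ≫ 𝟙 _
    rw [reassoc_of% hd, key, IsIso.inv_hom_id_assoc, Category.comp_id]

end PhiMonoidal

/-! ### Linearity of the coend over the action of `V`. -/

noncomputable section PhiLinear
open MonoidalCategory.DayFunctor Functor.LaxMonoidal

variable {V : Type u} [Category.{v} V] [MonoidalCategory V] [SymmetricCategory V] [HasColimits V]
  [∀ X : V, PreservesColimits (tensorLeft X)]

lemma actAssoc_pentagon (x y z : V) (A : DayLambda V) :
    actAssoc (x ⊗ y) z A ≫ actAssoc x y (act z A) =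
      actMap (α_ x y z).hom (𝟙 A) ≫ actAssoc x (y ⊗ z) A ≫ actMap (𝟙 x) (actAssoc y z A) :=
  day_ext fun k => by
    have := pentagon x y z (A.functor.obj (op k))
    simp only [day_comp_app, actAssoc_app, actMap_app, day_id_app, tensorHom_id, id_tensorHom]
    exact this.symm

lemma actUnit_actAssoc (x : V) (A : DayLambda V) :
    actUnit (act x A) = actMap (λ_ x).inv (𝟙 A) ≫ actAssoc (𝟙_ V) x A :=
  day_ext fun k => by
    simp only [day_comp_app, actAssoc_app, actMap_app, actUnit_app, day_id_app, tensorHom_id]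
    simp

section
variable (G : LambdaCat ⥤ DayLambda V)

lemma phiAct_natural {x y : V} {A B : DayLambda V} (f : x ⟶ y) (g : A ⟶ B) :
    phiMap (actMap f g) G ≫ phiAct y B G = phiAct x A G ≫ actMap f (phiMap g G) :=
  phi_hom_ext' fun k => by
    have h1 := phiι_map (actMap f g) G k
    have h2 := actAssoc_natural f (g.natTrans.app (op k)) (𝟙 (G.obj k))
    rw [actMap_app] at h1
    rw [reassoc_of% h1, phiι_act, reassoc_of% phiι_act, actMap_comp, phiι_map, reassoc_of% h2, actMap_comp,
      Category.id_comp, Category.comp_id]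

lemma phiAct_mapRight {H : LambdaCat ⥤ DayLambda V} (g : G ⟶ H) (x : V) (A : DayLambda V) :
    phiMapRight (act x A) g ≫ phiAct x A H = phiAct x A G ≫ actMap (𝟙 x) (phiMapRight A g) :=
  phi_hom_ext' fun k => by
    have h1 := phiι_mapRight (act x A) g k
    have h2 := actAssoc_natural (𝟙 x) (𝟙 (A.functor.obj (op k))) (g.app k)
    rw [id_tensorHom_id] at h2
    dsimp only at h1
    rw [reassoc_of% h1, phiι_act, reassoc_of% phiι_act, actMap_comp, phiι_mapRight, reassoc_of% h2,
      actMap_comp]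

/-- With `phiAct_unit`, this is the coherence of a `V`-linear functor; on components it is the
pentagon of `V`. -/
lemma phiAct_assoc (x y : V) (A : DayLambda V) :
    phiMap (actAssoc x y A) G ≫ phiAct x (act y A) G ≫ actMap (𝟙 x) (phiAct y A G) =
      phiAct (x ⊗ y) A G ≫ actAssoc x y (phi A G) :=
  phi_hom_ext' fun k => by
    have h1 := phiι_map (actAssoc x y A) G k
    have h2 := actAssoc_pentagon x y (A.functor.obj (op k)) (G.obj k)
    have h3 := actAssoc_natural (𝟙 x) (𝟙 y) (phiι A G k)
    have h4 := phiι_act x (act y A) G k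
    rw [actAssoc_app] at h1
    rw [id_tensorHom_id] at h3
    dsimp only at h4
    rw [reassoc_of% h1, reassoc_of% h4, actMap_comp, phiι_act, reassoc_of% phiι_act, h3, reassoc_of% h2,
      actMap_comp, Category.comp_id]

lemma phiAct_unit (A : DayLambda V) :
    phiMap (actUnit A) G ≫ phiAct (𝟙_ V) A G = actUnit (phi A G) :=
  phi_hom_ext' fun k => by
    have h1 := phiι_map (actUnit A) G k
    have h2 := actUnit_actAssoc (A.functor.obj (op k)) (G.obj k)
    rw [actUnit_app] at h1
    rw [reassoc_of% h1, phiι_act, actUnit_natural, h2, Category.assoc]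

/-- On components this is `actτ_actAssoc`. Compatibility of the monoidal with the linear structure
is what makes the interchange of coends monoidal. -/
lemma phiμ_phiAct [G.LaxMonoidal] (x y : V) (A B : DayLambda V) :
    (phiAct x A G ⊗ₘ phiAct y B G) ≫ actτ x y _ _ ≫ actMap (𝟙 _) (phiμ G A B) =
      phiμ G (act x A) (act y B) ≫ phiMap (actτ x y A B) G ≫ phiAct (x ⊗ y) (A ⊗ B) G :=
  phi_tensorPhi_hom_ext fun k l => by
    have h1 := phiι_act x A G k
    have h2 := phiι_act y B G l
    have h3 := actτ_natural (𝟙 x) (phiι A G k) (𝟙 y) (phiι B G l)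
    have h4 := phiι_μ G (act x A) (act y B) k l
    have h5 := dayη_actτ x y A B k l
    have h6 := actτ_actAssoc x y (A.functor.obj (op k)) (B.functor.obj (op l)) (G.obj k) (G.obj l)
    have h7 := actAssoc_natural (𝟙 (x ⊗ y)) (dayη A B k l) (μ G k l)
    have h8 : actMap (tensorμ x (A.functor.obj (op k)) y (B.functor.obj (op l)) ≫
        (x ⊗ y) ◁ dayη A B k l) (μ G k l) = actMap (tensorμ x (A.functor.obj (op k)) y
          (B.functor.obj (op l))) (𝟙 _) ≫ actMap ((x ⊗ y) ◁ dayη A B k l) (μ G k l) := by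
      rw [actMap_comp, Category.id_comp]
    rw [id_tensorHom] at h7
    rw [id_tensorHom_id] at h3
    dsimp only at h4
    rw [tensorHom_comp_tensorHom_assoc, h1, h2, ← tensorHom_comp_tensorHom_assoc, reassoc_of% h3,
      actMap_comp, phiι_μ, reassoc_of% h4, reassoc_of% phiEl_phiMap, h5, phiEl_phiAct, h8, Category.assoc,
      reassoc_of% h7, ← reassoc_of% h6, actMap_comp, actMap_comp, phiEl]
    simp only [Category.comp_id]

lemma phiMap_comp {A B C : DayLambda V} (f : A ⟶ B) (g : B ⟶ C) :
    phiMap (f ≫ g) G = phiMap f G ≫ phiMap g G := (phiFunctor G).map_comp f g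

lemma phiMap_id (A : DayLambda V) : phiMap (𝟙 A) G = 𝟙 _ := (phiFunctor G).map_id A

/-- The inverse of `phiAct`. -/
def phiActInv (x : V) (A : DayLambda V) (G : LambdaCat ⥤ DayLambda V) :
    act x (phi A G) ⟶ phi (act x A) G := inv (phiAct x A G)

lemma phiAct_inv (x : V) (A : DayLambda V) : phiAct x A G ≫ phiActInv x A G = 𝟙 _ :=
  IsIso.hom_inv_id _

lemma phiActInv_hom (x : V) (A : DayLambda V) : phiActInv x A G ≫ phiAct x A G = 𝟙 _ :=
  IsIso.inv_hom_id _

instance isIso_phiActInv (x : V) (A : DayLambda V) : IsIso (phiActInv x A G) :=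
  ⟨phiAct x A G, phiActInv_hom G x A, phiAct_inv G x A⟩

lemma phiActInv_natural {x y : V} {A B : DayLambda V} (f : x ⟶ y) (g : A ⟶ B) :
    actMap f (phiMap g G) ≫ phiActInv y B G = phiActInv x A G ≫ phiMap (actMap f g) G := by
  have h := (reassoc_of% (phiAct_natural G f g)) (phiActInv y B G)
  rw [phiAct_inv, Category.comp_id] at h
  rw [h, reassoc_of% phiActInv_hom]

lemma phiActInv_mapRight {H : LambdaCat ⥤ DayLambda V} (g : G ⟶ H) (x : V) (A : DayLambda V) :
    actMap (𝟙 x) (phiMapRight A g) ≫ phiActInv x A H = phiActInv x A G ≫ phiMapRight (act x A) g := by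
  have h := (reassoc_of% (phiAct_mapRight G g x A)) (phiActInv x A H)
  rw [phiAct_inv, Category.comp_id] at h
  rw [h, reassoc_of% phiActInv_hom]

lemma phiActInv_assoc (x y : V) (A : DayLambda V) :
    actAssoc x y (phi A G) ≫ actMap (𝟙 x) (phiActInv y A G) ≫ phiActInv x (act y A) G =
      phiActInv (x ⊗ y) A G ≫ phiMap (actAssoc x y A) G := by
  have h := phiAct_assoc G x y A
  have h2 := congrArg (fun t => phiActInv (x ⊗ y) A G ≫ t ≫ actMap (𝟙 x) (phiActInv y A G) ≫
    phiActInv x (act y A) G) h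
  simp only [Category.assoc] at h2
  rw [reassoc_of% phiActInv_hom, ← Category.assoc (actMap (𝟙 x) (phiAct y A G)), actMap_comp, phiAct_inv,
    Category.comp_id, actMap_id, Category.id_comp, phiAct_inv, Category.comp_id] at h2
  exact h2.symm

lemma phiActInv_μ [G.LaxMonoidal] (x y : V) (A B : DayLambda V) :
    (phiActInv x A G ⊗ₘ phiActInv y B G) ≫ phiμ G (act x A) (act y B) ≫ phiMap (actτ x y A B) G =
      actτ x y _ _ ≫ actMap (𝟙 _) (phiμ G A B) ≫ phiActInv (x ⊗ y) (A ⊗ B) G := by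
  have h := phiμ_phiAct G x y A B
  have h2 := congrArg (fun t => (phiActInv x A G ⊗ₘ phiActInv y B G) ≫ t ≫
    phiActInv (x ⊗ y) (A ⊗ B) G) h
  simp only [Category.assoc] at h2
  rw [tensorHom_comp_tensorHom_assoc, phiActInv_hom, phiActInv_hom, id_tensorHom_id,
    Category.id_comp, phiAct_inv, Category.comp_id] at h2
  exact h2.symm

lemma phiι_eq_actInv (x : V) (A : DayLambda V) (k : LambdaCat) : phiι (act x A) G k =
    actAssoc x _ _ ≫ actMap (𝟙 x) (phiι A G k) ≫ phiActInv x A G := by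
  have h := phiι_act x A G k
  rw [← reassoc_of% h, phiAct_inv, Category.comp_id]

end
end PhiLinear

/-! ### The interchange of coends and its cocycle identity. -/

noncomputable section PhiComp
open MonoidalCategory.DayFunctor Functor.LaxMonoidal

variable {V : Type u} [Category.{v} V] [MonoidalCategory V] [SymmetricCategory V] [HasColimits V]
  [∀ X : V, PreservesColimits (tensorLeft X)]

/-- The functor `k ↦ ∫^l G(k)(l) · H(l)`. -/
@[reducible] def phiPost (G H : LambdaCat ⥤ DayLambda V) : LambdaCat ⥤ DayLambda V where
  obj k := phi (G.obj k) H
  map f := phiMap (G.map f) H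
  map_id k := by rw [CategoryTheory.Functor.map_id, phiMap_id]
  map_comp f g := by rw [Functor.map_comp, phiMap_comp]

instance phiPostLaxBraided (G H : LambdaCat ⥤ DayLambda V) [G.LaxBraided] [H.LaxBraided] :
    (phiPost G H).LaxBraided :=
  inferInstanceAs (G ⋙ phiFunctor H).LaxBraided

/-- Functoriality of `phiPost` in the first variable. -/
@[reducible] def phiPostMap {G G' : LambdaCat ⥤ DayLambda V} (g : G ⟶ G')
    (H : LambdaCat ⥤ DayLambda V) : phiPost G H ⟶ phiPost G' H where
  app k := phiMap (g.app k) H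
  naturality _ _ f := by rw [← phiMap_comp, ← phiMap_comp, g.naturality]

/-- Functoriality of `phiPost` in the second variable. -/
@[reducible] def phiPostMapRight (G : LambdaCat ⥤ DayLambda V) {H H' : LambdaCat ⥤ DayLambda V}
    (h : H ⟶ H') : phiPost G H ⟶ phiPost G H' where
  app k := phiMapRight (G.obj k) h
  naturality _ _ f := (phiNat h).naturality (G.map f)

/-- By linearity `X(k) · phi (G k) H` is `phi (X(k) · G(k)) H`, to which `phi - H` of the component
of `phi X G` applies. -/
lemma exists_phiComp (X : DayLambda V) (G H : LambdaCat ⥤ DayLambda V) :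
    ∃ d : phi X (phiPost G H) ⟶ phi (phi X G) H, ∀ k, phiι X (phiPost G H) k ≫ d =
      phiActInv (X.functor.obj (op k)) (G.obj k) H ≫ phiMap (phiι X G k) H := by
  let h (k : LambdaCat) : act (X.functor.obj (op k)) (phi (G.obj k) H) ⟶ phi (phi X G) H :=
    phiActInv (X.functor.obj (op k)) (G.obj k) H ≫ phiMap (phiι X G k) H
  refine exists_phi_desc' (X := X) (G := phiPost G H) h (fun {k l} f => ?_)
  have h1 := phiActInv_natural H (X.functor.map f.op) (𝟙 (G.obj k))
  have h2 := phiActInv_natural H (𝟙 (X.functor.obj (op l))) (G.map f)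
  have h3 := phiι_condition X G f
  rw [phiMap_id] at h1
  change actMap (X.functor.map f.op) (𝟙 (phi (G.obj k) H)) ≫
    phiActInv (X.functor.obj (op k)) (G.obj k) H ≫ phiMap (phiι X G k) H =
    actMap (𝟙 _) (phiMap (G.map f) H) ≫
      phiActInv (X.functor.obj (op l)) (G.obj l) H ≫ phiMap (phiι X G l) H
  rw [reassoc_of% h1, reassoc_of% h2, ← phiMap_comp, ← phiMap_comp, h3]

/-- The interchange of coends. -/
def phiComp (X : DayLambda V) (G H : LambdaCat ⥤ DayLambda V) :
    phi X (phiPost G H) ⟶ phi (phi X G) H := (exists_phiComp X G H).choose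

lemma phiι_comp (X : DayLambda V) (G H : LambdaCat ⥤ DayLambda V) (k : LambdaCat) :
    phiι X (phiPost G H) k ≫ phiComp X G H =
      phiActInv (X.functor.obj (op k)) (G.obj k) H ≫ phiMap (phiι X G k) H :=
  (exists_phiComp X G H).choose_spec k

lemma phiEl_comp (X : DayLambda V) (G H : LambdaCat ⥤ DayLambda V) (k : LambdaCat) {x : V}
    {P : DayLambda V} (p : x ⟶ X.functor.obj (op k)) (q : P ⟶ phi (G.obj k) H) :
    phiEl X (phiPost G H) k p q ≫ phiComp X G H =
      actMap p q ≫ phiActInv (X.functor.obj (op k)) (G.obj k) H ≫ phiMap (phiι X G k) H := by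
  rw [phiEl, Category.assoc, phiι_comp]

lemma exists_phiComp_inv (X : DayLambda V) (G H : LambdaCat ⥤ DayLambda V) :
    ∃ d : phi (phi X G) H ⟶ phi X (phiPost G H), ∀ k, phiMap (phiι X G k) H ≫ d =
      phiAct (X.functor.obj (op k)) (G.obj k) H ≫ phiι X (phiPost G H) k := by
  let h (k : LambdaCat) : phi (act (X.functor.obj (op k)) (G.obj k)) H ⟶ phi X (phiPost G H) :=
    phiAct (X.functor.obj (op k)) (G.obj k) H ≫ phiι X (phiPost G H) k
  refine exists_phi_desc (phiFunctor H) (X := X) (G := G) h (fun {k l} f => ?_)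
  have h1 := phiAct_natural H (X.functor.map f.op) (𝟙 (G.obj k))
  have h2 := phiAct_natural H (𝟙 (X.functor.obj (op l))) (G.map f)
  have h3 : actMap (X.functor.map f.op) (𝟙 (phi (G.obj k) H)) ≫ phiι X (phiPost G H) k =
    actMap (𝟙 _) (phiMap (G.map f) H) ≫ phiι X (phiPost G H) l :=
    phiι_condition X (phiPost G H) f
  rw [phiMap_id] at h1
  change phiMap (actMap (X.functor.map f.op) (𝟙 (G.obj k))) H ≫
    phiAct (X.functor.obj (op k)) (G.obj k) H ≫ phiι X (phiPost G H) k =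
    phiMap (actMap (𝟙 _) (G.map f)) H ≫
      phiAct (X.functor.obj (op l)) (G.obj l) H ≫ phiι X (phiPost G H) l
  rw [reassoc_of% h1, reassoc_of% h2]
  exact congrArg (fun t => phiAct (X.functor.obj (op l)) (G.obj k) H ≫ t) h3

/-- The inverse exists because `phiFunctor H` preserves the coend `phi X G`. -/
instance isIso_phiComp (X : DayLambda V) (G H : LambdaCat ⥤ DayLambda V) : IsIso (phiComp X G H) := by
  obtain ⟨d, hd⟩ := exists_phiComp_inv X G H
  refine ⟨d, phi_hom_ext' fun k => ?_, phi_hom_ext (phiFunctor H) fun k => ?_⟩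
  · rw [reassoc_of% phiι_comp, hd, reassoc_of% phiActInv_hom]
    exact (Category.comp_id _).symm
  · change phiMap (phiι X G k) H ≫ d ≫ phiComp X G H = phiMap (phiι X G k) H ≫ 𝟙 _
    rw [reassoc_of% (hd k), phiι_comp, reassoc_of% phiAct_inv, Category.comp_id]

lemma phiComp_natural {X Y : DayLambda V} (f : X ⟶ Y) (G H : LambdaCat ⥤ DayLambda V) :
    phiMap f (phiPost G H) ≫ phiComp Y G H = phiComp X G H ≫ phiMap (phiMap f G) H :=
  phi_hom_ext' fun k => by
    have h := phiActInv_natural H (f.natTrans.app (op k)) (𝟙 (G.obj k))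
    have h2 := phiι_map f (phiPost G H) k
    have h3 := phiι_map f G k
    rw [phiMap_id] at h
    rw [reassoc_of% h2, phiι_comp, reassoc_of% phiι_comp, ← phiMap_comp, h3, phiMap_comp, ← reassoc_of% h]

lemma phiComp_natural_left (X : DayLambda V) {G G' : LambdaCat ⥤ DayLambda V} (g : G ⟶ G')
    (H : LambdaCat ⥤ DayLambda V) :
    phiMapRight X (phiPostMap g H) ≫ phiComp X G' H =
      phiComp X G H ≫ phiMap (phiMapRight X g) H :=
  phi_hom_ext' fun k => by
    have h := phiActInv_natural H (𝟙 (X.functor.obj (op k))) (g.app k)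
    have h2 : phiι X (phiPost G H) k ≫ phiMapRight X (phiPostMap g H) =
      actMap (𝟙 _) (phiMap (g.app k) H) ≫ phiι X (phiPost G' H) k :=
      phiι_mapRight X (phiPostMap g H) k
    have h3 := phiι_mapRight X g k
    rw [reassoc_of% h2, phiι_comp, reassoc_of% phiι_comp, ← phiMap_comp, h3, phiMap_comp, reassoc_of% h]

lemma phiComp_natural_right (X : DayLambda V) (G : LambdaCat ⥤ DayLambda V)
    {H H' : LambdaCat ⥤ DayLambda V} (h : H ⟶ H') :
    phiMapRight X (phiPostMapRight G h) ≫ phiComp X G H' =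
      phiComp X G H ≫ phiMapRight (phi X G) h :=
  phi_hom_ext' fun k => by
    have h1 := phiActInv_mapRight H h (X.functor.obj (op k)) (G.obj k)
    have h2 : phiι X (phiPost G H) k ≫ phiMapRight X (phiPostMapRight G h) =
      actMap (𝟙 _) (phiMapRight (G.obj k) h) ≫ phiι X (phiPost G H') k :=
      phiι_mapRight X (phiPostMapRight G h) k
    have h3 : phiMap (phiι X G k) H ≫ phiMapRight (phi X G) h =
      phiMapRight _ h ≫ phiMap (phiι X G k) H' := (phiNat h).naturality (phiι X G k)
    rw [reassoc_of% h2, phiι_comp, reassoc_of% phiι_comp, h3, reassoc_of% h1]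

/-- The cocycle identity meets the interchange at `X(k) · G(k)`; this reduces it to the interchange
at `G(k)`. -/
lemma phiComp_linear (x : V) (X : DayLambda V) (G H : LambdaCat ⥤ DayLambda V) :
    phiActInv x X (phiPost G H) ≫ phiComp (act x X) G H =
      actMap (𝟙 x) (phiComp X G H) ≫ phiActInv x (phi X G) H ≫ phiMap (phiActInv x X G) H := by
  rw [← cancel_epi (phiAct x X (phiPost G H)), reassoc_of% phiAct_inv]
  refine phi_hom_ext' fun k => ?_
  have h1 := phiι_act x X (phiPost G H) k
  have h2 : phiι (act x X) (phiPost G H) k ≫ phiComp (act x X) G H =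
      phiActInv (x ⊗ X.functor.obj (op k)) (G.obj k) H ≫ phiMap (phiι (act x X) G k) H :=
    phiι_comp (act x X) G H k
  have h3 : actMap (𝟙 x) (phiι X (phiPost G H) k) ≫ actMap (𝟙 x) (phiComp X G H) =
      actMap (𝟙 x) (phiActInv (X.functor.obj (op k)) (G.obj k) H) ≫
        actMap (𝟙 x) (phiMap (phiι X G k) H) := by
    rw [actMap_comp, actMap_comp, phiι_comp]
  have h4 := phiActInv_assoc H x (X.functor.obj (op k)) (G.obj k)
  have h5 := phiActInv_natural H (𝟙 x) (phiι X G k)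
  rw [h2, reassoc_of% h1, reassoc_of% h3, reassoc_of% h5, phiι_eq_actInv, phiMap_comp, phiMap_comp]
  exact (reassoc_of% h4) (phiMap (actMap (𝟙 x) (phiι X G k)) H ≫ phiMap (phiActInv x X G) H) |>.symm

/-- The interchange of coends as a natural transformation. -/
@[simps]
def phiCompNat (G H : LambdaCat ⥤ DayLambda V) :
    phiFunctor (phiPost G H) ⟶ phiFunctor G ⋙ phiFunctor H where
  app X := phiComp X G H
  naturality _ _ f := phiComp_natural f G H

/-- The interchange of coends, on the values of a functor. -/
@[reducible] def phiPostComp (G H K : LambdaCat ⥤ DayLambda V) :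
    phiPost G (phiPost H K) ⟶ phiPost (phiPost G H) K where
  app k := phiComp (G.obj k) H K
  naturality _ _ f := phiComp_natural (G.map f) H K

/-- Two successive coend functors can be taken out of a coend one by one or together; on components
the two ways agree by linearity and naturality. This is the pentagon of the Kelly product before
powers are compared. -/
lemma phiComp_cocycle (X : DayLambda V) (G H K : LambdaCat ⥤ DayLambda V) :
    phiMapRight X (phiPostComp G H K) ≫ phiComp X (phiPost G H) K ≫
      phiMap (phiComp X G H) K = phiComp X G (phiPost H K) ≫ phiComp (phi X G) H K :=
  phi_hom_ext' fun k => by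
    have h1 : phiι X (phiPost G (phiPost H K)) k ≫
        phiMapRight X (phiPostComp G H K) =
        actMap (𝟙 _) (phiComp (G.obj k) H K) ≫ phiι X (phiPost (phiPost G H) K) k :=
      phiι_mapRight X (phiPostComp G H K) k
    have h2 : phiι X (phiPost (phiPost G H) K) k ≫ phiComp X (phiPost G H) K =
      phiActInv (X.functor.obj (op k)) (phi (G.obj k) H) K ≫ phiMap (phiι X (phiPost G H) k) K :=
      phiι_comp X (phiPost G H) K k
    have h3 := phiComp_linear (X.functor.obj (op k)) (G.obj k) H K
    have h4 := phiComp_natural (phiι X G k) H K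
    rw [reassoc_of% h1, reassoc_of% h2, reassoc_of% phiι_comp, h4, reassoc_of% h3, ← phiMap_comp,
      phiι_comp, phiMap_comp]

/-- Monoidality lets the interchange act factor by factor on tensor powers, as the pentagon
requires; its unit part gives the compatibility with base maps. -/
instance phiCompNat_isMonoidal (G H : LambdaCat ⥤ DayLambda V) [G.LaxBraided] [H.LaxBraided] :
    NatTrans.IsMonoidal (phiCompNat G H) where
  unit := by
    change phiε (phiPost G H) ≫ phiComp (𝟙_ _) G H = phiε H ≫ phiMap (phiε G) H
    have h1 := phiActInv_natural H (dayν V) (ε G)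
    have h2 : ε (phiPost G H) = phiε H ≫ phiMap (ε G) H := rfl
    have h3 := actUnit_natural (phiε H)
    have h4 : actUnit (phi (𝟙_ (DayLambda V)) H) ≫ phiActInv (𝟙_ V) (𝟙_ (DayLambda V)) H =
        phiMap (actUnit (𝟙_ (DayLambda V))) H := by
      rw [← phiAct_unit H, Category.assoc, phiAct_inv, Category.comp_id]
    have h5 : actMap (dayν V) (phiε H ≫ phiMap (ε G) H) =
        actMap (𝟙 _) (phiε H) ≫ actMap (dayν V) (phiMap (ε G) H) := by
      rw [actMap_comp, Category.id_comp]
    rw [phiε, Category.assoc, phiEl_comp, h2, h5, Category.assoc, reassoc_of% h1, ← reassoc_of% h3,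
      reassoc_of% h4]
    rw [phiε, phiε, phiEl, phiEl, phiMap_comp, phiMap_comp]
  tensor X Y := by
    change phiμ (phiPost G H) X Y ≫ phiComp (X ⊗ Y) G H =
      (phiComp X G H ⊗ₘ phiComp Y G H) ≫ phiμ H _ _ ≫ phiMap (phiμ G X Y) H
    refine phi_tensorPhi_hom_ext fun k l => ?_
    have h1 : μ (phiPost G H) k l = phiμ H _ _ ≫ phiMap (μ G k l) H := rfl
    have h2 := phiActInv_natural H (dayη X Y k l) (μ G k l)
    have h3 := phiActInv_μ H (X.functor.obj (op k)) (Y.functor.obj (op l)) (G.obj k) (G.obj l)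
    have h4 := phiμ_natural H (phiι X G k) (phiι Y G l)
    rw [reassoc_of% phiι_μ, phiEl_comp, tensorHom_comp_tensorHom_assoc, phiι_comp, phiι_comp,
      ← tensorHom_comp_tensorHom_assoc, reassoc_of% h4, ← phiMap_comp, phiι_μ, phiMap_comp,
      reassoc_of% h3, phiEl, phiMap_comp, ← reassoc_of% h2, h1]
    have h5 : actMap (dayη X Y k l) (phiμ H (G.obj k) (G.obj l) ≫ phiMap (μ G k l) H) =
        actMap (𝟙 _) (phiμ H (G.obj k) (G.obj l)) ≫ actMap (dayη X Y k l) (phiMap (μ G k l) H) := by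
      rw [actMap_comp, Category.id_comp]
    rw [h5, Category.assoc]

end PhiComp

/-! ### The associativity isomorphism of the Kelly product and its pentagon. -/

noncomputable section KellyAssoc
open MonoidalCategory.DayFunctor Functor.LaxMonoidal

variable {V : Type u} [Category.{v} V] [MonoidalCategory V] [SymmetricCategory V] [HasColimits V]
  [∀ X : V, PreservesColimits (tensorLeft X)]

/-- The underlying Day functor of a `Λ`-sequence. -/
@[reducible] def dayObj (D : LambdaSeq V) : DayLambda V := ⟨D.right⟩

/-- The underlying morphism of Day functors. -/
@[reducible] def dayMap {D E : LambdaSeq V} (φ : D ⟶ E) : dayObj D ⟶ dayObj E := ⟨φ.right⟩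

/-- The base map as a map out of the unit for Day convolution. -/
def dayBase (D : LambdaSeq V) : 𝟙_ (DayLambda V) ⟶ dayObj D := ((toDay V).obj D).hom

lemma dayν_dayBase (D : LambdaSeq V) : dayν V ≫ (dayBase D).natTrans.app (op (𝟙_ LambdaCat)) = D.hom :=
  DayFunctor.ν_comp_unitDesc _

lemma dayBase_map {D E : LambdaSeq V} (φ : D ⟶ E) : dayBase D ≫ dayMap φ = dayBase E :=
  Under.w ((toDay V).map φ)

lemma dayBase_eq (D : LambdaSeq V) (d : 𝟙_ (DayLambda V) ⟶ dayObj D)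
    (h : dayν V ≫ d.natTrans.app (op (𝟙_ LambdaCat)) = D.hom) : dayBase D = d :=
  DayFunctor.unit_hom_ext ((dayν_dayBase D).trans h.symm)

/-- A morphism of Day functors that is compatible with the base maps. -/
def lambdaHom {D E : LambdaSeq V} (g : dayObj D ⟶ dayObj E) (h : dayBase D ≫ g = dayBase E) : D ⟶ E :=
  StructuredArrow.homMk g.natTrans (by
    change D.hom ≫ g.natTrans.app (op (𝟙_ LambdaCat)) = E.hom
    rw [← dayν_dayBase D, ← dayν_dayBase E, ← h, day_comp_app, Category.assoc])

lemma lambda_hom_ext {D E : LambdaSeq V} {f g : D ⟶ E} (h : dayMap f = dayMap g) : f = g :=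
  StructuredArrow.hom_ext _ _ (congrArg DayFunctor.Hom.natTrans h)

/-- An isomorphism of Day functors that is compatible with the base maps. -/
def lambdaIso {D E : LambdaSeq V} (g : dayObj D ⟶ dayObj E) (h : dayBase D ≫ g = dayBase E)
    (hg : IsIso g) : D ≅ E where
  hom := lambdaHom g h
  inv := lambdaHom (inv g) (by rw [← h, Category.assoc, IsIso.hom_inv_id, Category.comp_id])
  hom_inv_id := lambda_hom_ext (IsIso.hom_inv_id g)
  inv_hom_id := lambda_hom_ext (IsIso.inv_hom_id g)

/-- The tensor powers of a `Λ`-sequence. -/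
@[reducible] def pw (D : LambdaSeq V) : LambdaCat ⥤ DayLambda V :=
  (tensorPowers (DayLambda V)).obj ((toDay V).obj D)

/-- Functoriality of the tensor powers of a `Λ`-sequence. -/
def pwMap {D E : LambdaSeq V} (φ : D ⟶ E) : pw D ⟶ pw E :=
  (tensorPowers (DayLambda V)).map ((toDay V).map φ)

instance pwMap_isMonoidal {D E : LambdaSeq V} (φ : D ⟶ E) : NatTrans.IsMonoidal (pwMap φ) :=
  tensorPowersMap_isMonoidal _

/-- The Kelly product. -/
abbrev ke (D E : LambdaSeq V) : LambdaSeq V := ((kelly V).obj D).obj E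

lemma unit_comp_leftUnitor_inv_whiskerRight {C : Type*} [Category C] [MonoidalCategory C] {A P Q : C}
    (d : 𝟙_ C ⟶ A) (n : 𝟙_ C ⟶ P) (t : A ⊗ P ⟶ Q) :
    n ≫ (λ_ P).inv ≫ d ▷ P ≫ t = d ≫ (ρ_ A).inv ≫ A ◁ n ≫ t := by
  rw [leftUnitor_inv_naturality_assoc, whisker_exchange_assoc, rightUnitor_inv_naturality_assoc,
    unitors_inv_equal]

/-- It exhibits `D ⊙ E`, as an object under `I₀`, as the image of `D` under the monoidal functor
`phiFunctor (pw E)`. This is the form of the base map for which `powMap_powComp` compares powers. -/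
lemma dayBase_kelly (D E : LambdaSeq V) :
    dayBase (ke D E) = phiε (pw E) ≫ phiMap (dayBase D) (pw E) := by
  refine dayBase_eq _ _ ?_
  have h1 : phiε (pw E) ≫ phiMap (dayBase D) (pw E) = actUnit (𝟙_ (DayLambda V)) ≫
      actMap D.hom (𝟙 (𝟙_ (DayLambda V))) ≫ phiι (dayObj D) (pw E) (𝟙_ LambdaCat) := by
    rw [phiε, Category.assoc, phiEl_phiMap, dayν_dayBase]
    rfl
  refine (congrArg (fun t => dayν V ≫ t.natTrans.app (op (𝟙_ LambdaCat))) h1).trans ?_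
  rw [day_comp_app, actUnit_app]
  have h2 : (actMap D.hom (𝟙 (𝟙_ (DayLambda V))) ≫
      phiι (dayObj D) (pw E) (𝟙_ LambdaCat)).natTrans.app (op (𝟙_ LambdaCat)) =
      D.hom ▷ (𝟙_ (DayLambda V)).functor.obj (op (𝟙_ LambdaCat)) ≫
        (phiι (dayObj D) (pw E) (𝟙_ LambdaCat)).natTrans.app (op (𝟙_ LambdaCat)) := by
    refine (day_comp_app _ _ _).trans (congrArg (· ≫ _) ?_)
    refine (actMap_app _ _ _).trans ?_
    rw [day_id_app, tensorHom_id]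
  rw [h2]
  exact unit_comp_leftUnitor_inv_whiskerRight D.hom (dayν V)
    (tensorOverι V D.right (((dayPow V).obj E).flip.obj (op ⟨0⟩)) ⟨0⟩)

/-- The comparison of the powers of a Kelly product. -/
def pwComp (D E : LambdaSeq V) : pw (ke D E) ⟶ phiPost (pw D) (pw E) where
  app k := powComp (phiFunctor (pw E)) (dayObj D) k.card
  naturality k l f := by
    have h := powMap_powComp (phiFunctor (pw E)) (dayBase D) (LambdaCat.inj f)
    have h2 : ε (phiFunctor (pw E)) ≫ (phiFunctor (pw E)).map (dayBase D) = dayBase (ke D E) :=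
      (dayBase_kelly D E).symm
    rw [h2] at h
    exact h

instance pwComp_isMonoidal (D E : LambdaSeq V) : NatTrans.IsMonoidal (pwComp D E) where
  unit := (Category.id_comp _).trans ((Category.comp_id _).symm.trans
    (congrArg (ε (phiFunctor (pw E)) ≫ ·) ((phiFunctor (pw E)).map_id _).symm))
  tensor m n := powMul_powComp (phiFunctor (pw E)) (dayObj D) m.card n.card _ rfl

instance isIso_pwComp (D E : LambdaSeq V) : IsIso (pwComp D E) :=
  have (k : LambdaCat) : IsIso ((pwComp D E).app k) :=
    isIso_powComp (phiFunctor (pw E)) (dayObj D) k.card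
  NatIso.isIso_of_isIso_app _

lemma phiMapRight_comp (X : DayLambda V) {G H K : LambdaCat ⥤ DayLambda V} (g : G ⟶ H) (h : H ⟶ K) :
    phiMapRight X (g ≫ h) = phiMapRight X g ≫ phiMapRight X h :=
  phi_hom_ext' fun k => by
    rw [phiι_mapRight, reassoc_of% phiι_mapRight, phiι_mapRight, ← Category.assoc, actMap_comp,
      Category.comp_id, NatTrans.comp_app]

lemma phiMapRight_id (X : DayLambda V) (G : LambdaCat ⥤ DayLambda V) :
    phiMapRight X (𝟙 G) = 𝟙 _ :=
  phi_hom_ext' fun k => by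
    rw [phiι_mapRight, NatTrans.id_app, actMap_id, Category.id_comp, Category.comp_id]

instance isIso_phiMapRight (X : DayLambda V) {G H : LambdaCat ⥤ DayLambda V} (g : G ⟶ H) [IsIso g] :
    IsIso (phiMapRight X g) :=
  ⟨phiMapRight X (inv g), by rw [← phiMapRight_comp, IsIso.hom_inv_id, phiMapRight_id],
    by rw [← phiMapRight_comp, IsIso.inv_hom_id, phiMapRight_id]⟩

/-- The inverse of the associativity isomorphism, for a Day functor in the first variable. -/
def kellyAssoc (X : DayLambda V) (D E : LambdaSeq V) :
    phi X (pw (ke D E)) ⟶ phi (phi X (pw D)) (pw E) :=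
  phiMapRight X (pwComp D E) ≫ phiComp X (pw D) (pw E)

instance isIso_kellyAssoc (X : DayLambda V) (D E : LambdaSeq V) : IsIso (kellyAssoc X D E) :=
  @IsIso.comp_isIso _ _ _ _ _ _ _ (isIso_phiMapRight _ _) (isIso_phiComp _ _ _)

/-- `kellyAssoc` as a natural transformation. -/
def kellyAssocNat (D E : LambdaSeq V) :
    phiFunctor (pw (ke D E)) ⟶ phiFunctor (pw D) ⋙ phiFunctor (pw E) :=
  phiNat (pwComp D E) ≫ phiCompNat (pw D) (pw E)

instance kellyAssocNat_isMonoidal (D E : LambdaSeq V) : NatTrans.IsMonoidal (kellyAssocNat D E) :=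
  inferInstanceAs (NatTrans.IsMonoidal (phiNat (pwComp D E) ≫ phiCompNat (pw D) (pw E)))

lemma kellyAssoc_natural {X Y : DayLambda V} (f : X ⟶ Y) (D E : LambdaSeq V) :
    phiMap f (pw (ke D E)) ≫ kellyAssoc Y D E = kellyAssoc X D E ≫ phiMap (phiMap f (pw D)) (pw E) :=
  (kellyAssocNat D E).naturality f

lemma kellyAssoc_natural_middle (X : DayLambda V) {D D' : LambdaSeq V} (φ : D ⟶ D') (E : LambdaSeq V) :
    phiMapRight X (pwMap (((kelly V).map φ).app E)) ≫ kellyAssoc X D' E =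
      kellyAssoc X D E ≫ phiMap (phiMapRight X (pwMap φ)) (pw E) := by
  have h : pwMap (((kelly V).map φ).app E) ≫ pwComp D' E =
      pwComp D E ≫ phiPostMap (pwMap φ) (pw E) := by
    ext k : 2
    exact powComp_natural (phiFunctor (pw E)) (dayMap φ) k.card
  rw [kellyAssoc, kellyAssoc, Category.assoc, ← phiComp_natural_left, ← Category.assoc,
    ← phiMapRight_comp, ← Category.assoc, ← phiMapRight_comp, h]

lemma kellyAssoc_natural_right (X : DayLambda V) (D : LambdaSeq V) {E E' : LambdaSeq V} (ψ : E ⟶ E') :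
    phiMapRight X (pwMap (((kelly V).obj D).map ψ)) ≫ kellyAssoc X D E' =
      kellyAssoc X D E ≫ phiMapRight (phi X (pw D)) (pwMap ψ) := by
  have h : pwMap (((kelly V).obj D).map ψ) ≫ pwComp D E' =
      pwComp D E ≫ phiPostMapRight (pw D) (pwMap ψ) := by
    ext k : 2
    exact (powComp_natTrans (phiNat (pwMap ψ)) (dayObj D) k.card).symm
  rw [kellyAssoc, kellyAssoc, Category.assoc, ← phiComp_natural_right, ← Category.assoc,
    ← phiMapRight_comp, ← Category.assoc, ← phiMapRight_comp, h]

/-- Both base maps are unit maps of monoidal functors followed by the image of the base map of `X`,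
and the monoidal transformation `kellyAssocNat` respects the unit maps. -/
lemma kellyAssoc_base (X D E : LambdaSeq V) :
    dayBase (ke X (ke D E)) ≫ kellyAssoc (dayObj X) D E = dayBase (ke (ke X D) E) := by
  have h : phiε (pw (ke D E)) ≫ kellyAssoc (𝟙_ _) D E = phiε (pw E) ≫ phiMap (phiε (pw D)) (pw E) :=
    NatTrans.IsMonoidal.unit (τ := kellyAssocNat D E)
  refine (congrArg (· ≫ kellyAssoc (dayObj X) D E) (dayBase_kelly X (ke D E))).trans
    (Eq.trans ?_ (dayBase_kelly (ke X D) E).symm)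
  rw [dayBase_kelly X D]
  change (phiε (pw (ke D E)) ≫ phiMap (dayBase X) (pw (ke D E))) ≫ kellyAssoc (dayObj X) D E =
    phiε (pw E) ≫ phiMap (phiε (pw D) ≫ phiMap (dayBase X) (pw D)) (pw E)
  rw [Category.assoc, kellyAssoc_natural, reassoc_of% h, phiMap_comp]

/-- The associativity isomorphism of the Kelly product. -/
def kellyAssociator (X D E : LambdaSeq V) : ke (ke X D) E ≅ ke X (ke D E) :=
  (lambdaIso (D := ke X (ke D E)) (E := ke (ke X D) E) (kellyAssoc (dayObj X) D E)
    (kellyAssoc_base X D E) (isIso_kellyAssoc _ D E)).symm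

/-- Naturality of the interchange moves all comparisons of powers to the front, where they agree by
`h`; what remains is `phiComp_cocycle`. -/
lemma kellyAssoc_pentagon (X : DayLambda V) (D E F : LambdaSeq V) :
    kellyAssoc X D (ke E F) ≫ kellyAssoc (phi X (pw D)) E F =
      phiMapRight X (pwMap (kellyAssociator D E F).inv) ≫ kellyAssoc X (ke D E) F ≫
        phiMap (kellyAssoc X D E) (pw F) := by
  -- For each `k`, the comparison of powers commutes with the monoidal transformation `kellyAssocNat
  -- E F`, and along a composite of monoidal functors it is the composite of the comparisons.
  have h : pwComp D (ke E F) ≫ phiPostMapRight (pw D) (pwComp E F) ≫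
      phiPostComp (pw D) (pw E) (pw F) = pwMap (kellyAssociator D E F).inv ≫
        pwComp (ke D E) F ≫ phiPostMap (pwComp D E) (pw F) := by
    ext k : 2
    have h1 := powComp_natTrans (kellyAssocNat E F) (dayObj D) k.card
    have h2 := powComp_comp (phiFunctor (pw E)) (phiFunctor (pw F)) (dayObj D) k.card
    rw [h2] at h1
    exact h1
  have h3 := (reassoc_of% (phiComp_natural_right X (pw D) (pwComp E F))) (phiComp (phi X (pw D)) (pw E) (pw F))
  have h4 := phiComp_cocycle X (pw D) (pw E) (pw F)
  have h5 := (reassoc_of% (phiComp_natural_left X (pwComp D E) (pw F))) (phiMap (phiComp X (pw D) (pw E)) (pw F))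
  rw [kellyAssoc, kellyAssoc, kellyAssoc, kellyAssoc, phiMap_comp, Category.assoc, Category.assoc,
    ← h3, ← h5, ← h4, ← reassoc_of% phiMapRight_comp, ← reassoc_of% phiMapRight_comp, ← reassoc_of% phiMapRight_comp,
    ← reassoc_of% phiMapRight_comp]
  simp only [Category.assoc]
  rw [h]

/-- For the functor `i1`: it makes `kellyAct` compatible with the associativity isomorphism. -/
lemma kellyAssoc_linear (x : V) (X : DayLambda V) (D E : LambdaSeq V) :
    phiActInv x X (pw (ke D E)) ≫ kellyAssoc (act x X) D E =
      actMap (𝟙 x) (kellyAssoc X D E) ≫ phiActInv x (phi X (pw D)) (pw E) ≫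
        phiMap (phiActInv x X (pw D)) (pw E) := by
  have h1 := (reassoc_of% (phiActInv_mapRight _ (pwComp D E) x X)) (phiComp (act x X) (pw D) (pw E))
  have h2 := phiComp_linear x X (pw D) (pw E)
  have h3 : actMap (𝟙 x) (kellyAssoc X D E) = actMap (𝟙 x) (phiMapRight X (pwComp D E)) ≫
      actMap (𝟙 x) (phiComp X (pw D) (pw E)) := by rw [actMap_comp, Category.comp_id, kellyAssoc]
  rw [h3, Category.assoc, ← h2, h1, kellyAssoc]

end KellyAssoc

/-! ### Unit isomorphisms from the pentagon and a two-sided unit object. -/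

section OfUnits
variable {C : Type*} [Category C] {T : C ⥤ C ⥤ C} {U : C}

lemma mapIso_app_comp {X Y Z W : C} (f : X ⟶ Y) (g : Y ⟶ Z) :
    (T.map (f ≫ g)).app W = (T.map f).app W ≫ (T.map g).app W := by
  rw [Functor.map_comp, NatTrans.comp_app]

/-- An associative product with an object that is a unit on both sides up to unspecified natural
isomorphisms is a monoidal structure. -/
theorem exists_monoidalOn
    (a : ∀ X Y Z : C, (T.obj ((T.obj X).obj Y)).obj Z ≅ (T.obj X).obj ((T.obj Y).obj Z))
    (a_left : ∀ {X X' : C} (f : X ⟶ X') (Y Z : C), (T.map ((T.map f).app Y)).app Z ≫ (a X' Y Z).hom =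
      (a X Y Z).hom ≫ (T.map f).app _)
    (a_middle : ∀ (X : C) {Y Y' : C} (f : Y ⟶ Y') (Z : C), (T.map ((T.obj X).map f)).app Z ≫
      (a X Y' Z).hom = (a X Y Z).hom ≫ (T.obj X).map ((T.map f).app Z))
    (a_right : ∀ (X Y : C) {Z Z' : C} (f : Z ⟶ Z'), (T.obj ((T.obj X).obj Y)).map f ≫
      (a X Y Z').hom = (a X Y Z).hom ≫ (T.obj X).map ((T.obj Y).map f))
    (pent : ∀ X Y Z W : C, (T.map (a X Y Z).hom).app W ≫ (a X ((T.obj Y).obj Z) W).hom ≫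
        (T.obj X).map (a Y Z W).hom =
      (a ((T.obj X).obj Y) Z W).hom ≫ (a X Y ((T.obj Z).obj W)).hom)
    (L : T.obj U ≅ 𝟭 C) (R : T.flip.obj U ≅ 𝟭 C) :
    ∃ S : MonoidalOn T U, S.associator = a := by
  let FL : (T.obj U).FullyFaithful := (Functor.FullyFaithful.id C).ofIso L.symm
  let FR : (T.flip.obj U).FullyFaithful := (Functor.FullyFaithful.id C).ofIso R.symm
  -- The unit isomorphisms are built from the associator and some isomorphism `φ : U ⊗ U ≅ U`. Apart
  -- from providing `φ`, the isomorphisms `L` and `R` serve only to make `U ⊗ -` and `- ⊗ U` fully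
  -- faithful.
  obtain ⟨φ⟩ : Nonempty ((T.obj U).obj U ≅ U) := ⟨L.app U⟩
  have hl (Y : C) : ∃ l : (T.obj U).obj Y ≅ Y,
      (T.obj U).map l.hom = (a U U Y).inv ≫ (T.map φ.hom).app Y :=
    ⟨FL.preimageIso ((a U U Y).symm ≪≫ (T.mapIso φ).app Y), FL.map_preimage _⟩
  have hr (X : C) : ∃ r : (T.obj X).obj U ≅ X,
      (T.map r.hom).app U = (a X U U).hom ≫ (T.obj X).map φ.hom :=
    ⟨FR.preimageIso (a X U U ≪≫ (T.obj X).mapIso φ), FR.map_preimage _⟩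
  choose l hl using hl
  choose r hr using hr
  have faithL {X Y : C} {f g : X ⟶ Y} (h : (T.obj U).map f = (T.obj U).map g) : f = g :=
    FL.map_injective h
  have faithR {X Y : C} {f g : X ⟶ Y} (h : (T.map f).app U = (T.map g).app U) : f = g :=
    FR.map_injective h
  have l_nat {X Y : C} (f : X ⟶ Y) : (T.obj U).map f ≫ (l Y).hom = (l X).hom ≫ f := by
    apply faithL
    have h1 := a_right U U f
    rw [Functor.map_comp, Functor.map_comp, hl, hl, ← cancel_epi (a U U X).hom, ← reassoc_of% h1,
      Iso.hom_inv_id_assoc, Category.assoc, Iso.hom_inv_id_assoc, NatTrans.naturality]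
  have r_nat {X Y : C} (f : X ⟶ Y) : (T.map f).app U ≫ (r Y).hom = (r X).hom ≫ f := by
    apply faithR
    have h1 := a_left f U U
    rw [mapIso_app_comp, mapIso_app_comp, hr, hr, reassoc_of% h1, Category.assoc, NatTrans.naturality]
  have l_U (Y : C) : (l ((T.obj U).obj Y)).hom = (T.obj U).map (l Y).hom := by
    rw [← cancel_mono (l Y).hom, l_nat]
  -- The triangle at `U ⊗ Y`, which is the pentagon for `X`, `U`, `U`, `Y` after substitution of the
  -- equations that define `r X` and `l Y`.
  have tri1 (X Y : C) : (T.map (r X).hom).app ((T.obj U).obj Y) =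
      (a X U ((T.obj U).obj Y)).hom ≫ (T.obj X).map ((T.obj U).map (l Y).hom) := by
    have h1 := a_left (r X).hom U Y
    have h2 := pent X U U Y
    have h3 := a_middle X φ.hom Y
    rw [← cancel_epi (a ((T.obj X).obj U) U Y).hom, ← h1, ← reassoc_of% h2, ← Functor.map_comp, hl,
      Iso.hom_inv_id_assoc, hr, mapIso_app_comp, Category.assoc, h3]
  -- Naturality of `r X ⊗ -` along the isomorphism `l Y` carries the triangle from `U ⊗ Y` to `Y`.
  have tri (X Y : C) : (a X U Y).hom ≫ (T.obj X).map (l Y).hom = (T.map (r X).hom).app Y := by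
    have h1 := a_right X U (l Y).hom
    have h2 := (T.map (r X).hom).naturality (l Y).hom
    rw [tri1, Category.assoc] at h2
    rw [← cancel_epi ((T.obj ((T.obj X).obj U)).map (l Y).hom), reassoc_of% h1, h2,
      ← Functor.map_comp]
  exact ⟨{ associator := a
           leftUnitor := l
           rightUnitor := r
           associator_naturality := fun {X Y Z X' Y' Z'} f g h => by
             simp only [bifunctorMap, Category.assoc, Functor.map_comp,
               NatTrans.comp_app]
             rw [a_right, reassoc_of% (a_middle X' g Z), reassoc_of% (a_left f Y Z)]
           leftUnitor_naturality := l_nat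
           rightUnitor_naturality := r_nat
           pentagon := pent
           triangle := tri }, rfl⟩

end OfUnits

/-! ### The powers of the object `1` in `Λ`. -/

namespace LambdaCat

lemma card_tpow (n : ℕ) : (tpow (⟨1⟩ : LambdaCat) n).card = n := by
  induction n with
  | zero => rfl
  | succ n ih => rw [tpow, card_tensor, ih, Nat.add_comm]

/-- The identification of `n` with the `n`-fold wedge of `1`. -/
def isoPow (n : LambdaCat) : n ≅ tpow (⟨1⟩ : LambdaCat) n.card :=
  isoMk (finCongr (card_tpow n.card).symm)

lemma shift_isoPow (n : LambdaCat) (i : ℕ) : shift (isoPow n).hom i = i :=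
  shift_cast (m := n) (n := tpow (⟨1⟩ : LambdaCat) n.card) (card_tpow n.card).symm i

lemma shift_associator_inv (a b c : LambdaCat) (i : ℕ) : shift (α_ a b c).inv i = i :=
  shift_cast (Nat.add_assoc _ _ _).symm i

lemma shift_swapFirst (n : LambdaCat) (i : ℕ) :
    shift (swapFirst (⟨1⟩ : LambdaCat) ⟨1⟩ n) i = if i = 0 then 1 else if i = 1 then 0 else i := by
  have h (m n : LambdaCat) (i : ℕ) : shift (β_ m n).hom i =
    if i < m.card then n.card + i else if i < m.card + n.card then i - m.card else i := shift_flip m n i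
  simp only [swapFirst, shift_comp, shift_associator, shift_associator_inv, shift_whiskerRight, h,
    card_tensor]
  grind

lemma shift_insertAt (n : ℕ) (j : Fin (n + 1)) (i : ℕ) :
    shift (insertAt (⟨1⟩ : LambdaCat) n j) i =
      if i = 0 then (j : ℕ) else if i ≤ j then i - 1 else i := by
  induction n generalizing i with
  | zero =>
    obtain rfl : j = 0 := Fin.fin_one_eq_zero _
    rw [insertAt_zero]
    refine (shift_id _ i).trans ?_
    grind
  | succ n ih =>
    induction j using Fin.cases with
    | zero =>
      rw [insertAt_zero]
      refine (shift_id _ i).trans ?_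
      grind
    | succ j =>
      rw [insertAt_succ, shift_comp, shift_whiskerLeft, shift_swapFirst, ih]
      simp only [Fin.val_succ]
      grind

/-- The inclusion of the base point. -/
def zeroOne : 𝟙_ LambdaCat ⟶ (⟨1⟩ : LambdaCat) := (⟨Fin.elim0, fun i => i.elim0⟩ : Fin 0 ↪ Fin 1)

lemma shift_powMap {m n : ℕ} (f : Fin m ↪ Fin n) (i : ℕ) :
    shift (powMap zeroOne f) i = shift (m := ⟨m⟩) (n := ⟨n⟩) f i := by
  induction m generalizing n i with
  | zero =>
    have h1 : shift (powMap zeroOne f) i = i - 0 + (tpow (⟨1⟩ : LambdaCat) n).card :=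
      dif_neg (Nat.not_lt_zero i)
    have h2 : shift (m := ⟨0⟩) (n := ⟨n⟩) f i = i - 0 + n := dif_neg (Nat.not_lt_zero i)
    rw [h1, h2, card_tpow]
  | succ m ih =>
    obtain _ | n := n
    · exact (f 0).elim0
    have h (i : Fin m) := congrArg Fin.val (succAbove_remove f 0 i)
    rw [powMap_succ, shift_comp, shift_whiskerLeft, ih, shift_insertAt]
    obtain _ | i := i
    · simp [shift, inj]
    · by_cases hi : i < m
      · have h1 : shift (m := ⟨m⟩) (n := ⟨n⟩) (remove f 0) i = remove f 0 ⟨i, hi⟩ := dif_pos hi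
        have h2 : shift (m := ⟨m + 1⟩) (n := ⟨n + 1⟩) f (i + 1) = f (Fin.succ ⟨i, hi⟩) :=
          dif_pos (Nat.succ_lt_succ hi)
        have h3 := h ⟨i, hi⟩
        rw [Fin.zero_succAbove] at h3
        rw [h2, ← h3, Fin.succAbove]
        simp only [Nat.add_sub_cancel, h1, Fin.lt_def, Fin.val_castSucc]
        split_ifs <;> simp_all <;> omega
      · have h1 : shift (m := ⟨m⟩) (n := ⟨n⟩) (remove f 0) i = i - m + n := dif_neg hi
        have h2 : shift (m := ⟨m + 1⟩) (n := ⟨n + 1⟩) f (i + 1) = i + 1 - (m + 1) + (n + 1) :=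
          dif_neg (by simpa using hi)
        have h3 : (f 0 : ℕ) < n + 1 := (f 0).2
        simp only [Nat.add_sub_cancel, h1, h2]
        grind

/-- By `shift_powMap`, the functor of powers of `1` under `0`, formed in `Λ` itself, is the identity
functor. The powers of `I₁` are compared with it. -/
lemma isoPow_natural {m n : LambdaCat} (f : m ⟶ n) :
    (isoPow m).hom ≫ powMap zeroOne (inj f) = f ≫ (isoPow n).hom :=
  hom_ext_shift fun i => by
    rw [shift_comp, shift_comp, shift_isoPow, shift_isoPow, shift_powMap]
    rfl

end LambdaCat

/-! ### Elements of Day functors and their products. -/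

noncomputable section Elements
open MonoidalCategory.DayFunctor

variable {V : Type u} [Category.{v} V] [MonoidalCategory V] [SymmetricCategory V] [HasColimits V]
  [∀ X : V, PreservesColimits (tensorLeft X)]
  {A A' B B' C : DayLambda V} {k k' l l' m : LambdaCat}

/-- A morphism `φ` carries the element `a` at level `k` to the restriction of the element `b`. -/
def ElementMap (a : 𝟙_ V ⟶ A.functor.obj (op k)) (b : 𝟙_ V ⟶ B.functor.obj (op l)) (f : k ⟶ l)
    (φ : A ⟶ B) : Prop :=
  a ≫ φ.natTrans.app (op k) = b ≫ B.functor.map f.op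

/-- The product of elements. -/
def elementMul (a : 𝟙_ V ⟶ A.functor.obj (op k)) (b : 𝟙_ V ⟶ B.functor.obj (op l)) :
    𝟙_ V ⟶ (A ⊗ B).functor.obj (op (k ⊗ l)) :=
  (λ_ (𝟙_ V)).inv ≫ (a ⊗ₘ b) ≫ dayη A B k l

section
variable {a : 𝟙_ V ⟶ A.functor.obj (op k)} {a' : 𝟙_ V ⟶ A'.functor.obj (op k')}
  {b : 𝟙_ V ⟶ B.functor.obj (op l)} {b' : 𝟙_ V ⟶ B'.functor.obj (op l')}
  {c : 𝟙_ V ⟶ C.functor.obj (op m)}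

lemma ElementMap.id (a : 𝟙_ V ⟶ A.functor.obj (op k)) : ElementMap a a (𝟙 k) (𝟙 A) := by
  rw [ElementMap, day_id_app, op_id, CategoryTheory.Functor.map_id]

lemma ElementMap.comp {f : k ⟶ l} {φ : A ⟶ B} {g : l ⟶ m} {ψ : B ⟶ C} (h : ElementMap a b f φ)
    (h' : ElementMap b c g ψ) : ElementMap a c (f ≫ g) (φ ≫ ψ) := by
  rw [ElementMap] at *
  rw [day_comp_app, reassoc_of% h, day_hom_naturality, reassoc_of% h', op_comp, Functor.map_comp]

lemma ElementMap.tensor {f : k ⟶ k'} {φ : A ⟶ A'} {g : l ⟶ l'} {ψ : B ⟶ B'}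
    (h : ElementMap a a' f φ) (h' : ElementMap b b' g ψ) :
    ElementMap (elementMul a b) (elementMul a' b') (f ⊗ₘ g) (φ ⊗ₘ ψ) := by
  rw [ElementMap] at *
  rw [elementMul, elementMul, Category.assoc, Category.assoc, Category.assoc, Category.assoc,
    dayη_tensorHom, ← dayη_natural, tensorHom_comp_tensorHom_assoc, tensorHom_comp_tensorHom_assoc,
    h, h']

lemma ElementMap.whiskerLeft (a : 𝟙_ V ⟶ A.functor.obj (op k)) {g : l ⟶ l'} {ψ : B ⟶ B'}
    (h : ElementMap b b' g ψ) : ElementMap (elementMul a b) (elementMul a b') (k ◁ g) (A ◁ ψ) := by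
  have := (ElementMap.id a).tensor h
  rwa [id_tensorHom, id_tensorHom] at this

lemma ElementMap.whiskerRight {f : k ⟶ k'} {φ : A ⟶ A'} (h : ElementMap a a' f φ)
    (b : 𝟙_ V ⟶ B.functor.obj (op l)) :
    ElementMap (elementMul a b) (elementMul a' b) (f ▷ l) (φ ▷ B) := by
  have := h.tensor (ElementMap.id b)
  rwa [tensorHom_id, tensorHom_id] at this

lemma ElementMap.symm {f : k ≅ l} {φ : A ≅ B} (h : ElementMap a b f.hom φ.hom) :
    ElementMap b a f.inv φ.inv := by
  rw [ElementMap] at *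
  have h1 := day_hom_naturality φ.inv f.inv
  have h2 : φ.hom.natTrans.app (op k) ≫ φ.inv.natTrans.app (op k) = 𝟙 _ := by
    rw [← day_comp_app, Iso.hom_inv_id, day_id_app]
  have h3 : B.functor.map f.hom.op ≫ B.functor.map f.inv.op = 𝟙 _ := by
    rw [← Functor.map_comp, ← op_comp, Iso.inv_hom_id, op_id, CategoryTheory.Functor.map_id]
  have h4 := congrArg (· ≫ φ.inv.natTrans.app (op k) ≫ A.functor.map f.inv.op) h
  simp only [Category.assoc, reassoc_of% h2] at h4
  rw [h4, ← h1, reassoc_of% h3]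

lemma ElementMap.associator (a : 𝟙_ V ⟶ A.functor.obj (op k)) (b : 𝟙_ V ⟶ B.functor.obj (op l))
    (c : 𝟙_ V ⟶ C.functor.obj (op m)) : ElementMap (elementMul (elementMul a b) c)
      (elementMul a (elementMul b c)) (α_ k l m).hom (α_ A B C).hom := by
  have h := dayη_associator A B C k l m
  have h1 : (elementMul a b ⊗ₘ c) = ((λ_ (𝟙_ V)).inv ▷ 𝟙_ V) ≫ ((a ⊗ₘ b) ⊗ₘ c) ≫
      dayη A B k l ▷ C.functor.obj (op m) := by
    rw [elementMul, ← tensorHom_id, ← tensorHom_id, tensorHom_comp_tensorHom,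
      tensorHom_comp_tensorHom, Category.comp_id, Category.id_comp]
  have h2 : (a ⊗ₘ elementMul b c) = (𝟙_ V ◁ (λ_ (𝟙_ V)).inv) ≫ (a ⊗ₘ (b ⊗ₘ c)) ≫
      A.functor.obj (op k) ◁ dayη B C l m := by
    rw [elementMul, ← id_tensorHom, ← id_tensorHom, tensorHom_comp_tensorHom,
      tensorHom_comp_tensorHom, Category.comp_id, Category.id_comp]
  have h3 : elementMul (elementMul a b) c = (λ_ (𝟙_ V)).inv ≫ (elementMul a b ⊗ₘ c) ≫ dayη _ _ _ _ := rfl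
  have h4 : elementMul a (elementMul b c) = (λ_ (𝟙_ V)).inv ≫ (a ⊗ₘ elementMul b c) ≫ dayη _ _ _ _ := rfl
  rw [ElementMap, h3, h4, h1, h2]
  simp only [Category.assoc]
  have h5 : (λ_ (𝟙_ V)).inv ▷ 𝟙_ V ≫ (α_ _ _ _).hom = 𝟙_ V ◁ (λ_ (𝟙_ V)).inv := by
    rw [← triangle_assoc_comp_right_inv, unitors_inv_equal]
  rw [h, associator_naturality_assoc, reassoc_of% h5]

lemma ElementMap.leftUnitor (a : 𝟙_ V ⟶ A.functor.obj (op k)) :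
    ElementMap (elementMul (dayν V) a) a (λ_ k).hom (λ_ A).hom := by
  have h := dayη_leftUnitor A k
  rw [ElementMap, elementMul, MonoidalCategory.tensorHom_def']
  simp only [Category.assoc]
  rw [h, leftUnitor_naturality_assoc, Iso.inv_hom_id_assoc]

lemma ElementMap.braiding (a : 𝟙_ V ⟶ A.functor.obj (op k)) (b : 𝟙_ V ⟶ B.functor.obj (op l)) :
    ElementMap (elementMul a b) (elementMul b a) (β_ k l).hom (β_ A B).hom := by
  have h : (β_ (𝟙_ V) (𝟙_ V)).hom = 𝟙 _ := by
    rw [braiding_tensorUnit_left, unitors_equal, Iso.hom_inv_id]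
  rw [ElementMap, elementMul, elementMul, Category.assoc, Category.assoc, dayη_braiding,
    BraidedCategory.braiding_naturality_assoc, h, Category.id_comp, Category.assoc, Category.assoc]

lemma ElementMap.swapFirst (a : 𝟙_ V ⟶ A.functor.obj (op k)) (b : 𝟙_ V ⟶ B.functor.obj (op l))
    (c : 𝟙_ V ⟶ C.functor.obj (op m)) : ElementMap (elementMul a (elementMul b c))
      (elementMul b (elementMul a c)) (swapFirst k l m) (swapFirst A B C) :=
  (ElementMap.associator a b c).symm.comp
    (((ElementMap.braiding a b).whiskerRight c).comp (ElementMap.associator b a c))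

end

/-- The powers of an element. -/
def elementPow (a : 𝟙_ V ⟶ A.functor.obj (op k)) :
    (n : ℕ) → (𝟙_ V ⟶ (tpow A n).functor.obj (op (tpow k n)))
  | 0 => dayν V
  | n + 1 => elementMul a (elementPow a n)

lemma ElementMap.insertAt (a : 𝟙_ V ⟶ A.functor.obj (op k)) (n : ℕ) (j : Fin (n + 1)) :
    ElementMap (elementPow a (n + 1)) (elementPow a (n + 1)) (insertAt k n j) (insertAt A n j) := by
  induction n with
  | zero => exact ElementMap.id _
  | succ n ih =>
    induction j using Fin.cases with
    | zero =>
      rw [insertAt_zero, insertAt_zero]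
      exact ElementMap.id _
    | succ j => exact (ElementMap.swapFirst a a _).comp ((ih j).whiskerLeft a)

/-- The morphisms that `powMap` is composed of, in `Λ` and in Day functors alike, carry products of
elements to products of elements. Thus the effect of a power map on `elementPow` can be read off in
`Λ`. -/
lemma ElementMap.powMap (a : 𝟙_ V ⟶ A.functor.obj (op k)) {z : 𝟙_ LambdaCat ⟶ k}
    {ζ : 𝟙_ (DayLambda V) ⟶ A} (h : ElementMap (dayν V) a z ζ) {m n : ℕ} (f : Fin m ↪ Fin n) :
    ElementMap (elementPow a m) (elementPow a n) (powMap z f) (powMap ζ f) := by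
  induction m generalizing n with
  | zero =>
    rw [_root_.powMap, _root_.powMap]
    clear f
    induction n with
    | zero => exact ElementMap.id _
    | succ n ih => exact (ElementMap.leftUnitor (dayν V)).symm.comp (h.tensor ih)
  | succ m ih =>
    obtain _ | n := n
    · exact (f 0).elim0
    rw [powMap_succ, powMap_succ]
    exact ((ih _).whiskerLeft a).comp (ElementMap.insertAt a n _)

end Elements

/-! ### Universal elements and their products. -/

noncomputable section Representing
open MonoidalCategory.DayFunctor

variable {V : Type u} [Category.{v} V] [MonoidalCategory V] [SymmetricCategory V] [HasColimits V]
  [∀ X : V, PreservesColimits (tensorLeft X)]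

lemma act_tensor_hom_ext {x : V} {A B Z : DayLambda V} {f g : act x (A ⊗ B) ⟶ Z}
    (h : ∀ k l, x ◁ dayη A B k l ≫ f.natTrans.app (op (k ⊗ l)) =
      x ◁ dayη A B k l ≫ g.natTrans.app (op (k ⊗ l))) : f = g :=
  day_ext fun n => tensorLevel_hom_ext (tensorLeft x) A B n fun k l w => by
    have h1 := day_hom_naturality f w
    have h2 := day_hom_naturality g w
    dsimp only at h1 h2
    change x ◁ (dayη A B k l ≫ (A ⊗ B).functor.map w.op) ≫ f.natTrans.app (op n) =
      x ◁ (dayη A B k l ≫ (A ⊗ B).functor.map w.op) ≫ g.natTrans.app (op n)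
    rw [MonoidalCategory.whiskerLeft_comp, Category.assoc, Category.assoc, h1, h2,
      reassoc_of% (h k l)]

lemma exists_act_tensor_desc {x : V} {A B Z : DayLambda V}
    (h : ∀ k l, x ⊗ A.functor.obj (op k) ⊗ B.functor.obj (op l) ⟶ Z.functor.obj (op (k ⊗ l)))
    (w : ∀ {k k' l l' : LambdaCat} (f : k ⟶ k') (g : l ⟶ l'),
      x ◁ (A.functor.map f.op ⊗ₘ B.functor.map g.op) ≫ h k l =
        h k' l' ≫ Z.functor.map (f ⊗ₘ g).op) :
    ∃ d : act x (A ⊗ B) ⟶ Z, ∀ k l, x ◁ dayη A B k l ≫ d.natTrans.app (op (k ⊗ l)) = h k l := by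
  have H (n : LambdaCat) : ∃ d : x ⊗ (A ⊗ B).functor.obj (op n) ⟶ Z.functor.obj (op n),
      ∀ k l (t : n ⟶ k ⊗ l), x ◁ (dayη A B k l ≫ (A ⊗ B).functor.map t.op) ≫ d =
        h k l ≫ Z.functor.map t.op := by
    refine exists_tensorLevel_desc (tensorLeft x) A B n (fun k l t => h k l ≫ Z.functor.map t.op)
      (fun {k k' l l'} f g t => ?_)
    refine (Category.assoc _ _ _).symm.trans ((congrArg (· ≫ _) (w f g)).trans ?_)
    rw [Category.assoc, op_comp, Functor.map_comp]
  choose d hd using H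
  refine ⟨⟨{ app := fun n => d n.unop, naturality := fun m n f => ?_ }⟩, fun k l => ?_⟩
  · refine tensorLevel_hom_ext (tensorLeft x) A B m.unop fun k l t => ?_
    have h1 := hd m.unop k l t
    have h2 := hd n.unop k l (f.unop ≫ t)
    change x ◁ (dayη A B k l ≫ (A ⊗ B).functor.map t.op) ≫ x ◁ (A ⊗ B).functor.map f ≫ d n.unop =
      x ◁ (dayη A B k l ≫ (A ⊗ B).functor.map t.op) ≫ d m.unop ≫ Z.functor.map f
    rw [reassoc_of% h1, ← MonoidalCategory.whiskerLeft_comp_assoc, Category.assoc]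
    rw [op_comp, Functor.map_comp, Functor.map_comp] at h2
    exact h2
  · have h1 := hd (k ⊗ l) k l (𝟙 _)
    rw [op_id, CategoryTheory.Functor.map_id, CategoryTheory.Functor.map_id, Category.comp_id,
      Category.comp_id] at h1
    exact h1

/-- The value of a morphism out of `x · A` on an element of `A`. -/
def evalAt {x : V} {A Z : DayLambda V} {k : LambdaCat} (a : 𝟙_ V ⟶ A.functor.obj (op k))
    (f : act x A ⟶ Z) : x ⟶ Z.functor.obj (op k) :=
  (ρ_ x).inv ≫ x ◁ a ≫ f.natTrans.app (op k)

lemma evalAt_actMap {x y : V} {A Z : DayLambda V} {k : LambdaCat} (a : 𝟙_ V ⟶ A.functor.obj (op k))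
    (g : x ⟶ y) (f : act y A ⟶ Z) : evalAt a (actMap g (𝟙 A) ≫ f) = g ≫ evalAt a f := by
  rw [evalAt, evalAt, day_comp_app, actMap_app, day_id_app, tensorHom_id,
    rightUnitor_inv_naturality_assoc, whisker_exchange_assoc]

lemma evalAt_comp {x : V} {A Z Z' : DayLambda V} {k : LambdaCat} (a : 𝟙_ V ⟶ A.functor.obj (op k))
    (f : act x A ⟶ Z) (g : Z ⟶ Z') : evalAt a (f ≫ g) = evalAt a f ≫ g.natTrans.app (op k) := by
  rw [evalAt, evalAt, day_comp_app, Category.assoc, Category.assoc]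

lemma evalAt_elementMap {x : V} {A B Z : DayLambda V} {k l : LambdaCat}
    {a : 𝟙_ V ⟶ A.functor.obj (op k)} {b : 𝟙_ V ⟶ B.functor.obj (op l)} {u : k ⟶ l} {φ : A ⟶ B}
    (h : ElementMap a b u φ) (f : act x B ⟶ Z) :
    evalAt a (actMap (𝟙 x) φ ≫ f) = evalAt b f ≫ Z.functor.map u.op := by
  have h1 := day_hom_naturality f u
  dsimp only at h1
  rw [ElementMap] at h
  rw [evalAt, evalAt, day_comp_app, actMap_app, id_tensorHom, Category.assoc, Category.assoc, ← h1,
    ← MonoidalCategory.whiskerLeft_comp_assoc, h, MonoidalCategory.whiskerLeft_comp_assoc]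

/-- The element `a` is universal: `x · A` represents the elements of degree `x` at level `k`. -/
def Represents {A : DayLambda V} {k : LambdaCat} (a : 𝟙_ V ⟶ A.functor.obj (op k)) : Prop :=
  ∀ (x : V) (Z : DayLambda V), Function.Bijective (evalAt a : (act x A ⟶ Z) → _)

variable (V) in
-- `I₀` is a Kan extension along the inclusion of `0`, so its level `n` is a colimit over the maps
-- `n ⟶ 0`, and a map out of it consists of restrictions of its value at `dayν`.
lemma represents_unit : Represents (dayν V) := fun x Z => by
  refine ⟨fun f g h => day_ext fun n => unitLevel_hom_ext (tensorLeft x) n fun w => ?_, fun z => ?_⟩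
  · have h1 := day_hom_naturality f w
    have h2 := day_hom_naturality g w
    have h3 : x ◁ dayν V ≫ f.natTrans.app (op (𝟙_ LambdaCat)) =
      x ◁ dayν V ≫ g.natTrans.app (op (𝟙_ LambdaCat)) := (cancel_epi _).1 h
    dsimp only at h1 h2
    change x ◁ (dayν V ≫ (𝟙_ (DayLambda V)).functor.map w.op) ≫ f.natTrans.app (op n) =
      x ◁ (dayν V ≫ (𝟙_ (DayLambda V)).functor.map w.op) ≫ g.natTrans.app (op n)
    rw [MonoidalCategory.whiskerLeft_comp, Category.assoc, Category.assoc, h1, h2, reassoc_of% h3]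
  · have H (n : LambdaCat) : ∃ d : x ⊗ (𝟙_ (DayLambda V)).functor.obj (op n) ⟶ Z.functor.obj (op n),
        ∀ t : n ⟶ 𝟙_ _, x ◁ (dayν V ≫ (𝟙_ (DayLambda V)).functor.map t.op) ≫ d =
          (ρ_ x).hom ≫ z ≫ Z.functor.map t.op :=
      exists_unitLevel_desc (tensorLeft x) n (fun t => (ρ_ x).hom ≫ z ≫ Z.functor.map t.op)
    choose d hd using H
    refine ⟨⟨{ app := fun n => d n.unop, naturality := fun m n f => ?_ }⟩, ?_⟩
    · refine unitLevel_hom_ext (tensorLeft x) m.unop fun t => ?_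
      have h1 := hd m.unop t
      have h2 := hd n.unop (f.unop ≫ t)
      change x ◁ (dayν V ≫ (𝟙_ (DayLambda V)).functor.map t.op) ≫
        x ◁ (𝟙_ (DayLambda V)).functor.map f ≫ d n.unop =
        x ◁ (dayν V ≫ (𝟙_ (DayLambda V)).functor.map t.op) ≫ d m.unop ≫ Z.functor.map f
      rw [reassoc_of% h1, ← MonoidalCategory.whiskerLeft_comp_assoc, Category.assoc]
      rw [op_comp, Functor.map_comp, Functor.map_comp] at h2
      exact h2
    · have h1 := hd (𝟙_ _) (𝟙 _)
      rw [op_id, CategoryTheory.Functor.map_id, CategoryTheory.Functor.map_id, Category.comp_id,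
        Category.comp_id] at h1
      exact (congrArg ((ρ_ x).inv ≫ ·) h1).trans (Iso.inv_hom_id_assoc _ _)

/-- The functor `p ↦ Z(p ∨ q)`. -/
@[reducible] def shiftRight (Z : DayLambda V) (q : LambdaCat) : DayLambda V :=
  ⟨{ obj := fun p => Z.functor.obj (op (p.unop ⊗ q))
     map := fun f => Z.functor.map (f.unop ▷ q).op
     map_id := fun p => by simp
     map_comp := fun f g => by simp }⟩

/-- The functor `q ↦ Z(p ∨ q)`. -/
@[reducible] def shiftLeft (Z : DayLambda V) (p : LambdaCat) : DayLambda V :=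
  ⟨{ obj := fun q => Z.functor.obj (op (p ⊗ q.unop))
     map := fun f => Z.functor.map (p ◁ f.unop).op
     map_id := fun p => by simp
     map_comp := fun f g => by simp }⟩

/-- Functoriality of `shiftRight`. -/
def shiftRightMap (Z : DayLambda V) {q q' : LambdaCat} (f : q ⟶ q') :
    shiftRight Z q' ⟶ shiftRight Z q :=
  ⟨{ app := fun p => Z.functor.map (p.unop ◁ f).op
     naturality := fun p p' g => by
      change Z.functor.map _ ≫ Z.functor.map _ = Z.functor.map _ ≫ Z.functor.map _
      rw [← Functor.map_comp, ← Functor.map_comp, ← op_comp, ← op_comp, whisker_exchange] }⟩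

lemma shiftRightMap_app (Z : DayLambda V) {q q' : LambdaCat} (f : q ⟶ q') (p : LambdaCat) :
    (shiftRightMap Z f).natTrans.app (op p) = Z.functor.map (p ◁ f).op := rfl

/-- A morphism out of `x · (A ⊠ B)`, restricted to the value of `B` at `q`. -/
def restrictLeft {x : V} {A B Z : DayLambda V} (f : act x (A ⊗ B) ⟶ Z) (q : LambdaCat) :
    act (x ⊗ B.functor.obj (op q)) A ⟶ shiftRight Z q :=
  ⟨{ app := fun p => (α_ _ _ _).hom ≫ x ◁ (β_ _ _).hom ≫ x ◁ dayη A B p.unop q ≫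
        f.natTrans.app (op (p.unop ⊗ q))
     naturality := fun p p' g => by
      have h1 := dayη_natural A B g.unop (𝟙 q)
      have h2 := day_hom_naturality f (g.unop ▷ q)
      dsimp only at h2
      rw [op_id, CategoryTheory.Functor.map_id, tensorHom_id, tensorHom_id] at h1
      change (x ⊗ B.functor.obj (op q)) ◁ A.functor.map g ≫ _ = _ ≫ Z.functor.map (g.unop ▷ q).op
      simp only [Category.assoc]
      have h3 : (x ⊗ B.functor.obj (op q)) ◁ A.functor.map g ≫ (α_ _ _ _).hom ≫ x ◁ (β_ _ _).hom =
          (α_ _ _ _).hom ≫ x ◁ (β_ _ _).hom ≫ x ◁ A.functor.map g ▷ B.functor.obj (op q) := by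
        rw [← MonoidalCategory.whiskerLeft_comp, ← BraidedCategory.braiding_naturality_right,
          MonoidalCategory.whiskerLeft_comp, associator_naturality_right_assoc]
      rw [← h2, ← MonoidalCategory.whiskerLeft_comp_assoc x (dayη _ _ _ _), ← h1,
        reassoc_of% h3, MonoidalCategory.whiskerLeft_comp_assoc]
      rfl }⟩

lemma restrictLeft_app {x : V} {A B Z : DayLambda V} (f : act x (A ⊗ B) ⟶ Z) (p q : LambdaCat) :
    (restrictLeft f q).natTrans.app (op p) = (α_ _ _ _).hom ≫ x ◁ (β_ _ _).hom ≫
      x ◁ dayη A B p q ≫ f.natTrans.app (op (p ⊗ q)) := rfl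

lemma restrictLeft_injective {x : V} {A B Z : DayLambda V} {f g : act x (A ⊗ B) ⟶ Z}
    (h : ∀ q, restrictLeft f q = restrictLeft g q) : f = g :=
  act_tensor_hom_ext fun p q => by
    have h1 := congrArg (fun t => t.natTrans.app (op p)) (h q)
    simpa only [restrictLeft_app, cancel_epi] using h1

/-- With `restrictLeft_injective` and `restrictLeft_natural`, this is currying for maps out of `x ·
(A ⊠ B)`: the object `B(q)` joins the coefficients. -/
lemma exists_restrictLeft {x : V} {A B Z : DayLambda V}
    (h : ∀ q, act (x ⊗ B.functor.obj (op q)) A ⟶ shiftRight Z q)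
    (w : ∀ {q q'} (g : q ⟶ q'), actMap (x ◁ B.functor.map g.op) (𝟙 A) ≫ h q =
      h q' ≫ shiftRightMap Z g) :
    ∃ f : act x (A ⊗ B) ⟶ Z, ∀ q, restrictLeft f q = h q := by
  obtain ⟨d, hd⟩ := exists_act_tensor_desc (x := x) (A := A) (B := B) (Z := Z)
    (fun p q => x ◁ (β_ _ _).hom ≫ (α_ _ _ _).inv ≫ (h q).natTrans.app (op p))
    (fun {p p' q q'} f g => by
      have h1 := congrArg (fun t => t.natTrans.app (op p)) (w g)
      have h2 := day_hom_naturality (h q') f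
      simp only [day_comp_app, actMap_app, day_id_app, tensorHom_id, shiftRightMap_app] at h1
      dsimp only at h1 h2
      simp only [Quiver.Hom.unop_op] at h2
      simp only [Category.assoc]
      have h3 : x ◁ (A.functor.map f.op ⊗ₘ B.functor.map g.op) ≫ x ◁ (β_ _ _).hom ≫ (α_ _ _ _).inv =
          x ◁ (β_ _ _).hom ≫ (α_ _ _ _).inv ≫ (x ⊗ B.functor.obj (op q')) ◁ A.functor.map f.op ≫
            (x ◁ B.functor.map g.op) ▷ A.functor.obj (op p) := by
        rw [← MonoidalCategory.whiskerLeft_comp_assoc, BraidedCategory.braiding_naturality,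
          MonoidalCategory.tensorHom_def', MonoidalCategory.whiskerLeft_comp,
          MonoidalCategory.whiskerLeft_comp, Category.assoc, Category.assoc,
          associator_inv_naturality_middle, associator_inv_naturality_right_assoc]
      have e : f ⊗ₘ g = p ◁ g ≫ f ▷ q' := MonoidalCategory.tensorHom_def' f g
      rw [e, op_comp, Functor.map_comp, ← reassoc_of% h2, ← h1, reassoc_of% h3])
  refine ⟨d, fun q => day_ext fun p => ?_⟩
  rw [restrictLeft_app, hd, ← MonoidalCategory.whiskerLeft_comp_assoc, SymmetricCategory.symmetry,
    MonoidalCategory.whiskerLeft_id, Category.id_comp, Iso.hom_inv_id_assoc]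

lemma restrictLeft_natural {x : V} {A B Z : DayLambda V} (f : act x (A ⊗ B) ⟶ Z) {q q' : LambdaCat}
    (g : q ⟶ q') : actMap (x ◁ B.functor.map g.op) (𝟙 A) ≫ restrictLeft f q =
      restrictLeft f q' ≫ shiftRightMap Z g :=
  day_ext fun p => by
    have h1 := dayη_natural A B (𝟙 p) g
    have h2 := day_hom_naturality f (p ◁ g)
    dsimp only at h2
    rw [op_id, CategoryTheory.Functor.map_id, id_tensorHom, id_tensorHom] at h1
    have h3 : (x ◁ B.functor.map g.op) ▷ A.functor.obj (op p) ≫ (α_ _ _ _).hom ≫ x ◁ (β_ _ _).hom =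
        (α_ _ _ _).hom ≫ x ◁ (β_ _ _).hom ≫ x ◁ A.functor.obj (op p) ◁ B.functor.map g.op := by
      rw [← MonoidalCategory.whiskerLeft_comp, ← BraidedCategory.braiding_naturality_left,
        MonoidalCategory.whiskerLeft_comp, associator_naturality_middle_assoc]
    simp only [day_comp_app, actMap_app, day_id_app, tensorHom_id, shiftRightMap_app,
      restrictLeft_app, Category.assoc]
    rw [reassoc_of% h3, ← h2, ← MonoidalCategory.whiskerLeft_comp_assoc x (_ ◁ _), h1,
      MonoidalCategory.whiskerLeft_comp_assoc]

lemma exists_evalLeft {x : V} {A B Z : DayLambda V} {k : LambdaCat}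
    (a : 𝟙_ V ⟶ A.functor.obj (op k))
    (h : ∀ q : LambdaCat, act (x ⊗ B.functor.obj (op q)) A ⟶ shiftRight Z q)
    (w : ∀ {q q' : LambdaCat} (g : q ⟶ q'), actMap (x ◁ B.functor.map g.op) (𝟙 A) ≫ h q =
      h q' ≫ shiftRightMap Z g) :
    ∃ e : act x B ⟶ shiftLeft Z k, ∀ q, e.natTrans.app (op q) = evalAt a (h q) := by
  let e (q : LambdaCatᵒᵖ) : (act x B).functor.obj q ⟶ (shiftLeft Z k).functor.obj q :=
    (evalAt a (h q.unop) :)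
  refine ⟨⟨{ app := e, naturality := fun q q' g => ?_ }⟩, fun _ => rfl⟩
  change x ◁ B.functor.map g.unop.op ≫ evalAt a (h q'.unop) =
    evalAt a (h q.unop) ≫ Z.functor.map (k ◁ g.unop).op
  rw [← evalAt_actMap, w, evalAt_comp, shiftRightMap_app]

lemma evalAt_elementMul {x : V} {A B Z : DayLambda V} {k l : LambdaCat}
    (a : 𝟙_ V ⟶ A.functor.obj (op k)) (b : 𝟙_ V ⟶ B.functor.obj (op l)) (f : act x (A ⊗ B) ⟶ Z)
    (e : act x B ⟶ shiftLeft Z k)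
    (he : ∀ q, e.natTrans.app (op q) = evalAt a (restrictLeft f q)) :
    evalAt b e = evalAt (elementMul a b) f := by
  have h1 : b ≫ (ρ_ _).inv ≫ B.functor.obj (op l) ◁ a ≫ (β_ _ _).hom =
      (λ_ (𝟙_ V)).inv ≫ (a ⊗ₘ b) := by
    rw [BraidedCategory.braiding_naturality_right, rightUnitor_inv_braiding_assoc,
      leftUnitor_inv_naturality_assoc, MonoidalCategory.tensorHom_def']
  rw [evalAt, he, evalAt, restrictLeft_app, evalAt, elementMul, associator_naturality_right_assoc,
    rightUnitor_tensor_inv, Category.assoc, Iso.inv_hom_id_assoc]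
  have h2 := congrArg (fun t => x ◁ (t ≫ dayη A B k l)) h1
  simp only [Category.assoc, MonoidalCategory.whiskerLeft_comp] at h2 ⊢
  rw [← reassoc_of% h2]

/-- Currying turns maps `x · (A ⊠ B) ⟶ Z` into natural families `(x ⊗ B(q)) · A ⟶ Z(- ∨ q)`, then by
`ha` into natural maps `x ⊗ B(q) ⟶ Z(k ∨ q)`, then by `hb` into maps `x ⟶ Z(k ∨ l)`. Coefficients
and target change on the way, which is why `Represents` quantifies over both. -/
lemma Represents.tensor {A B : DayLambda V} {k l : LambdaCat} {a : 𝟙_ V ⟶ A.functor.obj (op k)}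
    {b : 𝟙_ V ⟶ B.functor.obj (op l)} (ha : Represents a) (hb : Represents b) :
    Represents (elementMul a b) := fun x Z => by
  refine ⟨fun f g h => restrictLeft_injective fun q => (ha _ _).1 ?_, fun z => ?_⟩
  · obtain ⟨e, he⟩ := exists_evalLeft a (restrictLeft f) (restrictLeft_natural f)
    obtain ⟨e', he'⟩ := exists_evalLeft a (restrictLeft g) (restrictLeft_natural g)
    obtain rfl : e = e' := (hb _ _).1 (by
      rw [evalAt_elementMul a b f e he, evalAt_elementMul a b g e' he', h])
    rw [← he, ← he']
  · obtain ⟨e, he⟩ := (hb x (shiftLeft Z k)).2 z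
    have H (q : LambdaCat) := (ha (x ⊗ B.functor.obj (op q)) (shiftRight Z q)).2
      (e.natTrans.app (op q))
    choose h hh using H
    obtain ⟨f, hf⟩ := exists_restrictLeft h (fun {q q'} g => (ha _ _).1 (by
      rw [evalAt_actMap, evalAt_comp, hh, hh]
      exact day_hom_naturality e g))
    refine ⟨f, ?_⟩
    rw [← evalAt_elementMul a b f e (fun q => by rw [hf, hh]), he]

lemma Represents.pow {A : DayLambda V} {k : LambdaCat} {a : 𝟙_ V ⟶ A.functor.obj (op k)}
    (ha : Represents a) (n : ℕ) : Represents (elementPow a n) := by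
  induction n with
  | zero => exact represents_unit V
  | succ n ih => exact ha.tensor ih

lemma Represents.map_iso {A : DayLambda V} {k l : LambdaCat} {a : 𝟙_ V ⟶ A.functor.obj (op k)}
    (ha : Represents a) (u : l ≅ k) : Represents (a ≫ A.functor.map u.hom.op) := fun x Z => by
  have h : (evalAt (a ≫ A.functor.map u.hom.op) : (act x A ⟶ Z) → _) =
      (fun t => t ≫ Z.functor.map u.hom.op) ∘ evalAt a := funext fun f => by
    have h1 := day_hom_naturality f u.hom
    dsimp only at h1
    rw [Function.comp_apply, evalAt, evalAt, MonoidalCategory.whiskerLeft_comp_assoc, h1,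
      Category.assoc, Category.assoc]
  rw [h]
  refine Function.Bijective.comp ⟨fun s t hst => (cancel_mono _).1 hst, fun t =>
    ⟨t ≫ Z.functor.map u.inv.op, ?_⟩⟩ (ha x Z)
  dsimp only
  rw [Category.assoc, ← Functor.map_comp, ← op_comp, Iso.hom_inv_id, op_id,
    CategoryTheory.Functor.map_id, Category.comp_id]

end Representing

/-! ### The unit isomorphisms for `I₁`. -/

noncomputable section KellyUnits
open MonoidalCategory.DayFunctor Functor.LaxMonoidal

variable {V : Type u} [Category.{v} V] [MonoidalCategory V] [SymmetricCategory V] [HasColimits V]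
  [∀ X : V, PreservesColimits (tensorLeft X)]

variable (V) in
/-- The identity of the unit of `V` as an element of `I₁` at level `1`. -/
def elementI1 : 𝟙_ V ⟶ (dayObj (I1 V)).functor.obj (op ⟨1⟩) := 𝟙 (𝟙_ V)

instance (n : LambdaCat) : Subsingleton ((⟨0⟩ : LambdaCat) ⟶ n) :=
  ⟨fun _ _ => DFunLike.ext (F := Fin 0 ↪ Fin n.card) _ _ fun i => i.elim0⟩

instance : Subsingleton ((⟨1⟩ : LambdaCat) ⟶ ⟨1⟩) :=
  ⟨fun _ _ => DFunLike.ext (F := Fin 1 ↪ Fin 1) _ _ fun _ => Subsingleton.elim _ _⟩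

/-- A tensor product with the initial object is initial. -/
def isInitialTensor (x : V) : IsInitial (x ⊗ ⊥_ V) :=
  (initialIsInitial (C := V)).isInitialObj (tensorLeft x) _

/-- A tensor product with the initial object is initial. -/
def isInitialTensor' (x : V) : IsInitial ((⊥_ V) ⊗ x) :=
  (isInitialTensor x).ofIso (β_ _ _)

variable (V) in
-- `I₁` is `Λ(-, 1)` with coefficients in `I`: there is one map to `1` from each of `0` and `1`, and
-- none from larger sets.
lemma represents_I1 : Represents (elementI1 V) := fun x Z => by
  have ev (f : act x (dayObj (I1 V)) ⟶ Z) : evalAt (elementI1 V) f =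
      (ρ_ x).inv ≫ f.natTrans.app (op ⟨1⟩) := by
    exact congrArg ((ρ_ x).inv ≫ ·) ((congrArg (· ≫ f.natTrans.app (op ⟨1⟩))
      (MonoidalCategory.whiskerLeft_id x (𝟙_ V))).trans (Category.id_comp _))
  -- As `0 ⟶ 1` induces the identity of `I`, level `0` is determined by level `1`.
  have lev0 (f : act x (dayObj (I1 V)) ⟶ Z) : f.natTrans.app (op ⟨0⟩) =
      f.natTrans.app (op ⟨1⟩) ≫ Z.functor.map LambdaCat.zeroOne.op := by
    rw [← day_hom_naturality]
    refine ((congrArg (· ≫ _) (MonoidalCategory.whiskerLeft_id x (𝟙_ V))).trans ?_).symm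
    exact Category.id_comp _
  refine ⟨fun f g h => day_ext fun n => ?_, fun z => ?_⟩
  · rw [ev, ev] at h
    replace h : f.natTrans.app (op ⟨1⟩) = g.natTrans.app (op ⟨1⟩) := (cancel_epi (ρ_ x).inv).1 h
    obtain ⟨_ | _ | n⟩ := n
    · rw [lev0, lev0, h]
    · exact h
    · exact (isInitialTensor x).hom_ext _ _
  · let t : ∀ n : ℕ, x ⊗ I1Obj V n ⟶ Z.functor.obj (op ⟨n⟩)
      | 0 => (ρ_ x).hom ≫ z ≫ Z.functor.map LambdaCat.zeroOne.op
      | 1 => (ρ_ x).hom ≫ z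
      | _ + 2 => (isInitialTensor x).to _
    have ht {k l : ℕ} (f : (⟨k⟩ : LambdaCat) ⟶ ⟨l⟩) :
        x ◁ (I1 V).right.map f.op ≫ t k = t l ≫ Z.functor.map f.op := by
      obtain _ | _ | l := l
      · obtain rfl : k = 0 := Nat.le_zero.1 (card_le f)
        obtain rfl : f = 𝟙 _ := Subsingleton.elim _ _
        rw [op_id, CategoryTheory.Functor.map_id, CategoryTheory.Functor.map_id, Category.comp_id]
        exact (congrArg (· ≫ _) (MonoidalCategory.whiskerLeft_id x _)).trans (Category.id_comp _)
      · obtain rfl | rfl : k = 0 ∨ k = 1 := Nat.le_one_iff_eq_zero_or_eq_one.1 (card_le f)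
        · obtain rfl : f = LambdaCat.zeroOne := Subsingleton.elim _ _
          refine (congrArg (· ≫ _) (MonoidalCategory.whiskerLeft_id x (𝟙_ V))).trans ?_
          exact (Category.id_comp _).trans (Category.assoc _ _ _).symm
        · obtain rfl : f = 𝟙 _ := Subsingleton.elim (α := (⟨1⟩ : LambdaCat) ⟶ ⟨1⟩) _ _
          rw [op_id, CategoryTheory.Functor.map_id, CategoryTheory.Functor.map_id, Category.comp_id]
          exact (congrArg (· ≫ _) (MonoidalCategory.whiskerLeft_id x _)).trans (Category.id_comp _)
      · exact (isInitialTensor x).hom_ext _ _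
    refine ⟨⟨{ app := fun n => t n.unop.card, naturality := fun m n f => ht f.unop }⟩, ?_⟩
    rw [ev]
    exact Iso.inv_hom_id_assoc _ _

variable (V) in
lemma elementMap_I1 : ElementMap (dayν V) (elementI1 V) LambdaCat.zeroOne (dayBase (I1 V)) :=
  (dayν_dayBase (I1 V)).trans (Category.comp_id (𝟙 (𝟙_ V))).symm

lemma ElementMap.restrict {A : DayLambda V} {k l : LambdaCat} (a : 𝟙_ V ⟶ A.functor.obj (op k))
    (u : l ⟶ k) : ElementMap (a ≫ A.functor.map u.op) a u (𝟙 A) :=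
  Category.comp_id _

variable (V) in
/-- The universal element of the `k`-th power of `I₁` at level `k`. -/
def elementI1Pow (k : LambdaCat) : 𝟙_ V ⟶ ((pw (I1 V)).obj k).functor.obj (op k) :=
  elementPow (elementI1 V) k.card ≫
    (tpow (dayObj (I1 V)) k.card).functor.map (LambdaCat.isoPow k).hom.op

lemma represents_elementI1Pow (k : LambdaCat) : Represents (elementI1Pow V k) :=
  ((represents_I1 V).pow k.card).map_iso (LambdaCat.isoPow k)

/-- By `isoPow_natural`, the transport along `isoPow` turns `ElementMap.powMap` into naturality
along `f` itself. -/
lemma elementI1Pow_natural {k l : LambdaCat} (f : k ⟶ l) :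
    ElementMap (elementI1Pow V k) (elementI1Pow V l) f ((pw (I1 V)).map f) := by
  have h1 := ElementMap.powMap (elementI1 V) (elementMap_I1 V) (LambdaCat.inj f)
  have h2 := ElementMap.restrict (elementPow (elementI1 V) k.card) (LambdaCat.isoPow k).hom
  have h3 := ElementMap.symm (φ := Iso.refl _)
    (ElementMap.restrict (elementPow (elementI1 V) l.card) (LambdaCat.isoPow l).hom)
  have h4 := h2.comp (h1.comp h3)
  rw [reassoc_of% (LambdaCat.isoPow_natural f), Iso.hom_inv_id, Category.comp_id, Category.id_comp,
    Iso.refl_inv, Category.comp_id] at h4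
  exact h4

variable (V) in
lemma elementI1Pow_zero : elementI1Pow V ⟨0⟩ = dayν V := by
  have h : (LambdaCat.isoPow ⟨0⟩).hom = 𝟙 _ := Subsingleton.elim _ _
  refine (congrArg (fun t => dayν V ≫ (𝟙_ (DayLambda V)).functor.map (Quiver.Hom.op t)) h).trans ?_
  refine (congrArg (dayν V ≫ ·) ((𝟙_ (DayLambda V)).functor.map_id _)).trans (Category.comp_id _)

lemma evalAt_phiι_natural (X : DayLambda V) {k l : LambdaCat} (f : k ⟶ l) :
    X.functor.map f.op ≫ evalAt (elementI1Pow V k) (phiι X (pw (I1 V)) k) =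
      evalAt (elementI1Pow V l) (phiι X (pw (I1 V)) l) ≫ (phi X (pw (I1 V))).functor.map f.op := by
  rw [← evalAt_actMap, phiι_condition, evalAt_elementMap (elementI1Pow_natural f)]

/-- The inverse of the right unit isomorphism. -/
def kellyRight (X : DayLambda V) : X ⟶ phi X (pw (I1 V)) :=
  ⟨{ app := fun k => (evalAt (elementI1Pow V k.unop) (phiι X (pw (I1 V)) k.unop) :)
     naturality := fun _ _ f => evalAt_phiι_natural X f.unop }⟩

lemma kellyRight_app (X : DayLambda V) (k : LambdaCat) : (kellyRight X).natTrans.app (op k) =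
    evalAt (elementI1Pow V k) (phiι X (pw (I1 V)) k) := rfl

/-- Co-Yoneda: as `I₁^{⊠k}` represents level `k`, the identity of `X(k)` corresponds to a map `X(k)
· I₁^{⊠k} ⟶ X`, and these maps are the components of the inverse. -/
instance isIso_kellyRight (X : DayLambda V) : IsIso (kellyRight X) := by
  have H (k : LambdaCat) := (represents_elementI1Pow k _ X).2 (𝟙 (X.functor.obj (op k)))
  choose p hp using H
  obtain ⟨d, hd⟩ := exists_phi_desc' (X := X) (G := pw (I1 V)) p (fun {k l} f =>
    (represents_elementI1Pow k _ X).1 (by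
      rw [evalAt_actMap, evalAt_elementMap (elementI1Pow_natural f), hp, hp, Category.comp_id,
        Category.id_comp]))
  refine ⟨d, day_ext fun k => ?_, phi_hom_ext' fun k => (represents_elementI1Pow k _ _).1 ?_⟩
  · rw [day_comp_app, kellyRight_app, ← evalAt_comp, hd, hp, day_id_app]
  · rw [reassoc_of% hd, evalAt_comp, hp, Category.id_comp, kellyRight_app, Category.comp_id]

lemma kellyRight_natural {X Y : DayLambda V} (f : X ⟶ Y) :
    f ≫ kellyRight Y = kellyRight X ≫ phiMap f (pw (I1 V)) :=
  day_ext fun k => by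
    rw [day_comp_app, day_comp_app, kellyRight_app, kellyRight_app, ← evalAt_comp, phiι_map,
      evalAt_actMap]

lemma kellyRight_base (D : LambdaSeq V) :
    dayBase D ≫ kellyRight (dayObj D) = dayBase (ke D (I1 V)) := by
  refine (dayBase_eq (ke D (I1 V)) (dayBase D ≫ kellyRight (dayObj D)) ?_).symm
  refine (congrArg (dayν V ≫ ·) (day_comp_app _ _ _)).trans ?_
  rw [← Category.assoc, dayν_dayBase, kellyRight_app, evalAt]
  change D.hom ≫ (ρ_ _).inv ≫ D.right.obj (op ⟨0⟩) ◁ elementI1Pow V ⟨0⟩ ≫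
    tensorOverι V D.right (((dayPow V).obj (I1 V)).flip.obj (op ⟨0⟩)) ⟨0⟩ = _
  rw [elementI1Pow_zero]
  rfl

lemma act_initial_hom_ext {A Z : DayLambda V} (f g : act (⊥_ V) A ⟶ Z) : f = g :=
  day_ext fun _ => (isInitialTensor' _).hom_ext _ _

/-- The component at level `0` of a coend with `I₁`. -/
def phiI1₀ (G : LambdaCat ⥤ DayLambda V) : G.obj ⟨0⟩ ⟶ phi (dayObj (I1 V)) G :=
  actUnit (G.obj ⟨0⟩) ≫ phiι (dayObj (I1 V)) G ⟨0⟩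

/-- The component at level `1` of a coend with `I₁`. -/
def phiI1 (G : LambdaCat ⥤ DayLambda V) : G.obj ⟨1⟩ ⟶ phi (dayObj (I1 V)) G :=
  actUnit (G.obj ⟨1⟩) ≫ phiι (dayObj (I1 V)) G ⟨1⟩

lemma map_phiI1 (G : LambdaCat ⥤ DayLambda V) (f : (⟨0⟩ : LambdaCat) ⟶ ⟨1⟩) :
    G.map f ≫ phiI1 G = phiI1₀ G := by
  have h1 : actMap (𝟙 (𝟙_ V)) (𝟙 (G.obj ⟨0⟩)) ≫ phiι (dayObj (I1 V)) G ⟨0⟩ =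
      actMap (𝟙 (𝟙_ V)) (G.map f) ≫ phiι (dayObj (I1 V)) G ⟨1⟩ :=
    phiι_condition (dayObj (I1 V)) G f
  have h2 := actUnit_natural (G.map f)
  rw [actMap_id] at h1
  refine (Category.assoc _ _ _).symm.trans ((congrArg (· ≫ phiι (dayObj (I1 V)) G ⟨1⟩) h2).trans ?_)
  refine (Category.assoc _ _ _).trans ?_
  exact (congrArg (actUnit (G.obj ⟨0⟩) ≫ ·) (h1.symm.trans (Category.id_comp _)))

/-- A morphism out of a coend with `I₁` is determined by its component at level `1`. -/
lemma phi_I1_hom_ext {G : LambdaCat ⥤ DayLambda V} {Z : DayLambda V}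
    {f g : phi (dayObj (I1 V)) G ⟶ Z} (h : phiI1 G ≫ f = phiI1 G ≫ g) : f = g :=
  phi_hom_ext' fun k => by
    obtain ⟨_ | _ | k⟩ := k
    · have h1 : phiI1₀ G ≫ f = phiI1₀ G ≫ g := by
        rw [← map_phiI1 G LambdaCat.zeroOne, Category.assoc, Category.assoc, h]
      exact (cancel_epi (actUnit (G.obj ⟨0⟩))).1
        ((Category.assoc _ _ _).symm.trans (h1.trans (Category.assoc _ _ _)))
    · exact (cancel_epi (actUnit (G.obj ⟨1⟩))).1
        ((Category.assoc _ _ _).symm.trans (h.trans (Category.assoc _ _ _)))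
    · exact act_initial_hom_ext _ _

/-- The component at `1` is the given map, the one at `0` is forced by `0 ⟶ 1`, and above `1` the
values of `I₁` are initial. So the coend with `I₁` is `G(1)`. -/
lemma exists_phi_I1_desc {G : LambdaCat ⥤ DayLambda V} {Z : DayLambda V} (h : G.obj ⟨1⟩ ⟶ Z) :
    ∃ d : phi (dayObj (I1 V)) G ⟶ Z, phiI1 G ≫ d = h := by
  let z : (⟨0⟩ : LambdaCat) ⟶ ⟨1⟩ := LambdaCat.zeroOne
  let t : ∀ n : ℕ, act (I1Obj V n) (G.obj ⟨n⟩) ⟶ Z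
    | 0 => inv (actUnit _) ≫ G.map z ≫ h
    | 1 => inv (actUnit _) ≫ h
    | _ + 2 => ⟨{ app := fun _ => (isInitialTensor' _).to _
                  naturality := fun _ _ _ => (isInitialTensor' _).hom_ext _ _ }⟩
  have ht {k l : ℕ} (f : (⟨k⟩ : LambdaCat) ⟶ ⟨l⟩) :
      actMap ((dayObj (I1 V)).functor.map f.op) (𝟙 (G.obj ⟨k⟩)) ≫ t k =
        actMap (𝟙 (I1Obj V l)) (G.map f) ≫ t l := by
    obtain _ | _ | l := l
    · obtain rfl : k = 0 := Nat.le_zero.1 (card_le f)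
      obtain rfl : f = 𝟙 _ := Subsingleton.elim _ _
      rw [CategoryTheory.Functor.map_id]
      rfl
    · obtain rfl | rfl : k = 0 ∨ k = 1 := Nat.le_one_iff_eq_zero_or_eq_one.1 (card_le f)
      · obtain rfl : f = z := Subsingleton.elim _ _
        have h1 := actUnit_natural (G.map z)
        change actMap (𝟙 (𝟙_ V)) (𝟙 (G.obj ⟨0⟩)) ≫ inv (actUnit _) ≫ G.map z ≫ h =
          actMap (𝟙 (𝟙_ V)) (G.map z) ≫ inv (actUnit _) ≫ h
        rw [actMap_id, Category.id_comp, IsIso.inv_comp_eq, ← reassoc_of% h1, IsIso.hom_inv_id_assoc]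
      · obtain rfl : f = 𝟙 _ := Subsingleton.elim (α := (⟨1⟩ : LambdaCat) ⟶ ⟨1⟩) _ _
        rw [CategoryTheory.Functor.map_id]
        rfl
    · exact act_initial_hom_ext _ _
  obtain ⟨d, hd⟩ := exists_phi_desc' (X := dayObj (I1 V)) (G := G) (Z := Z) (fun k => t k.card)
    (fun {k l} f => ht f)
  exact ⟨d, (Category.assoc _ _ _).trans ((congrArg (actUnit (G.obj ⟨1⟩) ≫ ·) (hd ⟨1⟩)).trans
    (IsIso.hom_inv_id_assoc _ _))⟩

lemma phiI1_mapRight {G H : LambdaCat ⥤ DayLambda V} (g : G ⟶ H) :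
    phiI1 G ≫ phiMapRight (dayObj (I1 V)) g = g.app ⟨1⟩ ≫ phiI1 H := by
  have h1 := actUnit_natural (g.app ⟨1⟩)
  have h2 := phiι_mapRight (dayObj (I1 V)) g ⟨1⟩
  refine (Category.assoc _ _ _).trans ((congrArg (actUnit (G.obj ⟨1⟩) ≫ ·) h2).trans ?_)
  exact (Category.assoc _ _ _).symm.trans ((congrArg (· ≫ phiι (dayObj (I1 V)) H ⟨1⟩) h1).symm.trans
    (Category.assoc _ _ _))

/-- The first power. -/
def pwOne (E : LambdaSeq V) : dayObj E ≅ (pw E).obj ⟨1⟩ := (ρ_ (dayObj E)).symm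

lemma pwOne_natural {E F : LambdaSeq V} (φ : E ⟶ F) :
    dayMap φ ≫ (pwOne F).hom = (pwOne E).hom ≫ (pwMap φ).app ⟨1⟩ :=
  (rightUnitor_inv_naturality (dayMap φ)).trans
    (congrArg ((ρ_ (dayObj E)).inv ≫ ·) (tensorHom_id (dayMap φ) (𝟙_ (DayLambda V))).symm)

lemma dayBase_pwOne (E : LambdaSeq V) (f : (⟨0⟩ : LambdaCat) ⟶ ⟨1⟩) :
    dayBase E ≫ (pwOne E).hom = (pw E).map f := by
  have h : (pw E).map f = (λ_ (𝟙_ (DayLambda V))).inv ≫ (dayBase E ⊗ₘ 𝟙 (𝟙_ (DayLambda V))) :=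
    powMap.eq_1 (dayBase E) 1 f
  rw [h, tensorHom_id, unitors_inv_equal]
  exact rightUnitor_inv_naturality (dayBase E)

/-- The inverse of the left unit isomorphism. -/
def kellyLeft (E : LambdaSeq V) : dayObj E ⟶ phi (dayObj (I1 V)) (pw E) :=
  (pwOne E).hom ≫ phiI1 (pw E)

lemma isIso_phiI1 (G : LambdaCat ⥤ DayLambda V) : IsIso (phiI1 G) := by
  obtain ⟨d, hd⟩ := exists_phi_I1_desc (G := G) (𝟙 _)
  exact ⟨d, hd, phi_I1_hom_ext (by rw [reassoc_of% hd, Category.comp_id])⟩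

instance isIso_kellyLeft (E : LambdaSeq V) : IsIso (kellyLeft E) :=
  @IsIso.comp_isIso _ _ _ _ _ _ _ inferInstance (isIso_phiI1 _)

lemma kellyLeft_natural {E F : LambdaSeq V} (φ : E ⟶ F) :
    dayMap φ ≫ kellyLeft F = kellyLeft E ≫ phiMapRight (dayObj (I1 V)) (pwMap φ) := by
  have h1 := pwOne_natural φ
  rw [kellyLeft, kellyLeft, reassoc_of% h1, Category.assoc, phiI1_mapRight]

lemma kellyLeft_base (E : LambdaSeq V) : dayBase E ≫ kellyLeft E = dayBase (ke (I1 V) E) := by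
  have h1 := dayBase_pwOne E LambdaCat.zeroOne
  have h2 : phiI1₀ (pw E) = phiε (pw E) ≫ phiMap (dayBase (I1 V)) (pw E) := by
    rw [phiε, Category.assoc, phiEl_phiMap, dayν_dayBase]
    refine congrArg (actUnit (𝟙_ (DayLambda V)) ≫ ·) ?_
    exact ((congrArg (· ≫ phiι (dayObj (I1 V)) (pw E) ⟨0⟩) (actMap_id (𝟙_ V) _)).trans
      (Category.id_comp _)).symm
  rw [kellyLeft, reassoc_of% h1]
  exact (map_phiI1 (pw E) _).trans (h2.trans (dayBase_kelly (I1 V) E).symm)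

end KellyUnits

/-! ### The monoidal structure of the Kelly product. -/

section KellyMonoidal
variable (V : Type u) [Category.{v} V] [MonoidalCategory V] [SymmetricCategory V] [HasColimits V]
  [∀ X : V, PreservesColimits (tensorLeft X)]

lemma iso_comm_of_inv {C : Type*} [Category C] {A A' B B' : C} (i : A ≅ B) (i' : A' ≅ B') {x : A ⟶ A'}
    {y : B ⟶ B'} (h : y ≫ i'.inv = i.inv ≫ x) : x ≫ i'.hom = i.hom ≫ y := by
  rw [← Iso.inv_comp_eq, ← Category.assoc, ← h, Category.assoc, Iso.inv_hom_id, Category.comp_id]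

lemma kellyAssociator_pentagon (X Y Z T : LambdaSeq V) :
    ((kelly V).map (kellyAssociator X Y Z).hom).app T ≫ (kellyAssociator X (ke Y Z) T).hom ≫
        ((kelly V).obj X).map (kellyAssociator Y Z T).hom =
      (kellyAssociator (ke X Y) Z T).hom ≫ (kellyAssociator X Y (ke Z T)).hom := by
  let i : ke (ke (ke X Y) Z) T ≅ ke X (ke Y (ke Z T)) :=
    ((kelly V).mapIso (kellyAssociator X Y Z)).app T ≪≫ kellyAssociator X (ke Y Z) T ≪≫
      ((kelly V).obj X).mapIso (kellyAssociator Y Z T)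
  let j : ke (ke (ke X Y) Z) T ≅ ke X (ke Y (ke Z T)) :=
    kellyAssociator (ke X Y) Z T ≪≫ kellyAssociator X Y (ke Z T)
  -- `kellyAssoc` is the inverse of the associativity isomorphism, so its pentagon is an equation
  -- between inverses.
  have h : i.inv = j.inv := lambda_hom_ext
    ((Category.assoc _ _ _).trans (kellyAssoc_pentagon (dayObj X) Y Z T).symm)
  have h2 : i = j := Iso.ext_inv h
  exact congrArg Iso.hom h2

/-- `kellyLeft` and `kellyRight` enter only as natural isomorphisms, and the unit isomorphisms of
`S` need not be their inverses. Hence only the associativity isomorphism is recorded for later use.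
-/
theorem exists_kelly_monoidalOn :
    ∃ S : MonoidalOn (kelly V) (I1 V), S.associator = kellyAssociator := by
  refine exists_monoidalOn kellyAssociator
    (fun f Y Z => iso_comm_of_inv _ _ (lambda_hom_ext (kellyAssoc_natural (dayMap f) Y Z)))
    (fun X _ _ f Z => iso_comm_of_inv _ _ (lambda_hom_ext (kellyAssoc_natural_middle (dayObj X) f Z)))
    (fun X Y _ _ f => iso_comm_of_inv _ _ (lambda_hom_ext (kellyAssoc_natural_right (dayObj X) Y f)))
    (kellyAssociator_pentagon V) ?_ ?_
  · exact (NatIso.ofComponents (fun E => lambdaIso (D := E) (E := ke (I1 V) E) (kellyLeft E)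
      (kellyLeft_base E) (isIso_kellyLeft E)) (fun φ => lambda_hom_ext (kellyLeft_natural φ))).symm
  · exact (NatIso.ofComponents (fun D => lambdaIso (D := D) (E := ke D (I1 V)) (kellyRight (dayObj D))
      (kellyRight_base D) (isIso_kellyRight _))
      (fun φ => lambda_hom_ext (kellyRight_natural (dayMap φ)))).symm

end KellyMonoidal

/-! ### Unital `Λ`-sequences are closed under the Kelly product. -/

noncomputable section Unital
open MonoidalCategory.DayFunctor Functor.LaxMonoidal

lemma LambdaCat.hom_ext_of_card_eq_zero {m n : LambdaCat} (h : m.card = 0) (f g : m ⟶ n) : f = g := by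
  obtain ⟨m⟩ := m
  obtain rfl : m = 0 := h
  exact Subsingleton.elim _ _

/-- The inclusion of the base point. -/
def LambdaCat.fromZero (n : LambdaCat) : 𝟙_ LambdaCat ⟶ n :=
  (⟨Fin.elim0, fun i => i.elim0⟩ : Fin 0 ↪ Fin n.card)

variable {V : Type u} [Category.{v} V] [MonoidalCategory V] [SymmetricCategory V] [HasColimits V]
  [∀ X : V, PreservesColimits (tensorLeft X)]

instance isIso_dayν : IsIso (dayν V) := by
  obtain ⟨d, hd⟩ := exists_unitLevel_desc (𝟭 V) (𝟙_ LambdaCat) (fun _ => 𝟙 (𝟙_ V))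
  have h1 := hd (𝟙 _)
  simp only [Functor.id_map, Functor.id_obj, op_id, CategoryTheory.Functor.map_id,
    Category.comp_id] at h1
  refine ⟨d, h1, unitLevel_hom_ext (𝟭 V) (𝟙_ LambdaCat) fun t => ?_⟩
  obtain rfl : t = 𝟙 _ := LambdaCat.hom_ext_of_card_eq_zero rfl _ _
  simp only [Functor.id_map, Functor.id_obj, op_id, CategoryTheory.Functor.map_id, Category.comp_id]
  rw [reassoc_of% h1]

/-- As `0` is initial in `Λ`, every term `A(k) ⊗ B(l)` of the colimit restricts to `A(0) ⊗ B(0)`,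
and these restrictions form the inverse. -/
lemma isIso_dayη_zero (A B : DayLambda V) : IsIso (dayη A B (𝟙_ LambdaCat) (𝟙_ LambdaCat)) := by
  have hz (k l : LambdaCat) (t : 𝟙_ LambdaCat ⊗ 𝟙_ LambdaCat ⟶ k ⊗ l) :
      t = LambdaCat.fromZero k ⊗ₘ LambdaCat.fromZero l := LambdaCat.hom_ext_of_card_eq_zero rfl _ _
  obtain ⟨d, hd⟩ := exists_tensorLevel_desc (𝟭 V) A B (𝟙_ LambdaCat ⊗ 𝟙_ LambdaCat)
    (fun k l _ => A.functor.map (LambdaCat.fromZero k).op ⊗ₘ B.functor.map (LambdaCat.fromZero l).op)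
    (fun {k k' l l'} f g _ => by
      rw [Functor.id_map, tensorHom_comp_tensorHom, ← Functor.map_comp, ← Functor.map_comp,
        ← op_comp, ← op_comp,
        LambdaCat.hom_ext_of_card_eq_zero rfl (LambdaCat.fromZero k ≫ f) (LambdaCat.fromZero k'),
        LambdaCat.hom_ext_of_card_eq_zero rfl (LambdaCat.fromZero l ≫ g) (LambdaCat.fromZero l')])
  refine ⟨d, ?_, tensorLevel_hom_ext (𝟭 V) A B _ fun k l t => ?_⟩
  · have h1 := hd _ _ (𝟙 _)
    rw [Functor.id_map, op_id, CategoryTheory.Functor.map_id, Category.comp_id,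
      LambdaCat.hom_ext_of_card_eq_zero rfl (LambdaCat.fromZero (𝟙_ LambdaCat)) (𝟙 (𝟙_ LambdaCat)),
      op_id, CategoryTheory.Functor.map_id, CategoryTheory.Functor.map_id] at h1
    exact h1.trans (id_tensorHom_id _ _)
  · have h1 := hd k l t
    have h2 := dayη_natural A B (LambdaCat.fromZero k) (LambdaCat.fromZero l)
    rw [Functor.id_map] at h1 ⊢
    refine (Category.assoc _ _ _).symm.trans ((congrArg (· ≫ dayη A B _ _) h1).trans (h2.trans ?_))
    rw [← hz k l t]
    exact (Category.comp_id _).symm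

lemma isIso_tensorHom_zero {A A' B B' : DayLambda V} (φ : A ⟶ A') (ψ : B ⟶ B')
    (hφ : IsIso (φ.natTrans.app (op (𝟙_ LambdaCat)))) (hψ : IsIso (ψ.natTrans.app (op (𝟙_ LambdaCat)))) :
    IsIso ((φ ⊗ₘ ψ).natTrans.app (op (𝟙_ LambdaCat))) := by
  have h1 := dayη_tensorHom φ ψ (𝟙_ LambdaCat) (𝟙_ LambdaCat)
  have h2 := isIso_dayη_zero A B
  have h3 := isIso_dayη_zero A' B'
  have h4 : IsIso (dayη A B (𝟙_ LambdaCat) (𝟙_ LambdaCat) ≫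
      (φ ⊗ₘ ψ).natTrans.app (op (𝟙_ LambdaCat ⊗ 𝟙_ LambdaCat))) := by
    rw [h1]
    infer_instance
  exact IsIso.of_isIso_comp_left (dayη A B (𝟙_ LambdaCat) (𝟙_ LambdaCat)) _

lemma isIso_app_of_isIso {A B : DayLambda V} (φ : A ⟶ B) [IsIso φ] (k : LambdaCatᵒᵖ) :
    IsIso (φ.natTrans.app k) :=
  ⟨(inv φ).natTrans.app k, by rw [← day_comp_app, IsIso.hom_inv_id, day_id_app],
    by rw [← day_comp_app, IsIso.inv_hom_id, day_id_app]⟩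

lemma isIso_unitPow_zero {A : DayLambda V} (η : 𝟙_ (DayLambda V) ⟶ A)
    (h : IsIso (η.natTrans.app (op (𝟙_ LambdaCat)))) (n : ℕ) :
    IsIso ((unitPow η n).natTrans.app (op (𝟙_ LambdaCat))) := by
  induction n with
  | zero => exact isIso_app_of_isIso (𝟙 _) _
  | succ n ih =>
    rw [unitPow, day_comp_app]
    exact @IsIso.comp_isIso _ _ _ _ _ _ _ (isIso_app_of_isIso _ _) (isIso_tensorHom_zero _ _ h ih)

/-- If `G(0) ⟶ G(k)` is invertible, the coend relation for `0 ⟶ k` moves the component `k` to the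
component `0`. -/
lemma isIso_tensorOverι_zero (F : LambdaCatᵒᵖ ⥤ V) (G : LambdaCat ⥤ V)
    (h : ∀ k, IsIso (G.map (LambdaCat.fromZero k))) : IsIso (tensorOverι V F G (𝟙_ LambdaCat)) := by
  have hz {k l : LambdaCat} (f : k ⟶ l) : LambdaCat.fromZero k ≫ f = LambdaCat.fromZero l :=
    LambdaCat.hom_ext_of_card_eq_zero rfl _ _
  obtain ⟨d, hd⟩ := exists_tensorOver_desc (F := F) (G := G)
    (fun k => F.map (LambdaCat.fromZero k).op ⊗ₘ inv (G.map (LambdaCat.fromZero k)))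
    (fun {k l} f => by
      have h1 : inv (G.map (LambdaCat.fromZero k)) = G.map f ≫ inv (G.map (LambdaCat.fromZero l)) := by
        rw [IsIso.eq_comp_inv, IsIso.inv_comp_eq, ← Functor.map_comp, hz]
      rw [h1, ← tensorHom_id, ← id_tensorHom, tensorHom_comp_tensorHom, tensorHom_comp_tensorHom,
        ← Functor.map_comp, ← op_comp, hz, Category.id_comp, Category.id_comp])
  refine ⟨d, ?_, tensorOver_hom_ext fun k => ?_⟩
  · have h1 : LambdaCat.fromZero (𝟙_ LambdaCat) = 𝟙 _ := LambdaCat.hom_ext_of_card_eq_zero rfl _ _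
    rw [hd]
    simp [h1]
  · have h1 := tensorOverι_condition F G (LambdaCat.fromZero k)
    rw [reassoc_of% hd, MonoidalCategory.tensorHom_def', Category.assoc, h1,
      ← MonoidalCategory.whiskerLeft_comp_assoc, IsIso.inv_hom_id, MonoidalCategory.whiskerLeft_id,
      Category.id_comp, Category.comp_id]

/-- At level `0` the maps `E^{⊠0} ⟶ E^{⊠k}` are tensor powers of the base map of `E`, hence
invertible, so the coend reduces to its component `k = 0`; the base map is then a composite of
isomorphisms. -/
lemma isUnital_kelly {D E : LambdaSeq V} (hD : isUnital V D) (hE : isUnital V E) :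
    isUnital V (ke D E) := by
  have hD' : IsIso D.hom := hD
  have hE' : IsIso E.hom := hE
  have h1 : IsIso ((dayBase E).natTrans.app (op (𝟙_ LambdaCat))) := by
    have : IsIso (dayν V ≫ (dayBase E).natTrans.app (op (𝟙_ LambdaCat))) := by
      rw [dayν_dayBase]; exact hE'
    exact IsIso.of_isIso_comp_left (dayν V) _
  have h2 := isIso_tensorOverι_zero D.right (((dayPow V).obj E).flip.obj (op ⟨0⟩)) (fun k => by
    have h3 : (pw E).map (LambdaCat.fromZero k) = unitPow (dayBase E) k.card := 
      powMap.eq_1 (dayBase E) k.card (LambdaCat.fromZero k)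
    have h4 := isIso_unitPow_zero (dayBase E) h1 k.card
    rw [← h3] at h4
    exact h4)
  change IsIso (kellyBase V D E)
  have h5 : IsIso (D.right.obj (op ⟨0⟩) ◁ dayν V) := inferInstance
  exact @IsIso.comp_isIso _ _ _ _ _ _ _ hD' (@IsIso.comp_isIso _ _ _ _ _ _ _ inferInstance
    (@IsIso.comp_isIso _ _ _ _ _ _ _ h5 h2))

lemma isUnital_I1 : isUnital V (I1 V) := inferInstanceAs (IsIso (𝟙 (𝟙_ V)))

lemma isMonoidal_isUnital (S : MonoidalOn (kelly V) (I1 V)) :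
    letI := S.monoidalCategory
    (isUnital V).IsMonoidal :=
  letI := S.monoidalCategory
  { prop_unit := isUnital_I1
    prop_tensor := fun _ _ hD hE => isUnital_kelly hD hE }

end Unital

/-! ### Kelly products of the form `(x ⊗ I₁) ⊙ E`. -/

noncomputable section LeftAction
open MonoidalCategory.DayFunctor Functor.LaxMonoidal

variable {V : Type u} [Category.{v} V] [MonoidalCategory V] [SymmetricCategory V] [HasColimits V]
  [∀ X : V, PreservesColimits (tensorLeft X)]

lemma actMap_left_comp {x : V} {A B C : DayLambda V} (f : A ⟶ B) (g : B ⟶ C) :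
    actMap (𝟙 x) (f ≫ g) = actMap (𝟙 x) f ≫ actMap (𝟙 x) g := by
  rw [actMap_comp, Category.comp_id]

variable (S : MonoidalOn (kelly V) (I1 V))

/-- The left unitor of a monoidal structure for the Kelly product. -/
def dayLeft (E : LambdaSeq V) : phi (dayObj (I1 V)) (pw E) ⟶ dayObj E := dayMap (S.leftUnitor E).hom

lemma isIso_dayMap {D E : LambdaSeq V} (f : D ⟶ E) (hf : IsIso f) : IsIso (dayMap f) :=
  ⟨dayMap (inv f), congrArg dayMap (IsIso.hom_inv_id f), congrArg dayMap (IsIso.inv_hom_id f)⟩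

instance isIso_dayLeft (E : LambdaSeq V) : IsIso (dayLeft S E) :=
  isIso_dayMap (S.leftUnitor E).hom inferInstance

lemma dayLeft_natural {E F : LambdaSeq V} (φ : E ⟶ F) :
    phiMapRight (dayObj (I1 V)) (pwMap φ) ≫ dayLeft S F = dayLeft S E ≫ dayMap φ :=
  congrArg dayMap (S.leftUnitor_naturality φ)

/-- A consequence of the axioms of a monoidal category; nothing about the construction of the left
unit isomorphism is used. -/
lemma dayLeft_tensor (hS : S.associator = kellyAssociator) (D E : LambdaSeq V) :
    kellyAssoc (dayObj (I1 V)) D E ≫ phiMap (dayLeft S D) (pw E) = dayLeft S (ke D E) := by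
  have h : (kellyAssociator (I1 V) D E).inv ≫ ((kelly V).map (S.leftUnitor D).hom).app E =
      (S.leftUnitor (ke D E)).hom := by
    let := S.monoidalCategory
    rw [← hS]
    exact (leftUnitor_tensor_hom D E).symm
  exact congrArg dayMap h

/-- The comparison `(x ⊗ I₁) ⊙ E ⟶ x ⊗ E`. -/
def kellyAct (x : V) (E : LambdaSeq V) :
    phi (act x (dayObj (I1 V))) (pw E) ⟶ act x (dayObj E) :=
  phiAct x (dayObj (I1 V)) (pw E) ≫ actMap (𝟙 x) (dayLeft S E)

instance isIso_kellyAct (x : V) (E : LambdaSeq V) : IsIso (kellyAct S x E) :=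
  @IsIso.comp_isIso _ _ _ _ _ _ _ (isIso_phiAct _ _ _) (isIso_actMap _ _)

lemma kellyAct_natural_left {x y : V} (f : x ⟶ y) (E : LambdaSeq V) :
    phiMap (actMap f (𝟙 (dayObj (I1 V)))) (pw E) ≫ kellyAct S y E =
      kellyAct S x E ≫ actMap f (𝟙 (dayObj E)) := by
  have h := (reassoc_of% (phiAct_natural (pw E) f (𝟙 (dayObj (I1 V))))) (actMap (𝟙 y) (dayLeft S E))
  rw [kellyAct, h, kellyAct, Category.assoc, actMap_comp, actMap_comp, phiMap_id]
  simp only [Category.comp_id, Category.id_comp]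

lemma kellyAct_natural_right (x : V) {E F : LambdaSeq V} (φ : E ⟶ F) :
    phiMapRight (act x (dayObj (I1 V))) (pwMap φ) ≫ kellyAct S x F =
      kellyAct S x E ≫ actMap (𝟙 x) (dayMap φ) := by
  have h := (reassoc_of% (phiAct_mapRight (pw E) (pwMap φ) x (dayObj (I1 V)))) (actMap (𝟙 x) (dayLeft S F))
  rw [kellyAct, h, kellyAct, Category.assoc, ← actMap_left_comp, ← actMap_left_comp, dayLeft_natural]

/-- The comparison `(x ⊗ I₁) ⊙ (D ⊙ E) ⟶ x ⊗ (D ⊙ E)`. -/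
def kellyActKelly (x : V) (D E : LambdaSeq V) :
    phi (act x (dayObj (I1 V))) (pw (ke D E)) ⟶ act x (phi (dayObj D) (pw E)) :=
  kellyAct S x (ke D E)

lemma kellyActKelly_natural (x : V) {D E F : LambdaSeq V} (m : ke D E ⟶ F)
    (g : phi (dayObj D) (pw E) ⟶ dayObj F) (hg : dayMap m = g) :
    phiMapRight (act x (dayObj (I1 V))) (pwMap m) ≫ kellyAct S x F =
      kellyActKelly S x D E ≫ actMap (𝟙 x) g := by
  subst hg
  exact kellyAct_natural_right S x m

/-- `kellyAssoc_linear` takes the action of `x` out of the associativity isomorphism, and what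
remains is `dayLeft_tensor`. -/
lemma kellyAct_assoc (hS : S.associator = kellyAssociator) (x : V) (D E : LambdaSeq V) :
    kellyActKelly S x D E = kellyAssoc (act x (dayObj (I1 V))) D E ≫
      phiMap (kellyAct S x D) (pw E) ≫ phiAct x (dayObj D) (pw E) := by
  have h1 := kellyAssoc_linear x (dayObj (I1 V)) D E
  have h2 := phiAct_natural (pw E) (𝟙 x) (dayLeft S D)
  have h3 : actMap (𝟙 x) (dayLeft S (ke D E)) = actMap (𝟙 x) (kellyAssoc (dayObj (I1 V)) D E) ≫
      actMap (𝟙 x) (phiMap (dayLeft S D) (pw E)) := by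
    rw [actMap_comp, Category.comp_id]
    exact congrArg (actMap (𝟙 x)) (dayLeft_tensor S hS D E).symm
  have h4 : phiAct x (dayObj (I1 V)) (pw (ke D E)) ≫
      actMap (𝟙 x) (kellyAssoc (dayObj (I1 V)) D E) ≫ actMap (𝟙 x) (phiMap (dayLeft S D) (pw E)) =
      kellyAssoc (act x (dayObj (I1 V))) D E ≫ phiMap (phiAct x (dayObj (I1 V)) (pw D)) (pw E) ≫
        phiAct x (phi (dayObj (I1 V)) (pw D)) (pw E) ≫ actMap (𝟙 x) (phiMap (dayLeft S D) (pw E)) := by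
    rw [← cancel_epi (phiActInv x (dayObj (I1 V)) (pw (ke D E))), reassoc_of% phiActInv_hom, reassoc_of% h1,
      ← reassoc_of% phiMap_comp, phiActInv_hom, phiMap_id, Category.id_comp, reassoc_of% phiActInv_hom]
  refine (congrArg (phiAct x (dayObj (I1 V)) (pw (ke D E)) ≫ ·) h3).trans (h4.trans ?_)
  rw [kellyAct, phiMap_comp, Category.assoc, h2]

lemma actUnit_kellyAct (E : LambdaSeq V) :
    phiMap (actUnit (dayObj (I1 V))) (pw E) ≫ kellyAct S (𝟙_ V) E = dayLeft S E ≫ actUnit (dayObj E) := by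
  rw [kellyAct, reassoc_of% (phiAct_unit (pw E) (dayObj (I1 V))), actUnit_natural]

lemma actAssoc_kellyAct (x y : V) (E : LambdaSeq V) :
    phiMap (actAssoc x y (dayObj (I1 V))) (pw E) ≫ phiAct x (act y (dayObj (I1 V))) (pw E) ≫
      actMap (𝟙 x) (kellyAct S y E) = kellyAct S (x ⊗ y) E ≫ actAssoc x y (dayObj E) := by
  have h1 := phiAct_assoc (pw E) x y (dayObj (I1 V))
  have h2 := actAssoc_natural (𝟙 x) (𝟙 y) (dayLeft S E)
  rw [id_tensorHom_id] at h2
  rw [kellyAct, kellyAct, actMap_left_comp, reassoc_of% h1, Category.assoc, h2]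

lemma phiMap_phiMapRight {A B : DayLambda V} (f : A ⟶ B) {G H : LambdaCat ⥤ DayLambda V} (g : G ⟶ H) :
    phiMap f G ≫ phiMapRight B g = phiMapRight A g ≫ phiMap f H :=
  (phiNat g).naturality f

lemma phiMap_pw_I1_injective {A B : DayLambda V} {f g : A ⟶ B}
    (h : phiMap f (pw (I1 V)) = phiMap g (pw (I1 V))) : f = g := by
  rw [← cancel_mono (kellyRight B), kellyRight_natural, kellyRight_natural, h]

/-- The right unit isomorphism `r` is accessible only through the triangle, which involves `r ⊙ I₁`.
As `- ⊙ I₁` is faithful, the equation may be proved after applying it, and there the triangle trades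
`r` for the left unit isomorphism. -/
lemma dayRight_eq (hS : S.associator = kellyAssociator) {x : V} {D : LambdaSeq V}
    (j : dayObj D ⟶ act x (dayObj (I1 V))) :
    phiMap j (pw (I1 V)) ≫ kellyAct S x (I1 V) =
      (dayMap (S.rightUnitor D).hom : phi (dayObj D) (pw (I1 V)) ⟶ dayObj D) ≫ j := by
  let r : phi (dayObj D) (pw (I1 V)) ⟶ dayObj D := dayMap (S.rightUnitor D).hom
  let l : ke (I1 V) (I1 V) ⟶ I1 V := (S.leftUnitor (I1 V)).hom
  have tri : kellyAssoc (dayObj D) (I1 V) (I1 V) ≫ phiMap r (pw (I1 V)) =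
      phiMapRight (dayObj D) (pwMap l) := by
    have h : (kellyAssociator D (I1 V) (I1 V)).inv ≫ ((kelly V).map (S.rightUnitor D).hom).app (I1 V) =
        ((kelly V).obj D).map (S.leftUnitor (I1 V)).hom := by
      rw [← hS, Iso.inv_comp_eq, S.triangle]
    exact congrArg dayMap h
  refine (phiMap_pw_I1_injective ?_).symm
  rw [← cancel_epi (kellyAssoc (dayObj D) (I1 V) (I1 V)), ← cancel_mono (kellyAct S x (I1 V))]
  have h1 := kellyAct_assoc S hS x (I1 V) (I1 V)
  have h2 := kellyActKelly_natural S x l (dayLeft S (I1 V)) rfl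
  have h3 := kellyAssoc_natural j (I1 V) (I1 V)
  have h4 : kellyAct S x (I1 V) = phiAct x (dayObj (I1 V)) (pw (I1 V)) ≫
    actMap (𝟙 x) (dayLeft S (I1 V)) := rfl
  have h5 : phiMapRight (act x (dayObj (I1 V))) (pwMap l) ≫ kellyAct S x (I1 V) =
      kellyAssoc (act x (dayObj (I1 V))) (I1 V) (I1 V) ≫
        phiMap (kellyAct S x (I1 V)) (pw (I1 V)) ≫ kellyAct S x (I1 V) := by
    rw [h2, h1]
    simp only [Category.assoc]
    rw [← h4]
  change (_ ≫ phiMap (r ≫ j) (pw (I1 V))) ≫ _ = _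
  rw [phiMap_comp, phiMap_comp, Category.assoc, Category.assoc, Category.assoc, Category.assoc, ← reassoc_of% h3,
    ← h5, reassoc_of% tri, ← Category.assoc, ← phiMap_phiMapRight, Category.assoc]

section
variable (x : V) {y z : V} {D E : LambdaSeq V} (j : dayObj D ⟶ act y (dayObj (I1 V)))
  (k : dayObj E ⟶ act z (dayObj (I1 V)))

/-- The comparison `(x ⊗ I₁) ⊙ D ⟶ (x ⊗ y) ⊗ I₁` for an identification of `D` with `y ⊗ I₁`. -/
def actComp : phi (act x (dayObj (I1 V))) (pw D) ⟶ act (x ⊗ y) (dayObj (I1 V)) :=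
  kellyAct S x D ≫ actMap (𝟙 x) j ≫ inv (actAssoc x y (dayObj (I1 V)))

instance isIso_actComp [IsIso j] : IsIso (actComp S x j) :=
  @IsIso.comp_isIso _ _ _ _ _ _ _ (isIso_kellyAct S x D)
    (@IsIso.comp_isIso _ _ _ _ _ _ _ (isIso_actMap _ _) inferInstance)

lemma actComp_actAssoc : actComp S x j ≫ actAssoc x y (dayObj (I1 V)) = kellyAct S x D ≫ actMap (𝟙 x) j := by
  rw [actComp, Category.assoc, Category.assoc, IsIso.inv_hom_id, Category.comp_id]

lemma actComp_natural_left {x' : V} (f : x ⟶ x') :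
    phiMap (actMap f (𝟙 (dayObj (I1 V)))) (pw D) ≫ actComp S x' j =
      actComp S x j ≫ actMap (f ▷ y) (𝟙 (dayObj (I1 V))) := by
  have h := actAssoc_natural f (𝟙 y) (𝟙 (dayObj (I1 V)))
  rw [tensorHom_id, actMap_id] at h
  rw [← cancel_mono (actAssoc x' y (dayObj (I1 V))), Category.assoc, actComp_actAssoc,
    reassoc_of% kellyAct_natural_left, Category.assoc, h, reassoc_of% actComp_actAssoc, actMap_comp, actMap_comp]
  simp only [Category.comp_id, Category.id_comp]

lemma actComp_natural_right {y' : V} (f : y ⟶ y') {D' : LambdaSeq V} (φ : D ⟶ D')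
    (j' : dayObj D' ⟶ act y' (dayObj (I1 V)))
    (h : dayMap φ ≫ j' = j ≫ actMap f (𝟙 (dayObj (I1 V)))) :
    phiMapRight (act x (dayObj (I1 V))) (pwMap φ) ≫ actComp S x j' =
      actComp S x j ≫ actMap (x ◁ f) (𝟙 (dayObj (I1 V))) := by
  have h1 := actAssoc_natural (𝟙 x) f (𝟙 (dayObj (I1 V)))
  rw [id_tensorHom] at h1
  rw [← cancel_mono (actAssoc x y' (dayObj (I1 V))), Category.assoc, actComp_actAssoc,
    reassoc_of% kellyAct_natural_right, Category.assoc, h1, reassoc_of% actComp_actAssoc, ← actMap_left_comp,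
    ← actMap_left_comp, h]

/-- Here `F` stands for `(y ⊗ z) ⊗ I₁`, with `m` the comparison out of `D ⊙ E` and `h` its
description by `actComp`. The equation is the associativity of the monoidal structure of `i1`; it
combines `kellyAct_assoc` with the pentagon of the action. -/
lemma actComp_assoc (hS : S.associator = kellyAssociator) {F : LambdaSeq V} (m : ke D E ⟶ F)
    (l : dayObj F ⟶ act (y ⊗ z) (dayObj (I1 V)))
    (h : (dayMap m : phi (dayObj D) (pw E) ⟶ dayObj F) ≫ l = phiMap j (pw E) ≫ actComp S y k) :
    kellyAssoc (act x (dayObj (I1 V))) D E ≫ phiMap (actComp S x j) (pw E) ≫ actComp S (x ⊗ y) k ≫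
        actMap (α_ x y z).hom (𝟙 (dayObj (I1 V))) =
      phiMapRight (act x (dayObj (I1 V))) (pwMap m) ≫ actComp S x l := by
  have h1 := actAssoc_pentagon x y z (dayObj (I1 V))
  have h2 := kellyAct_assoc S hS x D E
  have h3 := actAssoc_kellyAct S x y E
  have h4 := actAssoc_natural (𝟙 x) (𝟙 y) k
  rw [id_tensorHom_id] at h4
  have h5 := kellyActKelly_natural S x m _ rfl
  have h6 := phiAct_natural (pw E) (𝟙 x) j
  have h7 : actMap (𝟙 x) (dayMap m : phi (dayObj D) (pw E) ⟶ dayObj F) ≫ actMap (𝟙 x) l =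
      actMap (𝟙 x) (phiMap j (pw E)) ≫ actMap (𝟙 x) (actComp S y k) := by
    exact (actMap_left_comp _ _).symm.trans ((congrArg (actMap (𝟙 x)) h).trans (actMap_left_comp _ _))
  have h8 : kellyAssoc (act x (dayObj (I1 V))) D E ≫
      phiMap (kellyAct S x D ≫ actMap (𝟙 x) j) (pw E) ≫
        phiAct x (act y (dayObj (I1 V))) (pw E) ≫ actMap (𝟙 x) (kellyAct S y E ≫ actMap (𝟙 y) k) =
      kellyActKelly S x D E ≫ actMap (𝟙 x) (phiMap j (pw E)) ≫ actMap (𝟙 x) (actComp S y k) ≫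
        actMap (𝟙 x) (actAssoc y z (dayObj (I1 V))) := by
    rw [← actMap_left_comp (actComp S y k), actComp_actAssoc, h2, phiMap_comp]
    simp only [Category.assoc]
    rw [reassoc_of% h6]
  rw [← cancel_mono (actAssoc x (y ⊗ z) (dayObj (I1 V))),
    ← cancel_mono (actMap (𝟙 x) (actAssoc y z (dayObj (I1 V))))]
  simp only [Category.assoc]
  rw [← h1, reassoc_of% actComp_actAssoc, reassoc_of% actComp_actAssoc, h4, ← reassoc_of% h3,
    ← reassoc_of% phiMap_comp, actComp_actAssoc, ← actMap_left_comp, reassoc_of% h5]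
  refine h8.trans (congrArg (kellyActKelly S x D E ≫ ·) ((Category.assoc _ _ _).symm.trans
    ((congrArg (· ≫ actMap (𝟙 x) (actAssoc y z (dayObj (I1 V)))) h7).trans
      (Category.assoc _ _ _)))).symm

lemma actUnit_actComp : phiMap (actUnit (dayObj (I1 V))) (pw D) ≫ actComp S (𝟙_ V) j ≫
    actMap (λ_ y).hom (𝟙 (dayObj (I1 V))) = dayLeft S D ≫ j := by
  have h1 : actMap (λ_ y).hom (𝟙 (dayObj (I1 V))) ≫ actUnit (act y (dayObj (I1 V))) =
      actAssoc (𝟙_ V) y (dayObj (I1 V)) := by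
    rw [actUnit_actAssoc, ← Category.assoc, actMap_comp, Iso.hom_inv_id, Category.comp_id, actMap_id,
      Category.id_comp]
  rw [← cancel_mono (actUnit (act y (dayObj (I1 V)))), Category.assoc, Category.assoc, h1,
    actComp_actAssoc, reassoc_of% actUnit_kellyAct, Category.assoc, actUnit_natural]

lemma act_triangle (A : DayLambda V) : actMap (ρ_ x).inv (𝟙 A) ≫ actAssoc x (𝟙_ V) A =
    actMap (𝟙 x) (actUnit A) :=
  day_ext fun k => by
    simp only [day_comp_app, actAssoc_app, actMap_app, actUnit_app, day_id_app, tensorHom_id,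
      id_tensorHom]
    simp

lemma actComp_unit (i : dayObj D ⟶ act (𝟙_ V) (dayObj (I1 V))) (e : I1 V ⟶ D)
    (h : dayMap e ≫ i = actUnit (dayObj (I1 V))) :
    phiMapRight (act x (dayObj (I1 V))) (pwMap e) ≫ actComp S x i ≫
      actMap (ρ_ x).hom (𝟙 (dayObj (I1 V))) = kellyAct S x (I1 V) := by
  have h2 := act_triangle x (dayObj (I1 V))
  have h3 : actMap (ρ_ x).hom (𝟙 (dayObj (I1 V))) ≫ actMap (𝟙 x) (actUnit (dayObj (I1 V))) =
      actAssoc x (𝟙_ V) (dayObj (I1 V)) := by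
    rw [← h2, ← Category.assoc, actMap_comp, Iso.hom_inv_id, Category.comp_id, actMap_id,
      Category.id_comp]
  rw [← cancel_mono (actMap (𝟙 x) (actUnit (dayObj (I1 V)))), Category.assoc, Category.assoc, h3,
    actComp_actAssoc, reassoc_of% kellyAct_natural_right, ← actMap_left_comp, h]

/-- The value of the comparison on the structure maps from `I₁`. It makes the comparison a morphism
under `I₁`, and the compatibility with base maps also follows from it. -/
lemma actComp_str (ηx : 𝟙_ V ⟶ x) (ηy : 𝟙_ V ⟶ y) (s : I1 V ⟶ D)
    (h : dayMap s ≫ j = actUnit (dayObj (I1 V)) ≫ actMap ηy (𝟙 (dayObj (I1 V)))) :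
    phiMap (actUnit (dayObj (I1 V)) ≫ actMap ηx (𝟙 (dayObj (I1 V)))) (pw (I1 V)) ≫
        phiMapRight (act x (dayObj (I1 V))) (pwMap s) ≫ actComp S x j =
      dayLeft S (I1 V) ≫ actUnit (dayObj (I1 V)) ≫
        actMap ((λ_ (𝟙_ V)).inv ≫ (ηx ⊗ₘ ηy)) (𝟙 (dayObj (I1 V))) := by
  have h1 : actMap ((λ_ (𝟙_ V)).inv ≫ (ηx ⊗ₘ ηy)) (𝟙 (dayObj (I1 V))) ≫
      actAssoc x y (dayObj (I1 V)) = actUnit (act (𝟙_ V) (dayObj (I1 V))) ≫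
        actMap ηx (actMap ηy (𝟙 (dayObj (I1 V)))) := by
    have h2 := actAssoc_natural ηx ηy (𝟙 (dayObj (I1 V)))
    have h3 : actMap ((λ_ (𝟙_ V)).inv ≫ (ηx ⊗ₘ ηy)) (𝟙 (dayObj (I1 V))) =
        actMap (λ_ (𝟙_ V)).inv (𝟙 (dayObj (I1 V))) ≫ actMap (ηx ⊗ₘ ηy) (𝟙 (dayObj (I1 V))) := by
      rw [actMap_comp, Category.comp_id]
    rw [h3, Category.assoc, h2, actUnit_actAssoc, Category.assoc]
  have h4 : actMap ηx (𝟙 (dayObj (I1 V))) ≫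
      actMap (𝟙 x) (actUnit (dayObj (I1 V)) ≫ actMap ηy (𝟙 (dayObj (I1 V)))) =
      actMap (𝟙 (𝟙_ V)) (actUnit (dayObj (I1 V))) ≫ actMap ηx (actMap ηy (𝟙 (dayObj (I1 V)))) := by
    rw [actMap_comp, actMap_comp, Category.id_comp, Category.id_comp, Category.comp_id]
  rw [← cancel_mono (actAssoc x y (dayObj (I1 V)))]
  simp only [Category.assoc]
  rw [h1, actComp_actAssoc, reassoc_of% kellyAct_natural_right, ← actMap_left_comp, h, phiMap_comp,
    Category.assoc, reassoc_of% kellyAct_natural_left, h4, reassoc_of% actUnit_kellyAct,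
    ← reassoc_of% (actUnit_natural (actUnit (dayObj (I1 V))))]

end

end LeftAction

/-! ### The strong monoidal structure of `X ↦ X ⊗ I₁`. -/

noncomputable section I1Functor
open MonoidalCategory.DayFunctor Functor.LaxMonoidal

variable {V : Type u} [Category.{v} V] [MonoidalCategory V] [SymmetricCategory V] [HasColimits V]
  [∀ X : V, PreservesColimits (tensorLeft X)]

/-- The `Λ`-sequence `X ⊗ I₁`. -/
def i1Seq (X : Under (𝟙_ V)) : LambdaSeq V := ((i1 V).obj X).right

/-- The structure map of `X ⊗ I₁`. -/
def i1Str (X : Under (𝟙_ V)) : I1 V ⟶ i1Seq X := ((i1 V).obj X).hom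

/-- Functoriality of `X ⊗ I₁`. -/
def i1Map {X Y : Under (𝟙_ V)} (f : X ⟶ Y) : i1Seq X ⟶ i1Seq Y := ((i1 V).map f).right

/-- The identification of the Day functor of `X ⊗ I₁`. -/
def i1Day (X : Under (𝟙_ V)) : dayObj (i1Seq X) ⟶ act X.right (dayObj (I1 V)) := 𝟙 (dayObj (i1Seq X))

instance isIso_i1Day (X : Under (𝟙_ V)) : IsIso (i1Day X) :=
  inferInstanceAs (IsIso (𝟙 (dayObj (i1Seq X))))

/-- `i1Day X` is an identity morphism; it is written out so that the results on `actComp` apply,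
although `X ⊗ I₁` is defined as a composite of functors and not by `act`. -/
lemma dayMap_i1Str (X : Under (𝟙_ V)) : dayMap (i1Str X) ≫ i1Day X =
    actUnit (dayObj (I1 V)) ≫ actMap X.hom (𝟙 (dayObj (I1 V))) :=
  (Category.comp_id (dayMap (i1Str X))).trans (day_ext fun k =>
    congrArg ((λ_ ((I1 V).right.obj (op k))).inv ≫ ·)
      (tensorHom_id X.hom ((I1 V).right.obj (op k))).symm)

lemma dayMap_i1Map {X Y : Under (𝟙_ V)} (f : X ⟶ Y) :
    dayMap (i1Map f) = (actMap f.right (𝟙 (dayObj (I1 V))) :) :=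
  day_ext fun k => (tensorHom_id f.right ((I1 V).right.obj (op k))).symm

lemma dayMap_i1Map_i1Day {X Y : Under (𝟙_ V)} (f : X ⟶ Y) : dayMap (i1Map f) ≫ i1Day Y =
    i1Day X ≫ actMap f.right (𝟙 (dayObj (I1 V))) :=
  (Category.comp_id (dayMap (i1Map f))).trans ((dayMap_i1Map f).trans
    (Category.id_comp (actMap f.right (𝟙 (dayObj (I1 V))))).symm)

variable (S : MonoidalOn (kelly V) (I1 V))

/-- The comparison `(X ⊗ I₁) ⊙ (Y ⊗ I₁) ⟶ (X ⊗ Y) ⊗ I₁` of Day functors. -/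
def i1μDay (X Y : Under (𝟙_ V)) : dayObj (ke (i1Seq X) (i1Seq Y)) ⟶ dayObj (i1Seq (X ⊗ Y)) :=
  actComp S X.right (i1Day Y)

lemma i1Str_i1μDay (X Y : Under (𝟙_ V)) :
    phiMap (dayMap (i1Str X)) (pw (I1 V)) ≫ phiMapRight (dayObj (i1Seq X)) (pwMap (i1Str Y)) ≫
      i1μDay S X Y = dayLeft S (I1 V) ≫ dayMap (i1Str (X ⊗ Y)) := by
  have h1 := actComp_str S X.right (i1Day Y) X.hom Y.hom (i1Str Y) (dayMap_i1Str Y)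
  rw [← dayMap_i1Str X] at h1
  refine (Eq.trans ?_ h1).trans ?_
  · exact congrArg (fun t => phiMap t (pw (I1 V)) ≫ phiMapRight (dayObj (i1Seq X)) (pwMap (i1Str Y)) ≫
      i1μDay S X Y) (Category.comp_id (dayMap (i1Str X))).symm
  · exact congrArg (dayLeft S (I1 V) ≫ ·) ((dayMap_i1Str (X ⊗ Y)).symm.trans
      (Category.comp_id (dayMap (i1Str (X ⊗ Y)))))

/-- The base map of a Kelly product comes from that of the product of the sources. -/
lemma dayBase_bifunctorMap {D D' E E' : LambdaSeq V} (f : D ⟶ D') (g : E ⟶ E') :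
    dayBase (ke D E) ≫ phiMap (dayMap f) (pw E) ≫ phiMapRight (dayObj D') (pwMap g) =
      dayBase (ke D' E') :=
  dayBase_map (bifunctorMap (kelly V) f g)

/-- The base map of a Kelly product of sequences under `I₁` factors through that of `I₁ ⊙ I₁`.
Compatibility with base maps therefore follows from `i1Str_i1μDay`. -/
lemma dayBase_i1μDay (X Y : Under (𝟙_ V)) :
    dayBase (ke (i1Seq X) (i1Seq Y)) ≫ i1μDay S X Y = dayBase (i1Seq (X ⊗ Y)) := by
  have h1 := dayBase_bifunctorMap (i1Str X) (i1Str Y)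
  have h2 : dayBase (ke (I1 V) (I1 V)) ≫ dayLeft S (I1 V) = dayBase (I1 V) :=
    dayBase_map (S.leftUnitor (I1 V)).hom
  refine (congrArg (· ≫ i1μDay S X Y) h1.symm).trans ?_
  refine (Category.assoc _ _ _).trans ((congrArg (dayBase (ke (I1 V) (I1 V)) ≫ ·)
    ((Category.assoc _ _ _).trans (i1Str_i1μDay S X Y))).trans ?_)
  refine (Category.assoc _ _ _).symm.trans ((congrArg (· ≫ dayMap (i1Str (X ⊗ Y))) h2).trans ?_)
  exact dayBase_map (i1Str (X ⊗ Y))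

/-- The comparison `(X ⊗ I₁) ⊙ (Y ⊗ I₁) ≅ (X ⊗ Y) ⊗ I₁`. -/
def i1μ (X Y : Under (𝟙_ V)) : ke (i1Seq X) (i1Seq Y) ≅ i1Seq (X ⊗ Y) :=
  lambdaIso (i1μDay S X Y) (dayBase_i1μDay S X Y) (isIso_actComp S X.right (i1Day Y))

lemma i1Str_unit : dayMap (i1Str (𝟙_ (Under (𝟙_ V)))) ≫ i1Day (𝟙_ (Under (𝟙_ V))) =
    actUnit (dayObj (I1 V)) :=
  (dayMap_i1Str (𝟙_ (Under (𝟙_ V)))).trans ((congrArg (actUnit (dayObj (I1 V)) ≫ ·)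
    (actMap_id (𝟙_ V) (dayObj (I1 V)))).trans (Category.comp_id _))

/-- The comparison `I₁ ≅ 𝟙_ ⊗ I₁`. -/
def i1ε : I1 V ≅ i1Seq (𝟙_ (Under (𝟙_ V))) :=
  lambdaIso (dayMap (i1Str (𝟙_ (Under (𝟙_ V))))) (dayBase_map _) (by
    have h : dayMap (i1Str (𝟙_ (Under (𝟙_ V)))) = actUnit (dayObj (I1 V)) :=
      (Category.comp_id _).symm.trans i1Str_unit
    rw [h]
    exact isIso_actUnit _)

lemma i1ε_hom : (i1ε : I1 V ≅ _).hom = i1Str (𝟙_ (Under (𝟙_ V))) := lambda_hom_ext rfl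

lemma i1μ_natural_left {X X' : Under (𝟙_ V)} (f : X ⟶ X') (Y : Under (𝟙_ V)) :
    ((kelly V).map (i1Map f)).app (i1Seq Y) ≫ (i1μ S X' Y).hom =
      (i1μ S X Y).hom ≫ i1Map (f ▷ Y) := by
  refine lambda_hom_ext ?_
  have h1 := actComp_natural_left S X.right (i1Day Y) f.right
  refine (congrArg (fun t => phiMap t (pw (i1Seq Y)) ≫ i1μDay S X' Y) (dayMap_i1Map f)).trans
    (h1.trans ?_)
  exact congrArg (i1μDay S X Y ≫ ·) (dayMap_i1Map (f ▷ Y)).symm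

lemma i1μ_natural_right (X : Under (𝟙_ V)) {Y Y' : Under (𝟙_ V)} (f : Y ⟶ Y') :
    ((kelly V).obj (i1Seq X)).map (i1Map f) ≫ (i1μ S X Y').hom =
      (i1μ S X Y).hom ≫ i1Map (X ◁ f) := by
  refine lambda_hom_ext ?_
  have h1 := actComp_natural_right S X.right (i1Day Y) f.right (i1Map f) (i1Day Y') (dayMap_i1Map_i1Day f)
  exact h1.trans (congrArg (i1μDay S X Y ≫ ·) (dayMap_i1Map (X ◁ f)).symm)

lemma i1μ_assoc (hS : S.associator = kellyAssociator) (X Y Z : Under (𝟙_ V)) :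
    ((kelly V).map (i1μ S X Y).hom).app (i1Seq Z) ≫ (i1μ S (X ⊗ Y) Z).hom ≫ i1Map (α_ X Y Z).hom =
      (S.associator (i1Seq X) (i1Seq Y) (i1Seq Z)).hom ≫
        ((kelly V).obj (i1Seq X)).map (i1μ S Y Z).hom ≫ (i1μ S X (Y ⊗ Z)).hom := by
  rw [hS, ← Iso.inv_comp_eq]
  refine lambda_hom_ext ?_
  have h0 : dayMap (i1μ S Y Z).hom ≫ i1Day (Y ⊗ Z) = (phiMap (i1Day Y) (pw (i1Seq Z)) ≫
      actComp S Y.right (i1Day Z) :) :=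
    (Category.comp_id (i1μDay S Y Z)).trans ((Category.id_comp (i1μDay S Y Z)).symm.trans
      (congrArg (· ≫ i1μDay S Y Z) (phiMap_id (pw (i1Seq Z)) (dayObj (i1Seq Y)))).symm)
  have h1 := actComp_assoc S X.right (i1Day Y) (i1Day Z) hS (i1μ S Y Z).hom (i1Day (Y ⊗ Z)) h0
  refine Eq.trans ?_ h1
  exact congrArg (fun t => kellyAssoc (act X.right (dayObj (I1 V))) (i1Seq Y) (i1Seq Z) ≫
    phiMap (actComp S X.right (i1Day Y)) (pw (i1Seq Z)) ≫
      actComp S (X.right ⊗ Y.right) (i1Day Z) ≫ t) (dayMap_i1Map (α_ X Y Z).hom)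

lemma i1_left_unitality (X : Under (𝟙_ V)) : (S.leftUnitor (i1Seq X)).hom =
    ((kelly V).map i1ε.hom).app (i1Seq X) ≫ (i1μ S (𝟙_ _) X).hom ≫ i1Map (λ_ X).hom := by
  refine lambda_hom_ext ?_
  have h1 := actUnit_actComp S (i1Day X)
  rw [← i1Str_unit] at h1
  refine (Category.comp_id (dayLeft S (i1Seq X))).symm.trans (h1.symm.trans ?_)
  refine (congrArg (fun t => phiMap t (pw (i1Seq X)) ≫ actComp S (𝟙_ V) (i1Day X) ≫
    actMap (λ_ X.right).hom (𝟙 (dayObj (I1 V)))) (Category.comp_id (dayMap (i1Str (𝟙_ (Under (𝟙_ V))))))).trans ?_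
  exact congrArg (fun t => phiMap (dayMap (i1Str (𝟙_ (Under (𝟙_ V))))) (pw (i1Seq X)) ≫
    i1μDay S (𝟙_ _) X ≫ t) (dayMap_i1Map (λ_ X).hom).symm

/-- `dayRight_eq` expresses the right unit isomorphism by `kellyAct` at `I₁`, which `actComp_unit`
computes. -/
lemma i1_right_unitality (hS : S.associator = kellyAssociator) (X : Under (𝟙_ V)) :
    (S.rightUnitor (i1Seq X)).hom =
      ((kelly V).obj (i1Seq X)).map i1ε.hom ≫ (i1μ S X (𝟙_ _)).hom ≫ i1Map (ρ_ X).hom := by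
  rw [i1ε_hom]
  refine lambda_hom_ext ?_
  have h1 := actComp_unit S X.right (i1Day (𝟙_ _)) (i1Str (𝟙_ (Under (𝟙_ V)))) i1Str_unit
  have h2 := dayRight_eq S hS (i1Day X)
  have h3 : phiMap (i1Day X) (pw (I1 V)) ≫ kellyAct S X.right (I1 V) = kellyAct S X.right (I1 V) :=
    (congrArg (· ≫ kellyAct S X.right (I1 V)) (phiMap_id (pw (I1 V)) (dayObj (i1Seq X)))).trans
      (Category.id_comp (kellyAct S X.right (I1 V)))
  refine (Category.comp_id (dayMap (S.rightUnitor (i1Seq X)).hom)).symm.trans (h2.symm.trans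
    (h3.trans (h1.symm.trans ?_)))
  exact congrArg (fun t => phiMapRight (dayObj (i1Seq X)) (pwMap (i1Str (𝟙_ (Under (𝟙_ V))))) ≫
    i1μDay S X (𝟙_ _) ≫ t) (dayMap_i1Map (ρ_ X).hom).symm

lemma i1Str_i1μ (X Y : Under (𝟙_ V)) :
    ((S.leftUnitor (I1 V)).inv ≫ bifunctorMap (kelly V) (i1Str X) (i1Str Y)) ≫ (i1μ S X Y).hom =
      i1Str (X ⊗ Y) := by
  rw [Category.assoc, Iso.inv_comp_eq]
  exact lambda_hom_ext ((Category.assoc _ _ _).trans (i1Str_i1μDay S X Y))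

/-- The functor `X ↦ X ⊗ I₁` is strong monoidal. -/
def i1CoreMonoidal (hS : S.associator = kellyAssociator) :
    letI := S.under
    (i1 V).CoreMonoidal :=
  letI := S.under
  { εIso := Under.isoMk i1ε ((Category.id_comp _).trans i1ε_hom)
    μIso := fun X Y => Under.isoMk (i1μ S X Y) (i1Str_i1μ S X Y)
    μIso_hom_natural_left := fun f Y => Under.UnderMorphism.ext (i1μ_natural_left S f Y)
    μIso_hom_natural_right := fun X f => Under.UnderMorphism.ext (i1μ_natural_right S X f)
    associativity := fun X Y Z => Under.UnderMorphism.ext (i1μ_assoc S hS X Y Z)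
    left_unitality := fun X => Under.UnderMorphism.ext (i1_left_unitality S X)
    right_unitality := fun X => Under.UnderMorphism.ext (i1_right_unitality S hS X) }

end I1Functor

theorem mainTheorem2 (V : Type u) [Category.{v} V] [MonoidalCategory V] [SymmetricCategory V]
    [HasColimits V] [∀ X : V, PreservesColimits (tensorLeft X)] :
    ∃ S : MonoidalOn (kelly V) (I1 V),
      letI := S.monoidalCategory
      (∃ _ : (isUnital V).IsMonoidal,
        (∀ D E : (isUnital V).FullSubcategory,
          (D ⊗ E).obj = ((kelly V).obj D.obj).obj E.obj) ∧
        (𝟙_ (isUnital V).FullSubcategory).obj = I1 V) ∧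
      letI := S.under
      (∀ D E : Under (I1 V), (D ⊗ E).right = ((kelly V).obj D.right).obj E.right) ∧
      𝟙_ (Under (I1 V)) = Under.mk (𝟙 (I1 V)) ∧
      Nonempty (i1 V).Monoidal := by
  obtain ⟨S, hS⟩ := exists_kelly_monoidalOn V
  refine ⟨S, ⟨isMonoidal_isUnital S, fun _ _ => rfl, rfl⟩, fun _ _ => rfl, rfl, ?_⟩
  let := S.under
  exact ⟨(i1CoreMonoidal S hS).toMonoidal⟩
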